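/- \textbf{Setting.} A finite automaton has finitely many states, a transition relation, one initial and one final state. A \emph{shared memory concurrent program} $S=(\Sigma,M,(A_i)_{i\in[1..t]})$ consists of a finite alphabet $\Sigma$ of operations, a nondeterministic finite automaton $M$ over $\Sigma$ (the memory) with $m$ states, and nondeterministic finite automata $A_1,\dots,A_t$ (the threads), where $A_i$ is over the alphabet $\Sigma\times\{i\}$. Its language $L(S)$ is the set of words $u\in(\Sigma\times[1..t])^*$ such that $M$ accepts the projection of $u$ to $\Sigma^*$ and, for every $i\in[1..t]$, the restriction of $u$ to the letters in $\Sigma\times\{i\}$ is empty or accepted by $A_i$. The \emph{scheduling graph} $G(u)$ of a word $u\in(\Sigma\times[1..t])^*$ is the directed multigraph whose nodes are the threads that occur in $u$ and whose edge weight $E(i,j)$, for $i\ne j$, is the number of factorizations $u=u_1\,a\,b\,u_2$ with letters $a\in\Sigma\times\{i\}$, $b\in\Sigma\times\{j\}$; $E(i,i)=0$. The degree of a node of a directed multigraph is the maximum of its indegree and its outdegree (counted with weights), and the degree of a graph is the maximum of the degrees of its nodes. \emph{Contracting} two different nodes $n_1,n_2$ of a graph into a fresh node $n$ replaces them by $n$,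 with $E'(v,n)=E(v,n_1)+E(v,n_2)$ and $E'(n,v)=E(n_1,v)+E(n_2,v)$ for the other nodes $v$, $E'(n,n)=0$, and all other weights unchanged. A \emph{contraction process} of $G=(V,E)$ is a sequence $G_1,\dots,G_{|V|}$ of graphs with $G_1=G$ in which each $G_{k+1}$ arises from $G_k$ by such a contraction and $G_{|V|}$ has a single node; its degree is the maximum of the degrees of the $G_k$. The \emph{scheduling dimension} $\mathrm{sdim}(G)$ is the minimal degree of a contraction process of $G$ (and $0$ if $G$ has no nodes). \textbf{Problem} $\mathrm{BCS}_L(\mathrm{sdim})$. Input: a shared memory concurrent program $S$ and a bound $s\in\mathbb N$. Question: is there a word $u\in L(S)$ with $\mathrm{sdim}(G(u))\le s$? \textbf{Theorem.} $\mathrm{BCS}_L(\mathrm{sdim})$ can be solved in time $O^*\bigl((2m)^{4s}\cdot 4^{t}\bigr)$, where $O^*$ suppresses factors polynomial in the size of the input. That is, there are a single (deterministic) random access machine program and constants $C,c\in\mathbb N$ such that on every instance $(S,s)$ the program halts with the correct answer within time $$C\cdot(2m)^{4s}\cdot4^{t}\cdot N^{c},$$ where $N$ is the size of $(S,s)$: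 the number of operations, threads and states of all automata plus the binary length of $s$. (The machine has addition, truncated subtraction, tests for zero and indirect addressing, and its time is measured with logarithmic cost; the automata are given by their transition tables and $s$ is given as a number.) -/

import Mathlib

/-! ### Finite automata and shared memory concurrent programs -/

/-- A nondeterministic finite automaton with `n` states over an alphabet with `a` letters, with one
initial and one final state. -/
structure FinAut (a n : ℕ) where
  step : Fin n → Fin a → Fin n → Bool
  init : Fin n
  final : Fin n

/-- The automaton as an automaton of Mathlib. -/
def FinAut.toNFA {a n : ℕ} (A : FinAut a n) : NFA (Fin a) (Fin n) where
  step p x := {q | A.step p x q = true}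
  start := {A.init}
  accept := {A.final}

/-- The language of a finite automaton. -/
def FinAut.language {a n : ℕ} (A : FinAut a n) : Language (Fin a) := A.toNFA.accepts

/-- A shared memory concurrent program: a finite alphabet of `a` operations, a memory automaton `M`
with `m` states, and `t` thread automata, the `i`-th one with `n i` states. A letter `(x, i)` is the
operation `x` issued by thread `i`; the alphabet of thread `i` consists of the letters `(x, i)`, so
that `A i` only has to record the operations. -/
structure SMCP where
  a : ℕ
  m : ℕ
  t : ℕ
  M : FinAut a m
  n : Fin t → ℕ
  A : (i : Fin t) → FinAut a (n i)

/-- The operations issued by thread `i` in the word `u` (the projection of `u` to the alphabet of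
thread `i`, with the thread name dropped). -/
def threadProj {a t : ℕ} (i : Fin t) (u : List (Fin a × Fin t)) : List (Fin a) :=
  (u.filter (fun x => x.2 = i)).map Prod.fst

/-- The shuffle of the thread languages: the projection to each thread is empty or in the language
of that thread. -/
def SMCP.shuffle (S : SMCP) : Set (List (Fin S.a × Fin S.t)) :=
  {u | ∀ i : Fin S.t, threadProj i u ∈ (S.A i).language ∨ threadProj i u = []}

/-- The language of a program: the words in the shuffle of the thread languages that the memory
accepts. -/
def SMCP.language (S : SMCP) : Set (List (Fin S.a × Fin S.t)) :=
  {u | u.map Prod.fst ∈ S.M.language} ∩ S.shuffle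

/-! ### Directed multigraphs, contraction, scheduling dimension -/

/-- A directed multigraph with nodes in `ℕ`. Only the weights `E x y` with `x, y ∈ V` matter. -/
structure MGraph where
  V : Finset ℕ
  E : ℕ → ℕ → ℕ

namespace MGraph

def outdeg (G : MGraph) (x : ℕ) : ℕ := ∑ y ∈ G.V, G.E x y

def indeg (G : MGraph) (x : ℕ) : ℕ := ∑ y ∈ G.V, G.E y x

/-- The degree of a node: the maximum of its indegree and its outdegree. -/
def nodeDegree (G : MGraph) (x : ℕ) : ℕ := max (G.indeg x) (G.outdeg x)

/-- The degree of a graph: the maximum of the degrees of its nodes. -/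
def degree (G : MGraph) : ℕ := G.V.sup G.nodeDegree

/-- Contracting `x` and `y` into the fresh node `z`. The edges between `x` and `y` disappear. -/
def contract (G : MGraph) (x y z : ℕ) : MGraph where
  V := insert z ((G.V.erase x).erase y)
  E v w :=
    if v = z ∧ w = z then 0
    else if w = z then G.E v x + G.E v y
    else if v = z then G.E x w + G.E y w
    else G.E v w

/-- `H` arises from `G` by contracting two different nodes into a fresh one. -/
def ContractsTo (G H : MGraph) : Prop :=
  ∃ x ∈ G.V, ∃ y ∈ G.V, ∃ z ∉ G.V, x ≠ y ∧ H = G.contract x y z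

/-- `π = G₁, …, G_{|V|}` is a contraction sequence of `G`: it starts with `G`, each graph arises
from the previous one by a contraction, and the last graph has a single node. -/
structure IsContractionSeq (G : MGraph) (π : List MGraph) : Prop where
  head : π.head? = some G
  length : π.length = G.V.card
  chain : π.IsChain ContractsTo
  last : ∃ H ∈ π.getLast?, H.V.card = 1

/-- The degree of a contraction sequence: the maximum of the degrees of its graphs. -/
def seqDegree (π : List MGraph) : ℕ := (π.map degree).foldr max 0

/-- The scheduling dimension: the minimal degree of a contraction sequence. Every graph with at
least one node has a contraction sequence; the graph without nodes has none, and the infimum of the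
empty set makes its scheduling dimension `0`. -/
noncomputable def sdim (G : MGraph) : ℕ :=
  sInf {d | ∃ π : List MGraph, G.IsContractionSeq π ∧ d = seqDegree π}

end MGraph

/-- The scheduling graph of `u`: its nodes are the threads that occur in `u`, and the weight from
`i` to `j ≠ i` is the number of positions of `u` at which the processor passes from `i` to `j`. -/
def schedulingGraph {a t : ℕ} (u : List (Fin a × Fin t)) : MGraph where
  V := (u.map (fun x => (x.2 : ℕ))).toFinset
  E i j :=
    if i = j then 0
    else (u.zip u.tail).countP (fun p => (p.1.2 : ℕ) = i ∧ (p.2.2 : ℕ) = j)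

/-- The words whose scheduling graph has scheduling dimension at most `s`. -/
def sdimLang (a t s : ℕ) : Set (List (Fin a × Fin t)) :=
  {u | (schedulingGraph u).sdim ≤ s}

/-- Bounded context switching parameterized by the scheduling dimension: does `S` have a computation
of scheduling dimension at most `s`? -/
def BCSLsd (S : SMCP) (s : ℕ) : Prop :=
  (S.language ∩ sdimLang S.a S.t s).Nonempty

/-! ### Random access machines with logarithmic cost -/

namespace RAM

/-- A state: registers, which a program names directly, and a memory, which it accesses through
addresses held in registers. All cells hold natural numbers. -/
structure State where
  reg : ℕ → ℕ
  mem : ℕ → ℕ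

def State.setReg (μ : State) (x v : ℕ) : State := { μ with reg := Function.update μ.reg x v }

def State.setMem (μ : State) (k v : ℕ) : State := { μ with mem := Function.update μ.mem k v }

/-- Programs of a random access machine with addition and (truncated) subtraction. -/
inductive Prog where
  /-- `reg x := v`. -/
  | const (x v : ℕ)
  /-- `reg x := reg y + reg z`. -/
  | add (x y z : ℕ)
  /-- `reg x := reg y - reg z`. -/
  | sub (x y z : ℕ)
  /-- `reg x := mem (reg y)`. -/
  | load (x y : ℕ)
  /-- `mem (reg x) := reg y`. -/
  | store (x y : ℕ)
  /-- First `p`, then `q`. -/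
  | seq (p q : Prog)
  /-- `p` if `reg x ≠ 0`, and `q` otherwise. -/
  | ite (x : ℕ) (p q : Prog)
  /-- Repeat `p` as long as `reg x ≠ 0`. -/
  | while (x : ℕ) (p : Prog)

/-- `Exec p μ ν k`: started in `μ`, the program `p` halts in `ν`, and the execution takes time `k`.
Each instruction and each test of a register takes one unit of time plus the binary lengths of the
numbers and memory addresses that it handles. -/
inductive Exec : Prog → State → State → ℕ → Prop where
  | const (x v : ℕ) (μ : State) :
      Exec (.const x v) μ (μ.setReg x v) (1 + Nat.size v)
  | add (x y z : ℕ) (μ : State) :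
      Exec (.add x y z) μ (μ.setReg x (μ.reg y + μ.reg z))
        (1 + Nat.size (μ.reg y) + Nat.size (μ.reg z))
  | sub (x y z : ℕ) (μ : State) :
      Exec (.sub x y z) μ (μ.setReg x (μ.reg y - μ.reg z))
        (1 + Nat.size (μ.reg y) + Nat.size (μ.reg z))
  | load (x y : ℕ) (μ : State) :
      Exec (.load x y) μ (μ.setReg x (μ.mem (μ.reg y)))
        (1 + Nat.size (μ.reg y) + Nat.size (μ.mem (μ.reg y)))
  | store (x y : ℕ) (μ : State) :
      Exec (.store x y) μ (μ.setMem (μ.reg x) (μ.reg y))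
        (1 + Nat.size (μ.reg x) + Nat.size (μ.reg y))
  | seq {p q : Prog} {μ ν ξ : State} {k l : ℕ} :
      Exec p μ ν k → Exec q ν ξ l → Exec (.seq p q) μ ξ (k + l)
  | ite_true {x : ℕ} {p q : Prog} {μ ν : State} {k : ℕ} :
      μ.reg x ≠ 0 → Exec p μ ν k → Exec (.ite x p q) μ ν (1 + Nat.size (μ.reg x) + k)
  | ite_false {x : ℕ} {p q : Prog} {μ ν : State} {k : ℕ} :
      μ.reg x = 0 → Exec q μ ν k → Exec (.ite x p q) μ ν (1 + Nat.size (μ.reg x) + k)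
  | while_true {x : ℕ} {p : Prog} {μ ν ξ : State} {k l : ℕ} :
      μ.reg x ≠ 0 → Exec p μ ν k → Exec (.while x p) ν ξ l →
        Exec (.while x p) μ ξ (1 + Nat.size (μ.reg x) + k + l)
  | while_false {x : ℕ} {p : Prog} {μ : State} :
      μ.reg x = 0 → Exec (.while x p) μ μ (1 + Nat.size (μ.reg x))

/-- The initial state on the input `w`: the memory holds `w`, everything else is `0`. -/
def initial (w : List ℕ) : State where
  reg := fun _ => 0
  mem := fun k => w.getD k 0

/-- On the input `w`, the program `p` halts within time `T`, with the answer to `P` (`1` for yes and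
`0` for no) in register `0`. -/
def DecidesWithin (p : Prog) (w : List ℕ) (P : Prop) (T : ℕ) : Prop :=
  ∃ (ν : State) (k : ℕ), Exec p (initial w) ν k ∧ k ≤ T ∧
    (P → ν.reg 0 = 1) ∧ (¬ P → ν.reg 0 = 0)

end RAM

/-! ### Instances as inputs of a machine -/

/-- The transition table of an automaton, row by row. -/
def FinAut.table {a n : ℕ} (A : FinAut a n) : List ℕ :=
  (List.finRange n).flatMap fun p => (List.finRange a).flatMap fun x =>
    (List.finRange n).map fun q => (A.step p x q).toNat

/-- The instance `(S, s)` as a list of natural numbers: the number of operations, of memory states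
and of threads, the bound `s`, and then the memory automaton and the threads, each given by its
initial state, its final state and its transition table, for threads preceded by the number of
states. -/
def encodeInstance (S : SMCP) (s : ℕ) : List ℕ :=
  [S.a, S.m, S.t, s] ++ ([(S.M.init : ℕ), (S.M.final : ℕ)] ++ S.M.table) ++
    (List.finRange S.t).flatMap fun i =>
      [S.n i, ((S.A i).init : ℕ), ((S.A i).final : ℕ)] ++ (S.A i).table

/-- The size of the instance `(S, s)`: the number of operations, threads and states of all automata,
plus the binary length of `s`. The length of `encodeInstance S s` is polynomial in it. -/
def instanceSize (S : SMCP) (s : ℕ) : ℕ :=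
  S.a + S.t + S.m + ∑ i, S.n i + Nat.size s

/-! A node of a graph in a contraction process stands for the set `X` of original nodes that were
merged into it, and its outdegree and indegree are the weights of the edges that leave and enter
`X`. So a contraction process of degree at most `s` amounts to a binary tree of disjoint unions,
from the singletons up to the set of all nodes, in which every set has both cuts at most `s`. This
is `MGraph.Carve`, and `MGraph.sdim_le_iff` is the equivalence.

The letters of a word that belong to threads in `X` form maximal blocks. Every block is followed by
an edge out of `X` unless it ends the word, and preceded by an edge into `X` unless it begins the
word. Hence both cuts are at most `s` iff there are at most `s` blocks, or `s + 1` if the word both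
begins and ends in `X`, that is, wraps (`cutLe_grph_iff`). All that the rest of the word has to know
about `X` is therefore a list of at most `s + 1` pairs of memory states, those before and after each
block, and one bit for wrapping.

This leads to a dynamic program over facts `Fct`: "thread `i` can go from `p` to `p'` in these
blocks" and "the threads in `X` can all be run in these blocks, and `X` is carved". Two such facts
for disjoint `X` and `Y` are joined along a pattern of at most `2 * s + 2` items, which says how the
blocks of `X` and `Y` interleave to blocks of `X ∪ Y`. The rules are sound (`Sys.Step.sem`) and
complete (`Sys.lev_of_carve`). A run inside a single block may be long, but with `B` a bound for all
numbers of states there are at most `B ^ 4` facts about single blocks, so these are closed under the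
rules after `B ^ 4` rounds. Lists of blocks, then unions, then acceptance need fewer than `B`
further rounds (`Sys.lev_acc`).

An application of a rule is given by nine digits below `B`, a colour for each thread (in `X`, in
`Y`, in neither), a type among three for each item, and two memory states for each item. One round
thus runs through `B ^ 9 * 3 ^ (t + 2 * s + 2) * m ^ (4 * s + 4)` vectors, with polynomial work in
`B` for each. As `s` is given in binary, `B` need not be polynomial in the size of the input; but `9
^ s` times a polynomial in `s` is at most a constant times `16 ^ s`, the slack in `(2 * m) ^ (4 *
s)` (`pow_mul_nine_pow_le`), and `3 ^ t ≤ 4 ^ t`.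

For the machine, a small language with counted loops is compiled with a bound for the time
(`Cm.comp_spec`). The program has one long loop. It steps a mixed radix counter through all vectors
again and again and keeps the facts found so far in a table, with the code of a fact as the address;
`LoopInv` is the invariant. -/

namespace RAM

/-! ### A structured language for the machine -/

/-- The states of the source language: variables and memory. -/
structure Store where
  v : ℕ → ℕ
  m : ℕ → ℕ

/-- Expressions of the source language. -/
inductive Ex where
  | var (x : ℕ)
  | lit (n : ℕ)
  | add (a b : Ex)
  | sub (a b : Ex)
  | mul (a b : Ex)
  | get (a : Ex)

/-- Commands of the source language; `rep e c` repeats `c` as often as the initial value of `e`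
says. -/
inductive Cm where
  | skip
  | set (x : ℕ) (e : Ex)
  | put (a b : Ex)
  | seq (p q : Cm)
  | ite (e : Ex) (p q : Cm)
  | rep (e : Ex) (c : Cm)

def Ex.eval (σ : Store) : Ex → ℕ
  | var x => σ.v x
  | lit n => n
  | add a b => a.eval σ + b.eval σ
  | sub a b => a.eval σ - b.eval σ
  | mul a b => a.eval σ * b.eval σ
  | get a => σ.m (a.eval σ)

def Cm.sem : Cm → Store → Store
  | skip, σ => σ
  | set x e, σ => { σ with v := Function.update σ.v x (e.eval σ) }
  | put a b, σ => { σ with m := Function.update σ.m (a.eval σ) (b.eval σ) }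
  | seq p q, σ => q.sem (p.sem σ)
  | ite e p q, σ => if e.eval σ ≠ 0 then p.sem σ else q.sem σ
  | rep e c, σ => c.sem^[e.eval σ] σ

/-- The multipliers are at most `W`. -/
def Ex.ok (W : ℕ) (σ : Store) : Ex → Prop
  | var _ => True
  | lit _ => True
  | add a b => a.ok W σ ∧ b.ok W σ
  | sub a b => a.ok W σ ∧ b.ok W σ
  | mul a b => a.ok W σ ∧ b.ok W σ ∧ b.eval σ ≤ W
  | get a => a.ok W σ

/-- The multipliers and the numbers of repetitions are at most `W` during the execution. -/
def Cm.ok (W : ℕ) : Cm → Store → Prop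
  | skip, _ => True
  | set _ e, σ => e.ok W σ
  | put a b, σ => a.ok W σ ∧ b.ok W σ
  | seq p q, σ => p.ok W σ ∧ q.ok W (p.sem σ)
  | ite e p q, σ => e.ok W σ ∧ (e.eval σ ≠ 0 → p.ok W σ) ∧ (e.eval σ = 0 → q.ok W σ)
  | rep e c, σ => e.ok W σ ∧ e.eval σ ≤ W ∧ ∀ j < e.eval σ, c.ok W (c.sem^[j] σ)

/-- A bound for the number of instructions and for the growth of the binary lengths. -/
def Ex.bd (W : ℕ) : Ex → ℕ
  | var _ => 1
  | lit n => n + 1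
  | add a b => a.bd W + b.bd W + 1
  | sub a b => a.bd W + b.bd W + 1
  | mul a b => a.bd W + b.bd W + W + 2
  | get a => a.bd W + 1

def Cm.bd (W : ℕ) : Cm → ℕ
  | skip => 1
  | set _ e => e.bd W + 1
  | put a b => a.bd W + b.bd W + 1
  | seq p q => p.bd W + q.bd W
  | ite e p q => e.bd W + p.bd W + q.bd W + 1
  | rep e c => e.bd W + W * (c.bd W + 2) + 1

/-- Compilation with temporaries from number `d` on: the result is in the temporary `d`. -/
def Ex.comp : Ex → ℕ → Prog
  | var x, d => .seq (.const (2 * d + 1) 0) (.add (2 * d + 1) (2 * x) (2 * d + 1))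
  | lit n, d => .const (2 * d + 1) n
  | add a b, d => .seq (a.comp d) (.seq (b.comp (d + 1))
      (.add (2 * d + 1) (2 * d + 1) (2 * (d + 1) + 1)))
  | sub a b, d => .seq (a.comp d) (.seq (b.comp (d + 1))
      (.sub (2 * d + 1) (2 * d + 1) (2 * (d + 1) + 1)))
  | mul a b, d => .seq (a.comp d) (.seq (b.comp (d + 1))
      (.seq (.seq (.const (2 * (d + 2) + 1) 0) (.const (2 * (d + 3) + 1) 1))
        (.seq (.while (2 * (d + 1) + 1)
          (.seq (.add (2 * (d + 2) + 1) (2 * (d + 2) + 1) (2 * d + 1))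
            (.sub (2 * (d + 1) + 1) (2 * (d + 1) + 1) (2 * (d + 3) + 1))))
        (.add (2 * d + 1) (2 * (d + 2) + 1) (2 * (d + 1) + 1)))))
  | get a, d => .seq (a.comp d) (.load (2 * d + 1) (2 * d + 1))

def Cm.comp : Cm → ℕ → Prog
  | skip, d => .const (2 * d + 1) 0
  | set x e, d => .seq (e.comp d) (.seq (.const (2 * (d + 1) + 1) 0)
      (.add (2 * x) (2 * d + 1) (2 * (d + 1) + 1)))
  | put a b, d => .seq (a.comp d) (.seq (b.comp (d + 1)) (.store (2 * d + 1) (2 * (d + 1) + 1)))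
  | seq p q, d => .seq (p.comp d) (q.comp d)
  | ite e p q, d => .seq (e.comp d) (.ite (2 * d + 1) (p.comp d) (q.comp d))
  | rep e c, d => .seq (e.comp d) (.while (2 * d + 1) (.seq (c.comp (d + 1))
      (.seq (.const (2 * (d + 1) + 1) 1) (.sub (2 * d + 1) (2 * d + 1) (2 * (d + 1) + 1)))))

/-- The machine state `μ` represents the store `σ`: variable `x` is kept in register `2 * x`. -/
structure Rep (μ : State) (σ : Store) : Prop where
  v : ∀ x, μ.reg (2 * x) = σ.v x
  m : μ.mem = σ.m

/-- All values are below `2 ^ L`. -/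
structure Store.Below (L : ℕ) (σ : Store) : Prop where
  v : ∀ x, σ.v x < 2 ^ L
  m : ∀ x, σ.m x < 2 ^ L

/-- The time for `b` instructions that start with values below `2 ^ L`. -/
def budget (L b : ℕ) : ℕ := 8 * b * (L + b + 1)

/-- Program `p` leads from `μ` to a state that represents `σ`, within time `T`; the temporaries
below `d` are unchanged. -/
def Reaches (p : Prog) (μ : State) (d : ℕ) (σ : Store) (T : ℕ) (Q : State → Prop) : Prop :=
  ∃ (ν : State) (k : ℕ), Exec p μ ν k ∧ k ≤ T ∧ Rep ν σ ∧
    (∀ x < d, ν.reg (2 * x + 1) = μ.reg (2 * x + 1)) ∧ Q ν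

/-- Budgets compose although the numbers grow: a part of size `a` lengthens the values by at most
`a` bits, so the next part starts at length `L + a`. The term with `c` pays for the few extra
instructions around the two parts. -/
theorem budget_add (L a b c : ℕ) :
    budget L a + budget (L + a) b + 8 * c * (L + a + b + 1) ≤ budget L (a + b + c) := by
  unfold budget
  nlinarith [Nat.zero_le (a * b), Nat.zero_le (a * c), Nat.zero_le (b * c), Nat.zero_le (c * c)]

theorem budget_mono {L L' b b' : ℕ} (h : L ≤ L') (h' : b ≤ b') : budget L b ≤ budget L' b' := by
  unfold budget
  gcongr

theorem size_le_of_lt {n L : ℕ} (h : n < 2 ^ L) : Nat.size n ≤ L := Nat.size_le.2 h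

theorem Store.Below.mono {L L' : ℕ} {σ : Store} (h : σ.Below L) (hL : L ≤ L') : σ.Below L' :=
  ⟨fun x => (h.v x).trans_le (Nat.pow_le_pow_right two_pos hL),
    fun x => (h.m x).trans_le (Nat.pow_le_pow_right two_pos hL)⟩

theorem lt_two_pow_mono {n L L' : ℕ} (h : n < 2 ^ L) (hL : L ≤ L') : n < 2 ^ L' :=
  h.trans_le (Nat.pow_le_pow_right two_pos hL)

/-- Multipliers have to be at most `W` for this bound: a factor below `2 ^ W` adds at most `W` bits,
whatever the length of the other factor. A memory access resets the length to `L`, even if the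
address is long. -/
theorem Ex.eval_lt {W L : ℕ} {σ : Store} (hσ : σ.Below L) (e : Ex) (he : e.ok W σ) :
    e.eval σ < 2 ^ (L + e.bd W) := by
  induction e with
  | var x => exact lt_two_pow_mono (hσ.v x) (by simp [Ex.bd])
  | lit n =>
    exact lt_two_pow_mono (L := n) Nat.lt_two_pow_self (by simp only [Ex.bd]; omega)
  | add a b iha ihb =>
    have h1 := lt_two_pow_mono (iha he.1) (L' := L + a.bd W + b.bd W) (by omega)
    have h2 := lt_two_pow_mono (ihb he.2) (L' := L + a.bd W + b.bd W) (by omega)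
    have : L + (Ex.add a b).bd W = (L + a.bd W + b.bd W) + 1 := by simp only [Ex.bd]; omega
    rw [this, pow_succ]
    simp only [Ex.eval]
    omega
  | sub a b iha ihb =>
    have h1 := lt_two_pow_mono (iha he.1) (L' := L + (Ex.sub a b).bd W)
      (by simp only [Ex.bd]; omega)
    exact (Nat.sub_le _ _).trans_lt h1
  | mul a b iha ihb =>
    have h1 := iha he.1
    have h2 : b.eval σ < 2 ^ W := he.2.2.trans_lt Nat.lt_two_pow_self
    have : a.eval σ * b.eval σ < 2 ^ (L + a.bd W + W) := by
      rw [pow_add]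
      exact Nat.mul_lt_mul'' h1 h2
    exact lt_two_pow_mono this (by simp only [Ex.bd]; omega)
  | get a iha => exact lt_two_pow_mono (hσ.m _) (by simp [Ex.bd])

/-- The loop that adds register `z` to `y` as often as `x` says; `u` holds `1`. -/
theorem exec_mul_loop {x y z u L n : ℕ} {μ : State} (hxy : x ≠ y) (hzy : z ≠ y) (hzx : z ≠ x)
    (hux : u ≠ x) (huy : u ≠ y) (hx : μ.reg x = n) (hu : μ.reg u = 1)
    (hL : μ.reg y + n * μ.reg z < 2 ^ L) (hnL : n < 2 ^ L) :
    ∃ (ν : State) (k : ℕ), Exec (.while x (.seq (.add y y z) (.sub x x u))) μ ν k ∧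
      k ≤ (n + 1) * (4 * L + 5) ∧ ν.mem = μ.mem ∧ ν.reg y = μ.reg y + n * μ.reg z ∧
      ν.reg x = 0 ∧ (∀ r, r ≠ x → r ≠ y → ν.reg r = μ.reg r) := by
  induction n generalizing μ with
  | zero =>
    refine ⟨μ, _, Exec.while_false hx, ?_, rfl, by simp, hx, fun _ _ _ => rfl⟩
    simp [hx]
  | succ n ih =>
    set μ1 := μ.setReg y (μ.reg y + μ.reg z) with hμ1
    set μ2 := μ1.setReg x (μ1.reg x - μ1.reg u) with hμ2
    have e1 : μ1.reg x = n + 1 := by simp [hμ1, State.setReg, Function.update_of_ne hxy, hx]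
    have e2 : μ1.reg u = 1 := by simp [hμ1, State.setReg, Function.update_of_ne huy, hu]
    have hx2 : μ2.reg x = n := by simp [hμ2, State.setReg, e1, e2]
    have hr2 : ∀ r, r ≠ x → r ≠ y → μ2.reg r = μ.reg r := by
      intro r h1 h2
      simp [hμ2, hμ1, State.setReg, Function.update_of_ne h1, Function.update_of_ne h2]
    have hy2 : μ2.reg y = μ.reg y + μ.reg z := by
      simp [hμ2, hμ1, State.setReg, Function.update_of_ne hxy.symm]
    have hz2 : μ2.reg z = μ.reg z := hr2 z hzx hzy
    obtain ⟨ν, k, hk, hkb, hm, hy, hx', hr⟩ := ih (μ := μ2) hx2 ((hr2 u hux huy).trans hu)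
      (by rw [hy2, hz2]; linarith [hL]) (by omega)
    refine ⟨ν, _, Exec.while_true (by omega) (Exec.seq (Exec.add y y z μ) (Exec.sub x x u μ1)) hk,
      ?_, hm, ?_, hx', fun r h1 h2 => (hr r h1 h2).trans (hr2 r h1 h2)⟩
    · have s1 : Nat.size (μ.reg x) ≤ L := size_le_of_lt (hx ▸ hnL)
      have s2 : Nat.size (μ.reg y) ≤ L := size_le_of_lt (by nlinarith)
      have s3 : Nat.size (μ.reg z) ≤ L := size_le_of_lt (by nlinarith)
      have s4 : Nat.size (μ1.reg x) ≤ L := size_le_of_lt (e1 ▸ hnL)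
      have s5 : Nat.size (μ1.reg u) ≤ 1 := size_le_of_lt (by rw [e2]; norm_num)
      have : (n + 1 + 1) * (4 * L + 5) = (n + 1) * (4 * L + 5) + (4 * L + 5) := by ring
      omega
    · rw [hy, hy2, hz2]; ring

/-- Variables live in even registers and temporaries in odd ones, so evaluation never disturbs the
store. The left operand waits in temporary `d` while the right one is computed with temporaries from
`d + 1` on. -/
theorem Ex.comp_spec {W L : ℕ} {σ : Store} (hσ : σ.Below L) (e : Ex) (he : e.ok W σ) (d : ℕ)
    (μ : State) (hμ : Rep μ σ) :
    Reaches (e.comp d) μ d σ (budget L (e.bd W)) (fun ν => ν.reg (2 * d + 1) = e.eval σ) := by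
  induction e generalizing d μ with
  | var x =>
    refine ⟨_, _, Exec.seq (Exec.const _ _ _) (Exec.add _ _ _ _), ?_, ⟨?_, hμ.m⟩, ?_, ?_⟩
    · have h1 : Nat.size (μ.reg (2 * x)) ≤ L := size_le_of_lt (hμ.v x ▸ hσ.v x)
      have : (2 * x) ≠ 2 * d + 1 := by omega
      simp [State.setReg, Function.update_of_ne this, budget, Ex.bd]
      omega
    · intro y
      have : (2 * y) ≠ 2 * d + 1 := by omega
      simp [State.setReg, Function.update_of_ne this, hμ.v]
    · intro y hy
      have : (2 * y + 1) ≠ 2 * d + 1 := by omega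
      simp [State.setReg, Function.update_of_ne this]
    · have : (2 * x) ≠ 2 * d + 1 := by omega
      simp [State.setReg, Function.update_of_ne this, hμ.v, Ex.eval]
  | lit n =>
    refine ⟨_, _, Exec.const _ _ _, ?_, ⟨?_, hμ.m⟩, ?_, ?_⟩
    · have h1 : Nat.size n ≤ n := size_le_of_lt Nat.lt_two_pow_self
      simp only [budget, Ex.bd]
      nlinarith
    · intro y
      have : (2 * y) ≠ 2 * d + 1 := by omega
      simp [State.setReg, Function.update_of_ne this, hμ.v]
    · intro y hy
      have : (2 * y + 1) ≠ 2 * d + 1 := by omega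
      simp [State.setReg, Function.update_of_ne this]
    · simp [State.setReg, Ex.eval]
  | add a b iha ihb =>
    obtain ⟨μ1, k1, x1, t1, r1, f1, v1⟩ := iha he.1 d μ hμ
    obtain ⟨μ2, k2, x2, t2, r2, f2, v2⟩ := ihb he.2 (d + 1) μ1 r1
    have hv : μ2.reg (2 * d + 1) = a.eval σ := (f2 d (by omega)).trans v1
    refine ⟨_, _, Exec.seq x1 (Exec.seq x2 (Exec.add _ _ _ _)), ?_, ⟨?_, r2.m⟩, ?_, ?_⟩
    · have s1 := size_le_of_lt (a.eval_lt hσ he.1)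
      have s2 := size_le_of_lt (b.eval_lt hσ he.2)
      rw [hv, v2]
      have := budget_add L (a.bd W) (b.bd W) 1
      have := budget_mono (Nat.le_add_right L (a.bd W)) le_rfl (b := b.bd W)
      simp only [Ex.bd]
      omega
    · intro y
      have : (2 * y) ≠ 2 * d + 1 := by omega
      simp [State.setReg, Function.update_of_ne this, r2.v]
    · intro y hy
      have : (2 * y + 1) ≠ 2 * d + 1 := by omega
      simp [State.setReg, Function.update_of_ne this, f2 y (by omega), f1 y hy]
    · simp [State.setReg, hv, v2, Ex.eval]
  | sub a b iha ihb =>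
    obtain ⟨μ1, k1, x1, t1, r1, f1, v1⟩ := iha he.1 d μ hμ
    obtain ⟨μ2, k2, x2, t2, r2, f2, v2⟩ := ihb he.2 (d + 1) μ1 r1
    have hv : μ2.reg (2 * d + 1) = a.eval σ := (f2 d (by omega)).trans v1
    refine ⟨_, _, Exec.seq x1 (Exec.seq x2 (Exec.sub _ _ _ _)), ?_, ⟨?_, r2.m⟩, ?_, ?_⟩
    · have s1 := size_le_of_lt (a.eval_lt hσ he.1)
      have s2 := size_le_of_lt (b.eval_lt hσ he.2)
      rw [hv, v2]
      have := budget_add L (a.bd W) (b.bd W) 1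
      have := budget_mono (Nat.le_add_right L (a.bd W)) le_rfl (b := b.bd W)
      simp only [Ex.bd]
      omega
    · intro y
      have : (2 * y) ≠ 2 * d + 1 := by omega
      simp [State.setReg, Function.update_of_ne this, r2.v]
    · intro y hy
      have : (2 * y + 1) ≠ 2 * d + 1 := by omega
      simp [State.setReg, Function.update_of_ne this, f2 y (by omega), f1 y hy]
    · simp [State.setReg, hv, v2, Ex.eval]
  | mul a b iha ihb =>
    obtain ⟨μ1, k1, x1, t1, r1, f1, v1⟩ := iha he.1 d μ hμ
    obtain ⟨μ2, k2, x2, t2, r2, f2, v2⟩ := ihb he.2.1 (d + 1) μ1 r1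
    have hv : μ2.reg (2 * d + 1) = a.eval σ := (f2 d (by omega)).trans v1
    set μ3 := μ2.setReg (2 * (d + 2) + 1) 0 with hμ3
    set μ4 := μ3.setReg (2 * (d + 3) + 1) 1 with hμ4
    have h4 : ∀ y, y ≠ 2 * (d + 2) + 1 → y ≠ 2 * (d + 3) + 1 → μ4.reg y = μ2.reg y := by
      intro y h h'
      simp [hμ4, hμ3, State.setReg, Function.update_of_ne h, Function.update_of_ne h']
    have g1 : μ4.reg (2 * (d + 1) + 1) = b.eval σ := (h4 _ (by omega) (by omega)).trans v2
    have g2 : μ4.reg (2 * (d + 3) + 1) = 1 := by simp [hμ4, State.setReg]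
    have g3 : μ4.reg (2 * (d + 2) + 1) = 0 := by
      rw [hμ4]; simp [State.setReg, hμ3]
    have g0 : μ4.reg (2 * d + 1) = a.eval σ := (h4 _ (by omega) (by omega)).trans hv
    have hbig : b.eval σ * a.eval σ < 2 ^ (L + a.bd W + W) := by
      rw [mul_comm, pow_add]
      exact Nat.mul_lt_mul'' (a.eval_lt hσ he.1) (he.2.2.trans_lt Nat.lt_two_pow_self)
    obtain ⟨μ5, k5, x5, t5, m5, y5, z5, f5⟩ := exec_mul_loop (μ := μ4) (L := L + a.bd W + W)
      (x := 2 * (d + 1) + 1) (y := 2 * (d + 2) + 1) (z := 2 * d + 1) (u := 2 * (d + 3) + 1)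
      (by omega) (by omega) (by omega) (by omega) (by omega) g1 g2
      (by rw [g3, g0, zero_add]; exact hbig)
      (lt_two_pow_mono (he.2.2.trans_lt Nat.lt_two_pow_self) (by omega))
    rw [g3, g0, zero_add] at y5
    refine ⟨_, _, Exec.seq x1 (Exec.seq x2 (Exec.seq (Exec.seq (Exec.const _ _ _)
      (Exec.const _ _ _)) (Exec.seq x5 (Exec.add _ _ _ _)))), ?_, ⟨?_, ?_⟩, ?_, ?_⟩
    · have s1 := size_le_of_lt hbig
      rw [y5, z5]
      have h1 := budget_add L (a.bd W) (b.bd W) (W + 2)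
      have h2 := budget_mono (Nat.le_add_right L (a.bd W)) le_rfl (b := b.bd W)
      -- The loop makes at most `W` additions of numbers of length at most `L + a.bd W + W`; the
      -- summand `W + 2` of `Ex.bd` pays for them.
      have h3 : k5 ≤ (W + 1) * (4 * (L + a.bd W + W) + 5) :=
        t5.trans (Nat.mul_le_mul_right _ (by have := he.2.2; omega))
      have h4 : (W + 1) * (4 * (L + a.bd W + W) + 5) + (L + a.bd W + W) + 5
          ≤ 8 * (W + 2) * (L + a.bd W + b.bd W + 1) + 4 * (W + 2) * W := by nlinarith
      have h5 : budget L (a.bd W) + budget (L + a.bd W) (b.bd W) +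
          (8 * (W + 2) * (L + a.bd W + b.bd W + 1) + 4 * (W + 2) * W) ≤
          budget L (a.bd W + b.bd W + (W + 2)) := by
        unfold budget
        nlinarith [Nat.zero_le (a.bd W * b.bd W), Nat.zero_le (a.bd W * W),
          Nat.zero_le (b.bd W * W)]
      have h6 : Nat.size 0 = 0 := rfl
      have h7 : Nat.size 1 = 1 := Nat.size_one
      have h8 : (Ex.mul a b).bd W = a.bd W + b.bd W + (W + 2) := rfl
      rw [h8]
      omega
    · intro y
      have h : (2 * y) ≠ 2 * d + 1 := by omega
      simp only [State.setReg, Function.update_of_ne h]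
      rw [f5 _ (by omega) (by omega), h4 _ (by omega) (by omega), r2.v]
    · simp only [State.setReg]
      rw [m5]
      exact r2.m
    · intro y hy
      have h : (2 * y + 1) ≠ 2 * d + 1 := by omega
      simp only [State.setReg, Function.update_of_ne h]
      rw [f5 _ (by omega) (by omega), h4 _ (by omega) (by omega), f2 y (by omega), f1 y hy]
    · simp only [State.setReg, Function.update_self, y5, z5, Ex.eval]
      rw [mul_comm, add_zero]
  | get a iha =>
    obtain ⟨μ1, k1, x1, t1, r1, f1, v1⟩ := iha he d μ hμ
    refine ⟨_, _, Exec.seq x1 (Exec.load _ _ _), ?_, ⟨?_, r1.m⟩, ?_, ?_⟩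
    · have s1 := size_le_of_lt (a.eval_lt hσ he)
      have s2 := size_le_of_lt (hσ.m (a.eval σ))
      rw [v1, r1.m]
      have h1 := budget_add L (a.bd W) 0 1
      simp only [Ex.bd]
      have h2 : budget L (a.bd W) + budget (L + a.bd W) 0 + 8 * 1 * (L + a.bd W + 0 + 1) ≤
        budget L (a.bd W + 1) := h1
      simp only [budget] at *
      omega
    · intro y
      have : (2 * y) ≠ 2 * d + 1 := by omega
      simp [State.setReg, Function.update_of_ne this, r1.v]
    · intro y hy
      have : (2 * y + 1) ≠ 2 * d + 1 := by omega
      simp [State.setReg, Function.update_of_ne this, f1 y hy]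
    · simp [State.setReg, v1, r1.m, Ex.eval]

/-- A loop whose body takes time at most `b` in every iteration. -/
theorem exec_rep_loop {c : Cm} {d L b n : ℕ} {σ : Store} {μ : State} (hμ : Rep μ σ)
    (hn : μ.reg (2 * d + 1) = n) (hL : n < 2 ^ L)
    (hc : ∀ j < n, ∀ μ, Rep μ (c.sem^[j] σ) →
      Reaches (c.comp (d + 1)) μ (d + 1) (c.sem^[j + 1] σ) b fun _ => True) :
    Reaches (.while (2 * d + 1) (.seq (c.comp (d + 1))
      (.seq (.const (2 * (d + 1) + 1) 1) (.sub (2 * d + 1) (2 * d + 1) (2 * (d + 1) + 1)))))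
      μ d (c.sem^[n] σ) (n * (b + 2 * L + 5) + 1) fun _ => True := by
  induction n generalizing σ μ with
  | zero =>
    refine ⟨μ, _, Exec.while_false hn, ?_, hμ, fun _ _ => rfl, trivial⟩
    simp [hn]
  | succ n ih =>
    obtain ⟨μ1, k1, x1, t1, r1, f1, -⟩ := hc 0 (by omega) μ hμ
    set μ2 := μ1.setReg (2 * (d + 1) + 1) 1 with hμ2
    set μ3 := μ2.setReg (2 * d + 1) (μ2.reg (2 * d + 1) - μ2.reg (2 * (d + 1) + 1)) with hμ3
    have e1 : μ2.reg (2 * d + 1) = n + 1 := by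
      have : 2 * d + 1 ≠ 2 * (d + 1) + 1 := by omega
      simp only [hμ2, State.setReg, Function.update_of_ne this]
      rw [f1 d (by omega), hn]
    have e2 : μ2.reg (2 * (d + 1) + 1) = 1 := by simp [hμ2, State.setReg]
    have e3 : μ3.reg (2 * d + 1) = n := by
      rw [hμ3, e1, e2]; simp [State.setReg]
    have f3 : ∀ y, y ≠ 2 * d + 1 → y ≠ 2 * (d + 1) + 1 → μ3.reg y = μ1.reg y := by
      intro y h h'
      simp [hμ3, hμ2, State.setReg, Function.update_of_ne h, Function.update_of_ne h']
    have r3 : Rep μ3 (c.sem σ) :=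
      ⟨fun y => (f3 _ (by omega) (by omega)).trans (r1.v y), r1.m⟩
    obtain ⟨ν, k, x, t, r, f, -⟩ := ih r3 e3 (by omega) fun j hj μ hμ => hc (j + 1) (by omega) μ hμ
    refine ⟨ν, _, Exec.while_true (by omega) (Exec.seq x1 (Exec.seq (Exec.const _ _ _)
      (Exec.sub _ _ _ _))) x, ?_, r, fun y hy => ?_, trivial⟩
    · have s1 : Nat.size (μ.reg (2 * d + 1)) ≤ L := size_le_of_lt (hn ▸ hL)
      have s2 : Nat.size (μ2.reg (2 * d + 1)) ≤ L := size_le_of_lt (e1 ▸ hL)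
      have s3 : Nat.size (μ2.reg (2 * (d + 1) + 1)) ≤ 1 := size_le_of_lt (by rw [e2]; norm_num)
      have s4 : Nat.size 1 = 1 := Nat.size_one
      have : (n + 1) * (b + 2 * L + 5) = n * (b + 2 * L + 5) + (b + 2 * L + 5) := by ring
      rw [← hμ2, this]
      omega
    · rw [f y hy, f3 _ (by omega) (by omega), f1 y (by omega)]

theorem Cm.below_sem {W L : ℕ} {σ : Store} (hσ : σ.Below L) (c : Cm) (hc : c.ok W σ) :
    (c.sem σ).Below (L + c.bd W) := by
  induction c generalizing σ L with
  | skip => exact hσ.mono (by omega)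
  | set x e =>
    have h1 := e.eval_lt hσ hc
    have h2 := hσ.mono (Nat.le_add_right L ((Cm.set x e).bd W))
    refine ⟨fun y => ?_, h2.m⟩
    simp only [Cm.sem, Function.update_apply]
    split_ifs
    · exact lt_two_pow_mono h1 (by simp only [Cm.bd]; omega)
    · exact h2.v y
  | put a b =>
    have h1 := b.eval_lt hσ hc.2
    have h2 := hσ.mono (Nat.le_add_right L ((Cm.put a b).bd W))
    refine ⟨h2.v, fun y => ?_⟩
    simp only [Cm.sem, Function.update_apply]
    split_ifs
    · exact lt_two_pow_mono h1 (by simp only [Cm.bd]; omega)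
    · exact h2.m y
  | seq p q ihp ihq =>
    have := ihq (ihp hσ hc.1) hc.2
    rwa [add_assoc] at this
  | ite e p q ihp ihq =>
    simp only [Cm.sem]
    split_ifs with h
    · exact (ihp hσ (hc.2.1 h)).mono (by simp only [Cm.bd]; omega)
    · exact (ihq hσ (hc.2.2 (not_not.1 h))).mono (by simp only [Cm.bd]; omega)
  | rep e c ih =>
    have key : ∀ n ≤ e.eval σ, (c.sem^[n] σ).Below (L + n * c.bd W) := by
      intro n hn
      induction n with
      | zero => simpa using hσ
      | succ n ihn =>
        rw [Function.iterate_succ_apply']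
        exact (ih (ihn (by omega)) (hc.2.2 n (by omega))).mono (by ring_nf; omega)
    refine (key _ le_rfl).mono ?_
    have h1 : e.eval σ * c.bd W ≤ W * (c.bd W + 2) := Nat.mul_le_mul hc.2.1 (by omega)
    simp only [Cm.bd]
    omega

/-- The bound depends on the program only through `c.bd W`, which is polynomial in `W` by
`Cm.exists_bd_le`. The counter of a loop is kept in temporary `d`, out of reach of its body, which
is compiled from `d + 1` on. -/
theorem Cm.comp_spec {W L : ℕ} {σ : Store} (hσ : σ.Below L) (c : Cm) (hc : c.ok W σ) (d : ℕ)
    (μ : State) (hμ : Rep μ σ) :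
    Reaches (c.comp d) μ d (c.sem σ) (budget L (c.bd W)) fun _ => True := by
  induction c generalizing σ L d μ with
  | skip =>
    refine ⟨_, _, Exec.const _ _ _, ?_, ⟨?_, hμ.m⟩, ?_, trivial⟩
    · have : Nat.size 0 = 0 := rfl
      simp only [budget, Cm.bd]
      omega
    · intro y
      have : (2 * y) ≠ 2 * d + 1 := by omega
      simp [State.setReg, Function.update_of_ne this, hμ.v, Cm.sem]
    · intro y hy
      have : (2 * y + 1) ≠ 2 * d + 1 := by omega
      simp [State.setReg, Function.update_of_ne this]
  | set x e =>
    obtain ⟨μ1, k1, x1, t1, r1, f1, v1⟩ := e.comp_spec hσ hc d μ hμ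
    refine ⟨_, _, Exec.seq x1 (Exec.seq (Exec.const _ _ _) (Exec.add _ _ _ _)), ?_, ⟨?_, r1.m⟩, ?_,
      trivial⟩
    · have s1 := size_le_of_lt (e.eval_lt hσ hc)
      have hne : 2 * d + 1 ≠ 2 * (d + 1) + 1 := by omega
      have s2 : Nat.size 0 = 0 := rfl
      simp only [State.setReg, Function.update_of_ne hne, Function.update_self, v1, s2]
      have h1 := budget_add L (e.bd W) 0 1
      have h2 : budget (L + e.bd W) 0 = 0 := by simp [budget]
      rw [h2] at h1
      simp only [Cm.bd]
      simp only [add_zero] at h1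
      omega
    · intro y
      have h : (2 * y) ≠ 2 * (d + 1) + 1 := by omega
      have hne : 2 * d + 1 ≠ 2 * (d + 1) + 1 := by omega
      by_cases hy : y = x
      · subst hy
        simp [State.setReg, v1, Cm.sem]
      · have h' : 2 * y ≠ 2 * x := by omega
        simp [State.setReg, Function.update_of_ne h, Function.update_of_ne h',
          Function.update_of_ne hy, r1.v, Cm.sem]
    · intro y hy
      have h : (2 * y + 1) ≠ 2 * (d + 1) + 1 := by omega
      have h' : (2 * y + 1) ≠ 2 * x := by omega
      simp only [State.setReg, Function.update_of_ne h, Function.update_of_ne h', f1 y hy]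
  | put a b =>
    obtain ⟨μ1, k1, x1, t1, r1, f1, v1⟩ := a.comp_spec hσ hc.1 d μ hμ
    obtain ⟨μ2, k2, x2, t2, r2, f2, v2⟩ := b.comp_spec hσ hc.2 (d + 1) μ1 r1
    have hv : μ2.reg (2 * d + 1) = a.eval σ := (f2 d (by omega)).trans v1
    refine ⟨_, _, Exec.seq x1 (Exec.seq x2 (Exec.store _ _ _)), ?_, ⟨r2.v, ?_⟩, fun y hy => ?_,
      trivial⟩
    · have s1 := size_le_of_lt (a.eval_lt hσ hc.1)
      have s2 := size_le_of_lt (b.eval_lt hσ hc.2)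
      rw [hv, v2]
      have := budget_add L (a.bd W) (b.bd W) 1
      have := budget_mono (Nat.le_add_right L (a.bd W)) le_rfl (b := b.bd W)
      simp only [Cm.bd]
      omega
    · simp only [State.setMem, Cm.sem, hv, v2, r2.m]
    · exact (f2 y (by omega)).trans (f1 y hy)
  | seq p q ihp ihq =>
    obtain ⟨μ1, k1, x1, t1, r1, f1, -⟩ := ihp hσ hc.1 d μ hμ
    obtain ⟨μ2, k2, x2, t2, r2, f2, -⟩ := ihq (p.below_sem hσ hc.1) hc.2 d μ1 r1
    refine ⟨_, _, Exec.seq x1 x2, ?_, r2, fun y hy => (f2 y hy).trans (f1 y hy), trivial⟩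
    have := budget_add L (p.bd W) (q.bd W) 0
    simp only [Cm.bd]
    simp only [add_zero] at this
    omega
  | ite e p q ihp ihq =>
    obtain ⟨μ1, k1, x1, t1, r1, f1, v1⟩ := e.comp_spec hσ hc.1 d μ hμ
    have s1 := size_le_of_lt (e.eval_lt hσ hc.1)
    have h1 := budget_add L (e.bd W) (p.bd W + q.bd W) 1
    have h2 : budget L (p.bd W) ≤ budget (L + e.bd W) (p.bd W + q.bd W) :=
      budget_mono (by omega) (by omega)
    have h3 : budget L (q.bd W) ≤ budget (L + e.bd W) (p.bd W + q.bd W) :=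
      budget_mono (by omega) (by omega)
    have h4 : (Cm.ite e p q).bd W = e.bd W + (p.bd W + q.bd W) + 1 := by
      simp only [Cm.bd]; omega
    by_cases h : e.eval σ = 0
    · obtain ⟨μ2, k2, x2, t2, r2, f2, -⟩ := ihq hσ (hc.2.2 h) d μ1 r1
      refine ⟨_, _, Exec.seq x1 (Exec.ite_false (v1.trans h) x2), ?_, ?_,
        fun y hy => (f2 y hy).trans (f1 y hy), trivial⟩
      · rw [v1, h4]
        omega
      · simpa [Cm.sem, h] using r2
    · obtain ⟨μ2, k2, x2, t2, r2, f2, -⟩ := ihp hσ (hc.2.1 h) d μ1 r1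
      refine ⟨_, _, Exec.seq x1 (Exec.ite_true (v1.trans_ne h) x2), ?_, ?_,
        fun y hy => (f2 y hy).trans (f1 y hy), trivial⟩
      · rw [v1, h4]
        omega
      · simpa [Cm.sem, h] using r2
  | rep e c ih =>
    obtain ⟨μ1, k1, x1, t1, r1, f1, v1⟩ := e.comp_spec hσ hc.1 d μ hμ
    have key : ∀ n ≤ e.eval σ, (c.sem^[n] σ).Below (L + n * c.bd W) := by
      intro n hn
      induction n with
      | zero => simpa using hσ
      | succ n ihn =>
        rw [Function.iterate_succ_apply']
        exact (c.below_sem (ihn (by omega)) (hc.2.2 n (by omega))).mono (by ring_nf; omega)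
    -- All iterations are charged the same price: iteration `j` starts below `2 ^ (L + j * c.bd W)`,
    -- and `(j + 1) * c.bd W ≤ W * c.bd W`.
    have hW : ∀ n ≤ e.eval σ, n * c.bd W ≤ W * c.bd W := fun n hn =>
      Nat.mul_le_mul_right _ (hn.trans hc.2.1)
    obtain ⟨ν, k, x, t, r, f, -⟩ := exec_rep_loop (c := c) (L := W)
      (b := 8 * c.bd W * (L + W * c.bd W + 1)) r1 v1
      (hc.2.1.trans_lt Nat.lt_two_pow_self) fun j hj μ hμ => by
        rw [Function.iterate_succ_apply']
        obtain ⟨ν, k, x, t, h⟩ := ih (key j hj.le) (hc.2.2 j hj) (d + 1) μ hμ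
        refine ⟨ν, k, x, t.trans ?_, h⟩
        have := hW (j + 1) hj
        exact Nat.mul_le_mul_left _ (by linarith)
    refine ⟨_, _, Exec.seq x1 x, ?_, r, fun y hy => (f y hy).trans (f1 y hy), trivial⟩
    have h1 : k ≤ W * (8 * c.bd W * (L + W * c.bd W + 1) + 2 * W + 5) + 1 :=
      t.trans (by gcongr; exact hc.2.1)
    have h2 := budget_add L (e.bd W) (W * (c.bd W + 2)) 1
    have h3 : W * (8 * c.bd W * (L + W * c.bd W + 1) + 2 * W + 5) ≤
        budget (L + e.bd W) (W * (c.bd W + 2)) := by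
      have e1 : budget (L + e.bd W) (W * (c.bd W + 2)) =
        W * (8 * c.bd W * (L + e.bd W + W * (c.bd W + 2) + 1) +
          16 * (L + e.bd W + W * (c.bd W + 2) + 1)) := by unfold budget; ring
      rw [e1]
      apply Nat.mul_le_mul_left
      have e2 : 8 * c.bd W * (L + W * c.bd W + 1) ≤
          8 * c.bd W * (L + e.bd W + W * (c.bd W + 2) + 1) :=
        Nat.mul_le_mul_left _ (by rw [mul_add]; omega)
      have e3 : 16 * (W * 2) + 16 ≤ 16 * (L + e.bd W + W * (c.bd W + 2) + 1) := by
        rw [mul_add W]; omega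
      omega
    have h4 : (Cm.rep e c).bd W = e.bd W + W * (c.bd W + 2) + 1 := rfl
    rw [h4]
    omega

end RAM

namespace MGraph

/-! ### Scheduling dimension and carvings -/

/-- The graph with all edges reversed. -/
def flip (G : MGraph) : MGraph := ⟨G.V, fun x y => G.E y x⟩

/-- The weight of the edges that leave `X`. -/
def ocut (G : MGraph) (X : Finset ℕ) : ℕ := ∑ x ∈ X, ∑ y ∈ G.V \ X, G.E x y

def CutLe (G : MGraph) (s : ℕ) (X : Finset ℕ) : Prop := G.ocut X ≤ s ∧ G.flip.ocut X ≤ s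

/-- `X` is built from single nodes by disjoint unions, and all sets on the way have small cuts. -/
inductive Carve (G : MGraph) (s : ℕ) : Finset ℕ → Prop
  | leaf {x : ℕ} : x ∈ G.V → G.CutLe s {x} → Carve G s {x}
  | join {X Y : Finset ℕ} : Carve G s X → Carve G s Y → Disjoint X Y → G.CutLe s (X ∪ Y) →
      Carve G s (X ∪ Y)

/-- The preimage of a set of nodes under the contraction of `x` and `y` into `z`. -/
def expand (x y z : ℕ) (X : Finset ℕ) : Finset ℕ :=
  if z ∈ X then insert x (insert y (X.erase z)) else X

theorem contract_flip (G : MGraph) (x y z : ℕ) :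
    (G.contract x y z).flip = G.flip.contract x y z := by
  simp only [flip, contract, MGraph.mk.injEq, true_and]
  funext v w
  by_cases h1 : v = z <;> by_cases h2 : w = z <;> simp [h1, h2]

/-- The preimage of `X` contains both or neither of `x` and `y`, so the edges between them, which
the contraction deletes, do not cross the cut; every other edge keeps its weight in the sums. -/
theorem ocut_contract {G : MGraph} {x y z : ℕ} (hx : x ∈ G.V) (hy : y ∈ G.V) (hxy : x ≠ y)
    (hz : z ∉ G.V) {X : Finset ℕ} (hX : X ⊆ (G.contract x y z).V) :
    (G.contract x y z).ocut X = G.ocut (expand x y z X) := by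
  have hzx : z ≠ x := fun h => hz (h ▸ hx)
  have hzy : z ≠ y := fun h => hz (h ▸ hy)
  have hX' : ∀ v ∈ X, v ≠ z → v ∈ G.V ∧ v ≠ x ∧ v ≠ y := by
    intro v hv hvz
    have := hX hv
    simp only [contract, Finset.mem_insert, Finset.mem_erase] at this
    tauto
  unfold ocut expand
  by_cases h : z ∈ X
  · rw [if_pos h]
    have hc : (G.contract x y z).V \ X = G.V \ insert x (insert y (X.erase z)) := by
      ext w
      simp only [contract, Finset.mem_sdiff, Finset.mem_insert, Finset.mem_erase]
      constructor
      · rintro ⟨rfl | h1, h2⟩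
        · exact absurd h h2
        · exact ⟨h1.2.2, by tauto⟩
      · rintro ⟨h1, h2⟩
        have : w ≠ z := fun h => hz (h ▸ h1)
        tauto
    rw [hc, ← Finset.insert_erase h, Finset.sum_insert (Finset.notMem_erase _ _),
      Finset.sum_insert, Finset.sum_insert, ← add_assoc, ← Finset.sum_add_distrib,
      Finset.erase_insert (Finset.notMem_erase _ _)]
    · congr 1
      · refine Finset.sum_congr rfl fun w hw => ?_
        have hw' : w ≠ z := fun h => hz (h ▸ (Finset.mem_sdiff.1 hw).1)
        simp [contract, hw']
      · refine Finset.sum_congr rfl fun v hv => Finset.sum_congr rfl fun w hw => ?_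
        have hw' : w ≠ z := fun h => hz (h ▸ (Finset.mem_sdiff.1 hw).1)
        have hv' : v ≠ z := (Finset.mem_erase.1 hv).1
        simp [contract, hw', hv']
    · intro h'
      rw [Finset.insert_erase h] at h'
      have := Finset.mem_erase.1 h'
      exact (hX' y this.2 this.1).2.2 rfl
    · intro h'
      rw [Finset.insert_erase h] at h'
      rcases Finset.mem_insert.1 h' with h' | h'
      · exact hxy h'
      · have := Finset.mem_erase.1 h'
        exact (hX' x this.2 this.1).2.1 rfl
  · rw [if_neg h]
    refine Finset.sum_congr rfl fun v hv => ?_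
    have hvz : v ≠ z := fun e => h (e ▸ hv)
    have h1 : (G.contract x y z).V \ X = insert z (((G.V.erase x).erase y) \ X) := by
      ext w
      simp only [contract, Finset.mem_sdiff, Finset.mem_insert, Finset.mem_erase]
      constructor
      · tauto
      · rintro (rfl | h1) <;> tauto
    have h2 : G.V \ X = insert x (insert y (((G.V.erase x).erase y) \ X)) := by
      have hxX : x ∉ X := fun h' => (hX' x h' hzx.symm).2.1 rfl
      have hyX : y ∉ X := fun h' => (hX' y h' hzy.symm).2.2 rfl
      ext w
      simp only [Finset.mem_sdiff, Finset.mem_insert, Finset.mem_erase]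
      constructor
      · tauto
      · rintro (rfl | rfl | h1) <;> tauto
    rw [h1, h2, Finset.sum_insert, Finset.sum_insert, Finset.sum_insert, ← add_assoc]
    · congr 1
      · simp [contract, hvz]
      · refine Finset.sum_congr rfl fun w hw => ?_
        have hw' : w ≠ z := by
          rintro rfl
          simp only [Finset.mem_sdiff, Finset.mem_erase] at hw
          exact hz hw.1.2.2
        simp [contract, hvz, hw']
    · simp
    · simp [hxy]
    · simp [hz]

theorem cutLe_contract {G : MGraph} {x y z s : ℕ} (hx : x ∈ G.V) (hy : y ∈ G.V) (hxy : x ≠ y)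
    (hz : z ∉ G.V) {X : Finset ℕ} (hX : X ⊆ (G.contract x y z).V) :
    (G.contract x y z).CutLe s X ↔ G.CutLe s (expand x y z X) := by
  unfold CutLe
  rw [ocut_contract hx hy hxy hz hX, contract_flip,
    ocut_contract (G := G.flip) hx hy hxy hz (by rw [← contract_flip]; exact hX)]

theorem Carve.subset {G : MGraph} {s : ℕ} {X : Finset ℕ} (h : G.Carve s X) : X ⊆ G.V := by
  induction h with
  | leaf h _ => simpa using h
  | join _ _ _ _ ih1 ih2 => exact Finset.union_subset ih1 ih2

theorem Carve.nonempty {G : MGraph} {s : ℕ} {X : Finset ℕ} (h : G.Carve s X) : X.Nonempty := by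
  induction h with
  | leaf h _ => simp
  | join _ _ _ _ ih1 ih2 => exact ih1.mono Finset.subset_union_left

theorem Carve.cutLe {G : MGraph} {s : ℕ} {X : Finset ℕ} (h : G.Carve s X) : G.CutLe s X := by
  cases h <;> assumption

theorem Carve.cutLe_singleton {G : MGraph} {s : ℕ} {X : Finset ℕ} (h : G.Carve s X) :
    ∀ x ∈ X, G.CutLe s {x} := by
  induction h with
  | leaf h hc => intro x hx; rwa [Finset.mem_singleton.1 hx]
  | join _ _ _ _ ih1 ih2 =>
    intro x hx
    rcases Finset.mem_union.1 hx with hx | hx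
    exacts [ih1 x hx, ih2 x hx]

/-- A graph without loops. -/
def Loopless (G : MGraph) : Prop := ∀ x, G.E x x = 0

theorem Loopless.contract {G : MGraph} (h : G.Loopless) (x y z : ℕ) :
    (G.contract x y z).Loopless := by
  intro v
  by_cases hv : v = z <;> simp [MGraph.contract, hv, h v]

theorem ocut_singleton {G : MGraph} (h : G.Loopless) {x : ℕ} (hx : x ∈ G.V) :
    G.ocut {x} = G.outdeg x := by
  unfold ocut outdeg
  rw [Finset.sum_singleton, ← Finset.add_sum_erase _ _ hx, h x, zero_add, Finset.sdiff_singleton_eq_erase]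

/-- Rephrased with cuts, the degree bound can be pulled back along contractions to cuts of larger
sets of the original graph. -/
theorem degree_le_iff {G : MGraph} (h : G.Loopless) {s : ℕ} :
    G.degree ≤ s ↔ ∀ x ∈ G.V, G.CutLe s {x} := by
  unfold degree
  rw [Finset.sup_le_iff]
  refine forall₂_congr fun x hx => ?_
  have h1 := ocut_singleton h hx
  have h2 := ocut_singleton (G := G.flip) (fun x => h x) hx
  unfold nodeDegree CutLe
  rw [h1, h2, max_le_iff, and_comm]
  rfl

/-- `G` has a contraction process of degree at most `s`. -/
inductive Contr (s : ℕ) : MGraph → Prop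
  | one {G : MGraph} : G.V.card = 1 → G.degree ≤ s → Contr s G
  | step {G H : MGraph} : G.degree ≤ s → G.ContractsTo H → Contr s H → Contr s G

theorem expand_union (x y z : ℕ) (X Y : Finset ℕ) :
    expand x y z (X ∪ Y) = expand x y z X ∪ expand x y z Y ∨ (z ∈ X ∧ z ∈ Y) := by
  by_cases h1 : z ∈ X <;> by_cases h2 : z ∈ Y <;> simp only [expand, h1, h2, Finset.mem_union,
    or_true, if_true, if_false, or_false, and_true, and_false, or_self]
  · ext w
    have : w = z → w ∉ Y := by rintro rfl; exact h2
    simp only [Finset.mem_insert, Finset.mem_union, Finset.mem_erase]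
    tauto
  · ext w
    have : w = z → w ∉ X := by rintro rfl; exact h1
    simp only [Finset.mem_insert, Finset.mem_union, Finset.mem_erase]
    tauto

theorem expand_V {G : MGraph} {x y z : ℕ} (hx : x ∈ G.V) (hy : y ∈ G.V) (hz : z ∉ G.V) :
    expand x y z (G.contract x y z).V = G.V := by
  unfold expand
  rw [if_pos (by simp [contract])]
  ext w
  have : w ∈ G.V → w ≠ z := by rintro h rfl; exact hz h
  have : w = x → w ∈ G.V := by rintro rfl; exact hx
  have : w = y → w ∈ G.V := by rintro rfl; exact hy
  simp only [contract, Finset.mem_insert, Finset.mem_erase]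
  tauto

/-- In the tree for the contracted graph, the leaf `{z}` is replaced by a join of the leaves `{x}`
and `{y}`. The cut of `{x, y}` is that of `{z}`, and the cuts of the new leaves are small by the
degree bound `hG`. -/
theorem Carve.of_contract {G : MGraph} {x y z s : ℕ} (hx : x ∈ G.V) (hy : y ∈ G.V) (hxy : x ≠ y)
    (hz : z ∉ G.V) (hG : ∀ v ∈ G.V, G.CutLe s {v}) {X : Finset ℕ}
    (h : (G.contract x y z).Carve s X) : G.Carve s (expand x y z X) := by
  induction h with
  | @leaf v hv hc =>
    rw [cutLe_contract hx hy hxy hz (by simpa using hv)] at hc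
    by_cases hvz : v = z
    · subst hvz
      have e : expand x y v {v} = {x} ∪ {y} := by
        simp [expand]
      rw [e] at hc ⊢
      exact .join (.leaf hx (hG x hx)) (.leaf hy (hG y hy)) (by simpa using hxy) hc
    · have e : expand x y z {v} = {v} := by simp [expand, Ne.symm hvz]
      rw [e] at hc ⊢
      refine .leaf ?_ hc
      simp only [contract, Finset.mem_insert, Finset.mem_erase] at hv
      tauto
  | @join X Y h1 h2 hd hc ih1 ih2 =>
    rw [cutLe_contract hx hy hxy hz (Finset.union_subset h1.subset h2.subset)] at hc
    rcases expand_union x y z X Y with e | ⟨e1, e2⟩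
    · rw [e] at hc ⊢
      refine .join ih1 ih2 ?_ hc
      have key : ∀ X : Finset ℕ, X ⊆ (G.contract x y z).V → x ∉ X ∧ y ∉ X := by
        intro X hX
        constructor <;> intro h <;> have := hX h <;>
          simp only [contract, Finset.mem_insert, Finset.mem_erase] at this
        · rcases this with rfl | h
          exacts [hz hx, h.2.1 rfl]
        · rcases this with rfl | h
          exacts [hz hy, h.1 rfl]
      have kX := key X h1.subset
      have kY := key Y h2.subset
      rw [Finset.disjoint_left] at hd ⊢
      intro w hw hw'
      unfold expand at hw hw'
      by_cases a : z ∈ X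
      · have b : z ∉ Y := hd a
        rw [if_pos a] at hw
        rw [if_neg b] at hw'
        simp only [Finset.mem_insert, Finset.mem_erase] at hw
        rcases hw with rfl | rfl | hw
        exacts [kY.1 hw', kY.2 hw', hd hw.2 hw']
      · rw [if_neg a] at hw
        split_ifs at hw' with b
        · simp only [Finset.mem_insert, Finset.mem_erase] at hw'
          rcases hw' with rfl | rfl | hw'
          exacts [kX.1 hw, kX.2 hw, hd hw hw'.2]
        · exact hd hw hw'
    · exact absurd e2 (Finset.disjoint_left.1 hd e1)

theorem Contr.carve {s : ℕ} {G : MGraph} (h : Contr s G) (hG : G.Loopless) : G.Carve s G.V := by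
  induction h with
  | one h hd =>
    obtain ⟨x, hx⟩ := Finset.card_eq_one.1 h
    rw [hx]
    exact .leaf (by simp [hx]) ((degree_le_iff hG).1 hd x (by simp [hx]))
  | step hd hc _ ih =>
    obtain ⟨x, hx, y, hy, z, hz, hxy, rfl⟩ := hc
    have := (ih (hG.contract x y z)).of_contract hx hy hxy hz ((degree_le_iff hG).1 hd)
    rwa [expand_V hx hy hz] at this

/-- A subtree that avoids `x` and `y` consists of sets that are their own preimages, so it survives
unchanged. -/
theorem Carve.contract_of_notMem {G : MGraph} {x y z s : ℕ} (hx : x ∈ G.V) (hy : y ∈ G.V)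
    (hxy : x ≠ y) (hz : z ∉ G.V) {X : Finset ℕ} (h : G.Carve s X) (hxX : x ∉ X) (hyX : y ∉ X) :
    (G.contract x y z).Carve s X := by
  have key : ∀ X : Finset ℕ, X ⊆ G.V → x ∉ X → y ∉ X →
      X ⊆ (G.contract x y z).V ∧ expand x y z X = X := by
    intro X hX h1 h2
    refine ⟨fun v hv => ?_, ?_⟩
    · have a : v ≠ x := fun h => h1 (h ▸ hv)
      have b : v ≠ y := fun h => h2 (h ▸ hv)
      simp [contract, a, b, hX hv]
    · rw [expand, if_neg fun h => hz (hX h)]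
  induction h with
  | @leaf v hv hc =>
    obtain ⟨k1, k2⟩ := key {v} (by simpa using hv) hxX hyX
    exact .leaf (k1 (Finset.mem_singleton_self v)) ((cutLe_contract hx hy hxy hz k1).2 (by rwa [k2]))
  | @join X Y h1 h2 hd hc ih1 ih2 =>
    obtain ⟨k1, k2⟩ := key (X ∪ Y) (Finset.union_subset h1.subset h2.subset) hxX hyX
    simp only [Finset.mem_union, not_or] at hxX hyX
    exact .join (ih1 hxX.1 hyX.1) (ih2 hxX.2 hyX.2) hd
      ((cutLe_contract hx hy hxy hz k1).2 (by rwa [k2]))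

/-- A tree with at least two leaves has two sibling leaves `x` and `y`. All sets above them contain
both, all other sets neither, apart from the two leaves, so contracting them turns their parent into
a leaf and gives a tree for the contracted graph. -/
theorem Carve.exists_contract {G : MGraph} {s : ℕ} {X : Finset ℕ} (h : G.Carve s X)
    (hX : 2 ≤ X.card) : ∃ x ∈ X, ∃ y ∈ X, x ≠ y ∧ ∀ z ∉ G.V,
      (G.contract x y z).Carve s (insert z ((X.erase x).erase y)) := by
  induction h with
  | leaf => simp at hX
  | @join X Y h1 h2 hd hc ih1 ih2 =>
    have key : ∀ {x y z : ℕ}, x ∈ X ∪ Y → y ∈ X ∪ Y → x ≠ y → z ∉ G.V →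
        (G.contract x y z).CutLe s (insert z (((X ∪ Y).erase x).erase y)) := by
      intro x y z hx hy hxy hz
      have hs := Finset.union_subset h1.subset h2.subset
      rw [cutLe_contract (hs hx) (hs hy) hxy hz]
      · convert hc using 1
        unfold expand
        rw [if_pos (by simp)]
        ext w
        have : w ∈ X ∪ Y → w ≠ z := by rintro h rfl; exact hz (hs h)
        have : w = x → w ∈ X ∪ Y := by rintro rfl; exact hx
        have : w = y → w ∈ X ∪ Y := by rintro rfl; exact hy
        simp only [Finset.mem_insert, Finset.mem_erase]
        tauto
      · intro w hw
        have : w ∈ X ∪ Y → w ∈ G.V := fun h => hs h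
        simp only [contract, Finset.mem_insert, Finset.mem_erase] at hw ⊢
        tauto
    -- Sibling leaves found in one of the two subtrees also serve for the join, since the other
    -- subtree avoids them. Stated for arbitrary sets so that it can be used for either side.
    have side : ∀ {X Y : Finset ℕ}, G.Carve s X → G.Carve s Y → Disjoint X Y →
        (∀ {x y z : ℕ}, x ∈ X ∪ Y → y ∈ X ∪ Y → x ≠ y → z ∉ G.V →
          (G.contract x y z).CutLe s (insert z (((X ∪ Y).erase x).erase y))) →
        (∃ x ∈ X, ∃ y ∈ X, x ≠ y ∧ ∀ z ∉ G.V,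
          (G.contract x y z).Carve s (insert z ((X.erase x).erase y))) →
        ∃ x ∈ X ∪ Y, ∃ y ∈ X ∪ Y, x ≠ y ∧ ∀ z ∉ G.V,
          (G.contract x y z).Carve s (insert z (((X ∪ Y).erase x).erase y)) := by
      rintro X Y h1 h2 hd key ⟨x, hx, y, hy, hxy, h⟩
      have hxY := Finset.disjoint_left.1 hd hx
      have hyY := Finset.disjoint_left.1 hd hy
      refine ⟨x, Finset.mem_union_left _ hx, y, Finset.mem_union_left _ hy, hxy, fun z hz => ?_⟩
      have hk := key (Finset.mem_union_left _ hx) (Finset.mem_union_left _ hy) hxy hz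
      have e : insert z (((X ∪ Y).erase x).erase y) = insert z ((X.erase x).erase y) ∪ Y := by
        rw [Finset.erase_union_distrib, Finset.erase_union_distrib, Finset.erase_eq_of_notMem hxY,
          Finset.erase_eq_of_notMem hyY, Finset.insert_union]
      rw [e] at hk ⊢
      refine .join (h z hz) (h2.contract_of_notMem (h1.subset hx) (h1.subset hy) hxy hz hxY hyY)
        ?_ hk
      rw [Finset.disjoint_left] at hd ⊢
      intro w hw hw'
      rcases Finset.mem_insert.1 hw with rfl | hw
      · exact hz (h2.subset hw')
      · exact hd (Finset.mem_of_mem_erase (Finset.mem_of_mem_erase hw)) hw'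
    by_cases c1 : 2 ≤ X.card
    · exact side h1 h2 hd key (ih1 c1)
    by_cases c2 : 2 ≤ Y.card
    · rw [Finset.union_comm] at key ⊢
      exact side h2 h1 hd.symm key (ih2 c2)
    obtain ⟨x, rfl⟩ := Finset.card_eq_one.1 (le_antisymm (by omega) h1.nonempty.card_pos)
    obtain ⟨y, rfl⟩ := Finset.card_eq_one.1 (le_antisymm (by omega) h2.nonempty.card_pos)
    have hxy : x ≠ y := by simpa using hd
    refine ⟨x, by simp, y, by simp, hxy, fun z hz => ?_⟩
    have hk := key (x := x) (y := y) (by simp) (by simp) hxy hz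
    have e : insert z ((({x} ∪ {y} : Finset ℕ).erase x).erase y) = {z} := by
      ext w
      simp only [Finset.mem_insert, Finset.mem_erase, Finset.mem_union, Finset.mem_singleton]
      tauto
    rw [e] at hk ⊢
    exact .leaf (by simp [contract]) hk

theorem card_contract {G : MGraph} {x y z : ℕ} (hx : x ∈ G.V) (hy : y ∈ G.V) (hxy : x ≠ y)
    (hz : z ∉ G.V) : (G.contract x y z).V.card + 1 = G.V.card := by
  simp only [contract]
  rw [Finset.card_insert_of_notMem (by simp [hz]),
    Finset.card_erase_of_mem (Finset.mem_erase.2 ⟨hxy.symm, hy⟩), Finset.card_erase_of_mem hx]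
  have : 1 < G.V.card := Finset.one_lt_card.2 ⟨x, hx, y, hy, hxy⟩
  omega

theorem Carve.contr {s : ℕ} {G : MGraph} (h : G.Carve s G.V) (hG : G.Loopless) : Contr s G := by
  induction hn : G.V.card using Nat.strong_induction_on generalizing G with
  | _ n ih =>
    have hd : G.degree ≤ s := (degree_le_iff hG).2 h.cutLe_singleton
    by_cases hc : 2 ≤ G.V.card
    · obtain ⟨x, hx, y, hy, hxy, hcon⟩ := h.exists_contract hc
      obtain ⟨z, hz⟩ := Infinite.exists_notMem_finset G.V
      have := card_contract hx hy hxy hz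
      exact .step hd ⟨x, hx, y, hy, z, hz, hxy, rfl⟩
        (ih _ (by omega) (hcon z hz) (hG.contract x y z) rfl)
    · exact .one (le_antisymm (by omega) h.nonempty.card_pos) hd

/-- Without this, a small value of `sdim` could be the infimum of the empty set, and no process
would realize it. -/
theorem Contr.exists_of_nonempty {G : MGraph} (h : G.V.Nonempty) : ∃ s, Contr s G := by
  induction hn : G.V.card using Nat.strong_induction_on generalizing G with
  | _ n ih =>
    have mono : ∀ {s s' : ℕ} {G : MGraph}, s ≤ s' → Contr s G → Contr s' G := by
      intro s s' G hs hG
      induction hG with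
      | one h hd => exact .one h (hd.trans hs)
      | step hd hc _ ih => exact .step (hd.trans hs) hc ih
    by_cases hc : 2 ≤ G.V.card
    · obtain ⟨x, hx, y, hy, hxy⟩ := Finset.one_lt_card.1 hc
      obtain ⟨z, hz⟩ := Infinite.exists_notMem_finset G.V
      have := card_contract hx hy hxy hz
      obtain ⟨s, hs⟩ := ih _ (by omega) (G := G.contract x y z) ⟨z, by simp [contract]⟩ rfl
      exact ⟨max s G.degree, .step (le_max_right _ _) ⟨x, hx, y, hy, z, hz, hxy, rfl⟩
        (mono (le_max_left _ _) hs)⟩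
    · exact ⟨_, .one (le_antisymm (by omega) h.card_pos) le_rfl⟩

theorem seqDegree_cons (G : MGraph) (π : List MGraph) :
    seqDegree (G :: π) = max G.degree (seqDegree π) := rfl

theorem contr_iff {s : ℕ} {G : MGraph} :
    Contr s G ↔ ∃ π, G.IsContractionSeq π ∧ seqDegree π ≤ s := by
  constructor
  · intro h
    induction h with
    | @one G h hd =>
      refine ⟨[G], ⟨rfl, by simp [h], by simp, G, by simp, h⟩, ?_⟩
      rw [seqDegree_cons]
      exact max_le hd (by simp [seqDegree])
    | @step G H hd hc _ ih =>
      obtain ⟨π, hπ, hs⟩ := ih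
      obtain ⟨x, hx, y, hy, z, hz, hxy, rfl⟩ := id hc
      cases π with
      | nil => simpa using hπ.head
      | cons K π =>
        have hK : K = G.contract x y z := by simpa using hπ.head
        refine ⟨G :: K :: π, ⟨rfl, ?_, ?_, ?_⟩, ?_⟩
        · rw [List.length_cons, hπ.length, card_contract hx hy hxy hz]
        · exact List.isChain_cons_cons.2 ⟨hK ▸ hc, hπ.chain⟩
        · simpa using hπ.last
        · rw [seqDegree_cons]
          exact max_le hd hs
  · rintro ⟨π, hπ, hs⟩
    have key : ∀ (π : List MGraph) (G : MGraph), π.head? = some G → π.IsChain ContractsTo →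
        (∃ H ∈ π.getLast?, H.V.card = 1) → seqDegree π ≤ s → Contr s G := by
      intro π
      induction π with
      | nil => simp
      | cons K π ih =>
        intro G hG hch hl hs
        obtain rfl : K = G := by simpa using hG
        rw [seqDegree_cons, max_le_iff] at hs
        cases π with
        | nil => exact .one (by simpa using hl) hs.1
        | cons H π =>
          rw [List.isChain_cons_cons] at hch
          exact .step hs.1 hch.1 (ih H rfl hch.2 (by simpa using hl) hs.2)
    exact key π G hπ.head hπ.chain hπ.last hs

/-- Nodes are necessary: the graph without nodes has scheduling dimension `0`, but a carved set is
never empty. This is why the empty word is treated apart in the end. -/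
theorem sdim_le_iff {s : ℕ} {G : MGraph} (hG : G.Loopless) (h : G.V.Nonempty) :
    G.sdim ≤ s ↔ G.Carve s G.V := by
  have h1 : G.Carve s G.V ↔ Contr s G := ⟨fun h => h.contr hG, fun h => h.carve hG⟩
  rw [h1, contr_iff]
  unfold sdim
  constructor
  · intro hs
    obtain ⟨s', h'⟩ := Contr.exists_of_nonempty h
    obtain ⟨π', hπ', -⟩ := contr_iff.1 h'
    obtain ⟨π, hπ, e⟩ := Nat.sInf_mem (s := {d | ∃ π, G.IsContractionSeq π ∧ d = seqDegree π})
      ⟨_, π', hπ', rfl⟩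
    exact ⟨π, hπ, e ▸ hs⟩
  · rintro ⟨π, hπ, hs⟩
    refine le_trans (Nat.sInf_le ?_) hs
    exact ⟨π, hπ, rfl⟩

end MGraph

/-! ### Blocks of a word

Words are written with the latest letter first. -/

section Blocks

variable {α : Type*}

/-- Add a letter to the latest block. -/
def consHead (e : α) : List (List α) → List (List α)
  | [] => [[e]]
  | b :: bs => (e :: b) :: bs

/-- The maximal factors of a word whose letters satisfy `f`. -/
def blocks (f : α → Bool) : List α → List (List α)
  | [] => []
  | e :: v => if f e then (if v.head?.any f then consHead e (blocks f v) else [e] :: blocks f v)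
      else blocks f v

/-- The number of positions at which a letter with `p` is followed by a letter with `q`. -/
def adj (p q : α → Bool) : List α → ℕ
  | [] => 0
  | e :: v => (if v.head?.any p && q e then 1 else 0) + adj p q v

/-- Whether a word begins and ends with letters that satisfy `f`. -/
def wraps (f : α → Bool) (v : List α) : ℕ :=
  if v.head?.any f && v.getLast?.any f then 1 else 0

theorem flatten_consHead (e : α) (bs : List (List α)) :
    (consHead e bs).flatten = e :: bs.flatten := by
  cases bs <;> simp [consHead]

theorem consHead_append (e : α) {bs : List (List α)} (h : bs ≠ []) (cs : List (List α)) :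
    consHead e bs ++ cs = consHead e (bs ++ cs) := by
  cases bs with
  | nil => exact absurd rfl h
  | cons => rfl

theorem flatten_blocks (f : α → Bool) (v : List α) : (blocks f v).flatten = v.filter f := by
  induction v with
  | nil => rfl
  | cons e v ih =>
    unfold blocks
    split_ifs with h1 h2 <;> simp [h1, flatten_consHead, ih]

theorem ne_nil_of_mem_blocks (f : α → Bool) (v : List α) : ∀ b ∈ blocks f v, b ≠ [] := by
  induction v with
  | nil => simp [blocks]
  | cons e v ih =>
    unfold blocks
    split_ifs with h1 h2
    · cases hb : blocks f v with
      | nil => simp [consHead]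
      | cons b bs =>
        intro c hc
        rcases List.mem_cons.1 hc with rfl | hc
        · simp
        · exact ih c (hb ▸ List.mem_cons_of_mem _ hc)
    · intro c hc
      rcases List.mem_cons.1 hc with rfl | hc
      · simp
      · exact ih c hc
    · exact ih

theorem blocks_of_head {f : α → Bool} {e : α} (v : List α) (he : f e = true) :
    ∃ b bs, blocks f (e :: v) = (e :: b) :: bs := by
  unfold blocks
  rw [if_pos he]
  split_ifs
  · cases blocks f v with
    | nil => exact ⟨[], [], rfl⟩
    | cons b bs => exact ⟨b, bs, rfl⟩
  · exact ⟨[], _, rfl⟩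

theorem blocks_ne_nil {f : α → Bool} {v : List α} (h : v.head?.any f = true) :
    blocks f v ≠ [] := by
  cases v with
  | nil => simp at h
  | cons e v =>
    obtain ⟨b, bs, hb⟩ := blocks_of_head (f := f) v (by simpa using h)
    simp [hb]

/-- A factor whose letters satisfy `f` lies inside one maximal factor for `g`. So the blocks of a
set of threads can be read off from the blocks of any larger set, which makes a recursion over the
carving possible. -/
theorem blocks_eq_flatMap {f g : α → Bool} (hfg : ∀ e, f e = true → g e = true) (v : List α) :
    blocks f v = (blocks g v).flatMap (blocks f) := by
  induction v with
  | nil => rfl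
  | cons e v ih =>
    have hhead : v.head?.any f = true → v.head?.any g = true := by
      cases v with
      | nil => simp
      | cons d v => simpa using hfg d
    by_cases hg : g e = true
    · by_cases h2 : v.head?.any g = true
      · obtain ⟨d, v', rfl⟩ : ∃ d v', v = d :: v' := by
          cases v with
          | nil => simp at h2
          | cons d v' => exact ⟨d, v', rfl⟩
        have hd : g d = true := by simpa using h2
        obtain ⟨b, bs, hb⟩ := blocks_of_head v' hd
        have e1 : blocks g (e :: d :: v') = (e :: d :: b) :: bs := by
          rw [blocks, if_pos hg, if_pos h2, hb]; rfl
        rw [hb] at ih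
        rw [e1]
        simp only [List.flatMap_cons] at ih ⊢
        by_cases hf : f e = true
        · by_cases hfd : f d = true
          · rw [blocks, if_pos hf, if_pos (by simpa using hfd), ih]
            conv_rhs => rw [blocks, if_pos hf, if_pos (by simpa using hfd)]
            rw [consHead_append _ (blocks_ne_nil (by simpa using hfd))]
          · rw [blocks, if_pos hf, if_neg (by simpa using hfd), ih]
            conv_rhs => rw [blocks, if_pos hf, if_neg (by simpa using hfd)]
            rfl
        · rw [blocks, if_neg hf, ih]
          conv_rhs => rw [blocks, if_neg hf]
      · have e1 : blocks g (e :: v) = [e] :: blocks g v := by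
          rw [blocks, if_pos hg, if_neg h2]
        rw [e1, List.flatMap_cons, ← ih]
        by_cases hf : f e = true
        · rw [blocks, if_pos hf, if_neg fun h => h2 (hhead h)]
          simp [blocks, hf]
        · rw [blocks, if_neg hf]
          simp [blocks, hf]
    · have hf : ¬ f e = true := fun h => hg (hfg e h)
      rw [blocks, if_neg hf, blocks, if_neg hg, ih]

theorem blocks_of_forall {f : α → Bool} {v : List α} (hv : v ≠ []) (h : ∀ e ∈ v, f e = true) :
    blocks f v = [v] := by
  induction v with
  | nil => exact absurd rfl hv
  | cons e v ih =>
    cases v with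
    | nil => simp [blocks, h e]
    | cons d v =>
      rw [blocks, if_pos (h e (by simp)), if_pos (by simpa using h d (by simp)),
        ih (by simp) fun c hc => h c (by simp [List.mem_cons.1 hc])]
      rfl

theorem blocks_of_forall_not {f : α → Bool} {v : List α} (h : ∀ e ∈ v, f e = false) :
    blocks f v = [] := by
  induction v with
  | nil => rfl
  | cons e v ih =>
    rw [blocks, if_neg (by simp [h e]), ih fun d hd => h d (List.mem_cons_of_mem _ hd)]

theorem adj_congr {p q p' q' : α → Bool} {v : List α} (hp : ∀ e ∈ v, p e = p' e)
    (hq : ∀ e ∈ v, q e = q' e) : adj p q v = adj p' q' v := by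
  induction v with
  | nil => rfl
  | cons e v ih =>
    rw [adj, adj, ih (fun d hd => hp d (List.mem_cons_of_mem _ hd))
      (fun d hd => hq d (List.mem_cons_of_mem _ hd)), hq e (by simp)]
    cases v with
    | nil => rfl
    | cons d v => simp [hp d]

theorem length_consHead (e : α) {bs : List (List α)} (h : bs ≠ []) :
    (consHead e bs).length = bs.length := by
  cases bs with
  | nil => exact absurd rfl h
  | cons => rfl

/-- Each block is left exactly once, except for one that contains the latest letter, which is the
head of the list. -/
theorem adj_out_add (f : α → Bool) (v : List α) :
    adj f (fun e => !f e) v + (if v.head?.any f then 1 else 0) = (blocks f v).length := by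
  induction v with
  | nil => rfl
  | cons e v ih =>
    rw [adj, blocks]
    by_cases h : f e = true <;> by_cases h2 : v.head?.any f = true
    · rw [if_pos h, if_pos h2, length_consHead _ (blocks_ne_nil h2), ← ih]
      simp [h, h2]
    · rw [if_pos h, if_neg h2, List.length_cons, ← ih]
      simp [h, h2]
    · rw [if_neg h, ← ih]
      simp [h, h2, add_comm]
    · rw [if_neg h, ← ih]
      simp [h, h2]

/-- Each block is entered exactly once, except for one that contains the earliest letter, which is
the last one of the list. -/
theorem adj_in_add (f : α → Bool) (v : List α) :
    adj (fun e => !f e) f v + (if v.getLast?.any f then 1 else 0) = (blocks f v).length := by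
  induction v with
  | nil => rfl
  | cons e v ih =>
    cases v with
    | nil => cases h : f e <;> simp [adj, blocks, h]
    | cons d v =>
      have hl : (e :: d :: v).getLast? = (d :: v).getLast? := by simp
      rw [hl, adj]
      by_cases h : f e = true <;> by_cases h2 : (d :: v).head?.any f = true
      · conv_rhs => rw [blocks, if_pos h, if_pos h2, length_consHead _ (blocks_ne_nil h2), ← ih]
        have h3 : f d = true := by simpa using h2
        simp [h3]
      · conv_rhs => rw [blocks, if_pos h, if_neg h2, List.length_cons, ← ih]
        have h3 : ¬ f d = true := by simpa using h2
        simp [h, h3]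
        omega
      · conv_rhs => rw [blocks, if_neg h, ← ih]
        simp [h]
      · conv_rhs => rw [blocks, if_neg h, ← ih]
        simp [h]

/-- The scheduling graph of a word, for letters with thread `th`. -/
def grph (th : α → ℕ) (v : List α) : MGraph where
  V := (v.map th).toFinset
  E i j := if i = j then 0 else adj (fun e => th e == i) (fun e => th e == j) v

theorem grph_loopless (th : α → ℕ) (v : List α) : (grph th v).Loopless := by
  intro x
  simp [grph]

theorem sum_sum_adj (th : α → ℕ) (A B : Finset ℕ) (v : List α) :
    ∑ i ∈ A, ∑ j ∈ B, adj (fun e => th e == i) (fun e => th e == j) v =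
      adj (fun e => decide (th e ∈ A)) (fun e => decide (th e ∈ B)) v := by
  induction v with
  | nil => simp [adj]
  | cons e v ih =>
    simp only [adj]
    rw [← ih]
    simp only [Finset.sum_add_distrib]
    congr 1
    cases v with
    | nil => simp
    | cons d v =>
      have : ∀ i j : ℕ, (if (((d :: v).head?.any fun e => th e == i) && th e == j) = true then 1
          else 0) = (if th d = i then 1 else 0) * (if th e = j then 1 else 0) := by
        intro i j
        by_cases h1 : th d = i <;> by_cases h2 : th e = j <;> simp [h1, h2]
      simp only [this, ← Finset.mul_sum, Finset.sum_ite_eq, ← Finset.sum_mul]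
      by_cases h1 : th d ∈ A <;> by_cases h2 : th e ∈ B <;> simp [h1, h2]

theorem ocut_grph (th : α → ℕ) (v : List α) {X : Finset ℕ} :
    (grph th v).ocut X =
      adj (fun e => decide (th e ∈ X)) (fun e => !decide (th e ∈ X)) v := by
  have h1 : (grph th v).ocut X = ∑ i ∈ X, ∑ j ∈ (grph th v).V \ X,
      adj (fun e => th e == i) (fun e => th e == j) v := by
    refine Finset.sum_congr rfl fun i hi => Finset.sum_congr rfl fun j hj => ?_
    have : i ≠ j := by rintro rfl; exact (Finset.mem_sdiff.1 hj).2 hi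
    simp [grph, this]
  rw [h1, sum_sum_adj]
  refine adj_congr (fun e _ => rfl) fun e he => ?_
  have : th e ∈ (grph th v).V := by
    simp only [grph, List.mem_toFinset, List.mem_map]
    exact ⟨e, he, rfl⟩
  simp [this]

theorem ocut_flip_grph (th : α → ℕ) (v : List α) {X : Finset ℕ} :
    (grph th v).flip.ocut X =
      adj (fun e => !decide (th e ∈ X)) (fun e => decide (th e ∈ X)) v := by
  have h1 : (grph th v).flip.ocut X = ∑ j ∈ (grph th v).V \ X, ∑ i ∈ X,
      adj (fun e => th e == j) (fun e => th e == i) v := by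
    rw [Finset.sum_comm]
    refine Finset.sum_congr rfl fun i hi => Finset.sum_congr rfl fun j hj => ?_
    have : j ≠ i := by rintro rfl; exact (Finset.mem_sdiff.1 hj).2 hi
    simp [MGraph.flip, grph, this]
  rw [h1, sum_sum_adj]
  refine adj_congr (fun e he => ?_) fun e _ => rfl
  have : th e ∈ (grph th v).V := by
    simp only [grph, List.mem_toFinset, List.mem_map]
    exact ⟨e, he, rfl⟩
  simp [this]

/-- The two cuts are the number of blocks minus the corrections in `adj_out_add` and `adj_in_add`.
Both are at most `s` iff the number of blocks is at most `s` plus the smaller correction, and this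
is `wraps`. -/
theorem cutLe_grph_iff (th : α → ℕ) (v : List α) {s : ℕ} {X : Finset ℕ} :
    (grph th v).CutLe s X ↔ (blocks (fun e => decide (th e ∈ X)) v).length ≤
      s + wraps (fun e => decide (th e ∈ X)) v := by
  have h1 := adj_out_add (fun e => decide (th e ∈ X)) v
  have h2 := adj_in_add (fun e => decide (th e ∈ X)) v
  unfold MGraph.CutLe wraps
  rw [ocut_grph, ocut_flip_grph]
  cases h3 : v.head?.any (fun e => decide (th e ∈ X)) <;>
    cases h4 : v.getLast?.any (fun e => decide (th e ∈ X)) <;>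
    simp only [h3, h4, if_true, if_false, Bool.false_eq_true, Bool.and_true, Bool.and_false] at * <;> omega

theorem zip_tail_concat (l : List α) (x e : α) :
    (l ++ [x] ++ [e]).zip (l ++ [x] ++ [e]).tail = (l ++ [x]).zip (l ++ [x]).tail ++ [(x, e)] := by
  induction l with
  | nil => rfl
  | cons y l ih =>
    cases l with
    | nil => rfl
    | cons z l => simpa using ih

end Blocks

theorem schedulingGraph_eq_grph {a t : ℕ} (v : List (Fin a × Fin t)) :
    schedulingGraph v.reverse = grph (fun e => (e.2 : ℕ)) v := by
  unfold schedulingGraph grph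
  congr 1
  · ext x
    simp
  · funext i j
    split_ifs
    · rfl
    · induction v with
      | nil => rfl
      | cons e v ih =>
        cases v with
        | nil => simp [adj]
        | cons d v =>
          rw [adj, ← ih, List.reverse_cons, List.reverse_cons, zip_tail_concat, List.countP_append]
          rw [add_comm]
          congr 1
          simp [List.countP_cons]

/-! ### Interleaving patterns -/

section Patterns

variable {β γ : Type*}

/-- The owner of the latest item of a pattern. An item of type `0` or `1` starts a new block of this
owner; an item of type `2` continues the latest block with an item of the other owner. -/
def own : List (ℕ × β) → ℕ
  | [] => 0
  | it :: l => if it.1 = 2 then 1 - own l else it.1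

/-- The items of owner `o`. -/
def pr (o : ℕ) : List (ℕ × β) → List β
  | [] => []
  | it :: l => if own (it :: l) = o then it.2 :: pr o l else pr o l

/-- The blocks of a pattern, for both owners together. -/
def mg (f : β → β → β) : List (ℕ × β) → List β
  | [] => []
  | it :: l => if it.1 = 2 then (mg f l).modifyHead (f it.2) else it.2 :: mg f l

/-- Items of type `2` continue the previous item. -/
def Linked (cp : β → β → Prop) : List (ℕ × β) → Prop
  | [] => True
  | it :: l => (it.1 = 2 → ∃ c ∈ l.head?, cp it.2 c.2) ∧ Linked cp l

/-- All items of owner `0` come before those of owner `1`. -/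
def InSequence : List (ℕ × β) → Prop
  | [] => True
  | it :: l => (own l = 1 → own (it :: l) = 1) ∧ InSequence l

/-- The owner of the first item. -/
def firstOwn : List (ℕ × β) → ℕ
  | [] => 0
  | it :: l => if l.length = 0 then own (it :: l) else firstOwn l

theorem exists_of_mem_forall₂ {R : γ → β → Prop} {l' : List γ} {l : List β}
    (h : List.Forall₂ R l' l) {a : γ} (ha : a ∈ l') : ∃ b ∈ l, R a b := by
  induction h with
  | nil => simp at ha
  | @cons c b _ _ h _ ih =>
    rcases List.mem_cons.1 ha with rfl | ha
    · exact ⟨b, by simp, h⟩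
    · obtain ⟨d, hd, h⟩ := ih ha
      exact ⟨d, List.mem_cons_of_mem _ hd, h⟩

theorem own_le_one {l : List (ℕ × β)} (h : ∀ it ∈ l, it.1 ≤ 2) : own l ≤ 1 := by
  cases l with
  | nil => simp [own]
  | cons it l =>
    have := h it (by simp)
    unfold own
    split_ifs <;> omega

theorem own_congr {R : γ → β → Prop} {l' : List (ℕ × γ)} {l : List (ℕ × β)}
    (h : List.Forall₂ (fun a b => a.1 = b.1 ∧ R a.2 b.2) l' l) : own l' = own l := by
  induction h with
  | nil => rfl
  | cons h _ ih => simp [own, h.1, ih]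

theorem firstOwn_congr {R : γ → β → Prop} {l' : List (ℕ × γ)} {l : List (ℕ × β)}
    (h : List.Forall₂ (fun a b => a.1 = b.1 ∧ R a.2 b.2) l' l) : firstOwn l' = firstOwn l := by
  induction h with
  | nil => rfl
  | cons h ht ih => simp [firstOwn, ih, own_congr ht, own, h.1, ht.length_eq]

theorem inSequence_congr {R : γ → β → Prop} {l' : List (ℕ × γ)} {l : List (ℕ × β)}
    (h : List.Forall₂ (fun a b => a.1 = b.1 ∧ R a.2 b.2) l' l) :
    InSequence l' ↔ InSequence l := by
  induction h with
  | nil => rfl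
  | cons h ht ih => simp [InSequence, ih, own_congr ht, own, h.1]

theorem linked_of_forall₂ {R : γ → β → Prop} {cp : β → β → Prop} {l' : List (ℕ × γ)}
    {l : List (ℕ × β)} (h : List.Forall₂ (fun a b => a.1 = b.1 ∧ R a.2 b.2) l' l)
    (hl : Linked cp l) : Linked (fun _ _ => True) l' := by
  induction h with
  | nil => trivial
  | cons h ht ih =>
    refine ⟨fun h2 => ?_, ih hl.2⟩
    obtain ⟨c, hc, -⟩ := hl.1 (h.1 ▸ h2)
    cases ht with
    | nil => simp at hc
    | @cons a _ => exact ⟨a, rfl, trivial⟩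

/-- For soundness: a pattern of pairs of states is filled with the words that witness the two
premises, each item taking the next word of its owner. -/
theorem exists_pattern {R : γ → β → Prop} (l : List (ℕ × β)) (hl : ∀ it ∈ l, it.1 ≤ 2)
    {ws₀ ws₁ : List γ} (h0 : List.Forall₂ R ws₀ (pr 0 l)) (h1 : List.Forall₂ R ws₁ (pr 1 l)) :
    ∃ l' : List (ℕ × γ), List.Forall₂ (fun a b => a.1 = b.1 ∧ R a.2 b.2) l' l ∧
      pr 0 l' = ws₀ ∧ pr 1 l' = ws₁ := by
  induction l generalizing ws₀ ws₁ with
  | nil =>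
    simp only [pr, List.forall₂_nil_right_iff] at h0 h1
    exact ⟨[], .nil, h0.symm, h1.symm⟩
  | cons it l ih =>
    have hl' : ∀ it ∈ l, it.1 ≤ 2 := fun x hx => hl x (List.mem_cons_of_mem _ hx)
    have ho := own_le_one hl
    rcases Nat.le_one_iff_eq_zero_or_eq_one.1 ho with e | e
    · rw [pr, if_pos e] at h0
      rw [pr, if_neg (by omega)] at h1
      obtain ⟨w, ws, hw, hws, rfl⟩ := List.forall₂_cons_right_iff.1 h0
      obtain ⟨l', h, e0, e1⟩ := ih hl' hws h1
      have hf : List.Forall₂ (fun a b => a.1 = b.1 ∧ R a.2 b.2) ((it.1, w) :: l') (it :: l) :=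
        .cons ⟨rfl, hw⟩ h
      have := own_congr hf
      refine ⟨_, hf, ?_, ?_⟩
      · rw [pr, if_pos (by omega), e0]
      · rw [pr, if_neg (by omega), e1]
    · rw [pr, if_neg (by omega)] at h0
      rw [pr, if_pos e] at h1
      obtain ⟨w, ws, hw, hws, rfl⟩ := List.forall₂_cons_right_iff.1 h1
      obtain ⟨l', h, e0, e1⟩ := ih hl' h0 hws
      have hf : List.Forall₂ (fun a b => a.1 = b.1 ∧ R a.2 b.2) ((it.1, w) :: l') (it :: l) :=
        .cons ⟨rfl, hw⟩ h
      have := own_congr hf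
      refine ⟨_, hf, ?_, ?_⟩
      · rw [pr, if_neg (by omega), e0]
      · rw [pr, if_pos (by omega), e1]

theorem mg_eq_cons {f : β → β → β} {cp : β → β → Prop} {it : ℕ × β} {l : List (ℕ × β)}
    (h : Linked cp (it :: l)) : ∃ c cs, mg f (it :: l) = c :: cs := by
  induction l generalizing it with
  | nil =>
    refine ⟨it.2, [], ?_⟩
    rw [mg, if_neg]
    · rfl
    · intro h2
      obtain ⟨c, hc, -⟩ := h.1 h2
      simp at hc
  | cons d l ih =>
    obtain ⟨c, cs, hc⟩ := ih h.2
    rw [mg, hc]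
    split_ifs
    · exact ⟨_, _, rfl⟩
    · exact ⟨_, _, rfl⟩

theorem length_pr_add {l : List (ℕ × β)} (hl : ∀ it ∈ l, it.1 ≤ 2) :
    (pr 0 l).length + (pr 1 l).length = l.length := by
  induction l with
  | nil => rfl
  | cons it l ih =>
    have hl' : ∀ it ∈ l, it.1 ≤ 2 := fun x hx => hl x (List.mem_cons_of_mem _ hx)
    have ih := ih hl'
    have ho := own_le_one hl
    rcases Nat.le_one_iff_eq_zero_or_eq_one.1 ho with e | e
    · rw [pr, if_pos e, pr, if_neg (by omega), List.length_cons, List.length_cons]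
      omega
    · rw [pr, if_neg (by omega), pr, if_pos e, List.length_cons, List.length_cons]
      omega

theorem pr_one_eq_nil {l : List (ℕ × β)} (hs : InSequence l) (hl : ∀ it ∈ l, it.1 ≤ 2)
    (h : own l = 0) : pr 1 l = [] := by
  induction l with
  | nil => rfl
  | cons it l ih =>
    have hl' : ∀ it ∈ l, it.1 ≤ 2 := fun x hx => hl x (List.mem_cons_of_mem _ hx)
    rw [pr, if_neg (by omega)]
    refine ih hs.2 hl' ?_
    have := own_le_one hl'
    by_contra h'
    have := hs.1 (by omega)
    omega

/-- The concatenation of all items of a pattern of words. -/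
def wordOf (l : List (ℕ × List γ)) : List γ := (l.map Prod.snd).flatten

theorem flatten_mg {l : List (ℕ × List γ)} {cp : List γ → List γ → Prop} (h : Linked cp l) :
    (mg (· ++ ·) l).flatten = wordOf l := by
  induction l with
  | nil => rfl
  | cons it l ih =>
    have ih := ih h.2
    rw [mg]
    split_ifs with h2
    · obtain ⟨c, hc, -⟩ := h.1 h2
      cases l with
      | nil => simp at hc
      | cons d l =>
        obtain ⟨c, cs, e⟩ := mg_eq_cons (f := (· ++ ·)) h.2
        rw [e] at ih ⊢
        simp only [wordOf, List.map_cons, List.flatten_cons, List.modifyHead_cons] at ih ⊢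
        rw [List.append_assoc, ih]
    · simp only [wordOf, List.flatten_cons, List.map_cons, ih]

theorem filter_wordOf {l : List (ℕ × List γ)} {f : γ → Bool} {o : ℕ} (ho : o ≤ 1)
    (hl : ∀ it ∈ l, it.1 ≤ 2) (h : ∀ w ∈ pr (1 - o) l, ∀ e ∈ w, f e = false) :
    (wordOf l).filter f = (pr o l).flatten.filter f := by
  induction l with
  | nil => rfl
  | cons it l ih =>
    have hl' : ∀ it ∈ l, it.1 ≤ 2 := fun x hx => hl x (List.mem_cons_of_mem _ hx)
    have hown := own_le_one hl
    have e1 : wordOf (it :: l) = it.2 ++ wordOf l := by simp [wordOf]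
    rw [e1, List.filter_append]
    by_cases e : own (it :: l) = o
    · rw [pr, if_neg (by omega)] at h
      rw [ih hl' h, pr, if_pos e, List.flatten_cons, List.filter_append]
    · rw [pr, if_pos (by omega)] at h
      rw [ih hl' fun w hw => h w (List.mem_cons_of_mem _ hw), pr, if_neg e,
        List.filter_eq_nil_iff.2 fun x hx => by simp [h it.2 (by simp) x hx], List.nil_append]

theorem wordOf_of_inSequence {l : List (ℕ × List γ)} (hs : InSequence l)
    (hl : ∀ it ∈ l, it.1 ≤ 2) : wordOf l = (pr 1 l).flatten ++ (pr 0 l).flatten := by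
  induction l with
  | nil => rfl
  | cons it l ih =>
    have hl' : ∀ it ∈ l, it.1 ≤ 2 := fun x hx => hl x (List.mem_cons_of_mem _ hx)
    have e1 : wordOf (it :: l) = it.2 ++ wordOf l := by simp [wordOf]
    rw [e1, ih hs.2 hl']
    rcases Nat.le_one_iff_eq_zero_or_eq_one.1 (own_le_one hl) with e | e
    · rw [pr_one_eq_nil hs hl e, pr, if_pos e]
      have : own l = 0 := by
        have := own_le_one hl'
        by_contra h'
        have := hs.1 (by omega)
        omega
      rw [pr_one_eq_nil hs.2 hl' this]
      simp
    · conv_rhs => rw [pr, if_pos e, pr, if_neg (by omega)]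
      simp

theorem head_mg {l : List (ℕ × List γ)} {it : ℕ × List γ} {cp : List γ → List γ → Prop}
    (h : Linked cp (it :: l)) (hne : it.2 ≠ []) :
    ∃ c cs, mg (· ++ ·) (it :: l) = c :: cs ∧ c.head? = it.2.head? := by
  obtain ⟨c, cs, e⟩ := mg_eq_cons (f := (· ++ ·)) h
  refine ⟨c, cs, e, ?_⟩
  rw [mg] at e
  obtain ⟨x, w, hw⟩ := List.exists_cons_of_ne_nil hne
  split_ifs at e with h2
  · cases hm : mg (· ++ ·) l with
    | nil => simp [hm] at e
    | cons d ds =>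
      simp only [hm, List.modifyHead_cons, List.cons.injEq] at e
      rw [← e.1, hw]
      rfl
  · simp only [List.cons.injEq] at e
    rw [e.1]

theorem blocks_append {f : γ → Bool} {w c : List γ} (hw : w ≠ []) (h : ∀ e ∈ w, f e = true)
    (hc : c.head?.any f = false) : blocks f (w ++ c) = w :: blocks f c := by
  induction w with
  | nil => exact absurd rfl hw
  | cons e w ih =>
    cases w with
    | nil => simp [blocks, h e, hc]
    | cons d w =>
      rw [List.cons_append, blocks, if_pos (h e (by simp)), if_pos (by simpa using h d (by simp)),
        ih (by simp) fun x hx => h x (List.mem_cons_of_mem _ hx)]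
      rfl

theorem blocks_append_of_not {f : γ → Bool} {w c : List γ} (h : ∀ e ∈ w, f e = false) :
    blocks f (w ++ c) = blocks f c := by
  induction w with
  | nil => rfl
  | cons e w ih =>
    rw [List.cons_append, blocks, if_neg (by simp [h e]),
      ih fun x hx => h x (List.mem_cons_of_mem _ hx)]

/-- Two items that are glued in a merged block have different owners, by the definition of `own` for
type `2`. Hence every item is a whole block of its owner within the merged block. -/
theorem flatMap_blocks_mg {l : List (ℕ × List γ)} {cp : List γ → List γ → Prop}
    (hlk : Linked cp l) (hl : ∀ it ∈ l, it.1 ≤ 2) (hne : ∀ it ∈ l, it.2 ≠ []) {f : γ → Bool}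
    {o : ℕ} (ho : o ≤ 1) (h0 : ∀ w ∈ pr o l, ∀ e ∈ w, f e = true)
    (h1 : ∀ w ∈ pr (1 - o) l, ∀ e ∈ w, f e = false) :
    (mg (· ++ ·) l).flatMap (blocks f) = pr o l := by
  induction l with
  | nil => rfl
  | cons it l ih =>
    have hl' : ∀ it ∈ l, it.1 ≤ 2 := fun x hx => hl x (List.mem_cons_of_mem _ hx)
    have hne' : ∀ it ∈ l, it.2 ≠ [] := fun x hx => hne x (List.mem_cons_of_mem _ hx)
    have hown := own_le_one hl
    have hown' := own_le_one hl'
    have hit := hne it (by simp)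
    by_cases e : own (it :: l) = o
    · have h1' := h1
      rw [pr, if_neg (by omega)] at h1
      rw [pr, if_pos e] at h0
      have ih := ih hlk.2 hl' hne' (fun w hw => h0 w (List.mem_cons_of_mem _ hw)) h1
      have hf := h0 it.2 (by simp)
      conv_rhs => rw [pr, if_pos e]
      rw [mg]
      split_ifs with h2
      · cases l with
        | nil =>
          obtain ⟨c, hc, -⟩ := hlk.1 h2
          simp at hc
        | cons d l =>
          obtain ⟨c, cs, e2, hc⟩ := head_mg hlk.2 (hne' d (by simp))
          rw [e2] at ih ⊢
          -- The item that is continued has the other owner, so the letter just before `it.2` does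
          -- not satisfy `f` and `it.2` is a block by itself.
          have hod : own (d :: l) = 1 - o := by
            rw [own, if_pos h2] at e
            omega
          rw [pr, if_pos hod] at h1
          have hd : c.head?.any f = false := by
            rw [hc]
            cases hd2 : d.2 with
            | nil => rfl
            | cons x w => simpa using h1 d.2 (by simp) x (by simp [hd2])
          rw [List.modifyHead_cons, List.flatMap_cons, blocks_append hit hf hd, List.cons_append,
            ← List.flatMap_cons, ih]
      · rw [List.flatMap_cons, blocks_of_forall hit hf, ih, List.singleton_append]
    · rw [pr, if_pos (by omega)] at h1
      rw [pr, if_neg e] at h0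
      have ih := ih hlk.2 hl' hne' h0 (fun w hw => h1 w (List.mem_cons_of_mem _ hw))
      have hf := h1 it.2 (by simp)
      conv_rhs => rw [pr, if_neg e]
      rw [mg]
      split_ifs with h2
      · cases l with
        | nil =>
          obtain ⟨c, hc, -⟩ := hlk.1 h2
          simp at hc
        | cons d l =>
          obtain ⟨c, cs, e2, hc⟩ := head_mg hlk.2 (hne' d (by simp))
          rw [e2] at ih ⊢
          rw [List.modifyHead_cons, List.flatMap_cons, blocks_append_of_not hf,
            ← List.flatMap_cons, ih]
      · rw [List.flatMap_cons, blocks_of_forall_not hf, ih, List.nil_append]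

theorem head_wordOf {l : List (ℕ × List γ)} (hne : ∀ it ∈ l, it.2 ≠ []) (hl : l ≠ [])
    {f : γ → Bool} (h0 : ∀ w ∈ pr (own l) l, ∀ e ∈ w, f e = true) :
    (wordOf l).head?.any f = true := by
  cases l with
  | nil => exact absurd rfl hl
  | cons it l =>
    rw [pr, if_pos rfl] at h0
    obtain ⟨x, w, hw⟩ := List.exists_cons_of_ne_nil (hne it (by simp))
    have := h0 it.2 (by simp) x (by simp [hw])
    simp [wordOf, hw, this]

theorem wordOf_ne_nil {l : List (ℕ × List γ)} (hne : ∀ it ∈ l, it.2 ≠ []) (hl : l ≠ []) :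
    wordOf l ≠ [] := by
  obtain ⟨it, l, rfl⟩ := List.exists_cons_of_ne_nil hl
  have := hne it (by simp)
  simp [wordOf, this]

theorem getLast_wordOf {l : List (ℕ × List γ)} (hne : ∀ it ∈ l, it.2 ≠ []) (hl : l ≠ [])
    {f : γ → Bool} (h0 : ∀ w ∈ pr (firstOwn l) l, ∀ e ∈ w, f e = true) :
    (wordOf l).getLast?.any f = true := by
  induction l with
  | nil => exact absurd rfl hl
  | cons it l ih =>
    have hne' : ∀ it ∈ l, it.2 ≠ [] := fun x hx => hne x (List.mem_cons_of_mem _ hx)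
    have e1 : wordOf (it :: l) = it.2 ++ wordOf l := by simp [wordOf]
    rw [e1]
    by_cases h : l = []
    · subst h
      rw [firstOwn, if_pos List.length_nil, pr, if_pos rfl] at h0
      have hit := hne it (by simp)
      have := h0 it.2 (by simp) (it.2.getLast hit) (List.getLast_mem hit)
      simp [wordOf, List.getLast?_eq_some_getLast hit, this]
    · have hlen : ¬ l.length = 0 := by simpa using h
      rw [firstOwn, if_neg hlen] at h0
      have h0' : ∀ w ∈ pr (firstOwn l) l, ∀ e ∈ w, f e = true := by
        rw [pr] at h0
        split_ifs at h0
        · exact fun w hw => h0 w (List.mem_cons_of_mem _ hw)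
        · exact h0
      rw [List.getLast?_append_of_ne_nil _ (wordOf_ne_nil hne' h)]
      exact ih hne' h h0'

theorem head_filter {f : γ → Bool} {v : List γ} (h : v.head?.any f = true) :
    (v.filter f).head? = v.head? := by
  cases v with
  | nil => rfl
  | cons e v =>
    have : f e = true := by simpa using h
    simp [this]

theorem getLast_filter {f : γ → Bool} {v : List γ} (h : v.getLast?.any f = true) :
    (v.filter f).getLast? = v.getLast? := by
  rw [← List.head?_reverse, ← List.filter_reverse, head_filter, List.head?_reverse]
  rwa [List.head?_reverse]

end Patterns

/-! ### Derivations -/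

/-- A letter together with the memory states before and after it. -/
structure Ltr where
  q : ℕ
  x : ℕ
  i : ℕ
  r : ℕ

/-- A program with states, operations and threads in `ℕ`, with bounds. -/
structure Sys where
  Ms : ℕ → ℕ → ℕ → Prop
  As : ℕ → ℕ → ℕ → ℕ → Prop
  pI : ℕ → ℕ
  pF : ℕ → ℕ
  qI : ℕ
  qF : ℕ
  a : ℕ
  m : ℕ
  t : ℕ
  s : ℕ
  B : ℕ
  hM : ∀ {q x r}, Ms q x r → q < m ∧ x < a ∧ r < m
  hA : ∀ {i p x p'}, As i p x p' → i < t ∧ p < B ∧ p' < B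
  hmB : m ≤ B
  hpI : ∀ i < t, pI i < B
  hpF : ∀ i < t, pF i < B
  hB : t + 2 * s + 10 ≤ B

/-- The facts that the algorithm derives: thread `i` goes from `p` to `p'` in the blocks `σ`; the
threads in `X` have runs with the blocks `σ`, which wrap if `w = 1`; there is a solution. -/
inductive Fct where
  | seg (i p p' : ℕ) (σ : List (ℕ × ℕ))
  | der (X : Finset ℕ) (w : ℕ) (σ : List (ℕ × ℕ))
  | acc

/-- A pair holds the memory states before and after a block. As the latest item comes first, `b` is
the continuation of `c`. -/
def joinPair (b c : ℕ × ℕ) : ℕ × ℕ := (c.1, b.2)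

def linkPair (b c : ℕ × ℕ) : Prop := b.1 = c.2

namespace Sys

variable (S : Sys)

/-- A set with small cuts has at most `s + 1` blocks, so two sets together contribute at most `2 * s
+ 2` items. -/
structure ValidPat (l : List (ℕ × ℕ × ℕ)) : Prop where
  length : l.length ≤ 2 * S.s + 2
  type : ∀ it ∈ l, it.1 ≤ 2
  lt : ∀ it ∈ l, it.2.1 < S.m ∧ it.2.2 < S.m

/-- The rules of the algorithm. -/
inductive Step (T : Fct → Prop) : Fct → Prop
  | letter {i p p' q r x : ℕ} : S.As i p x p' → S.Ms q x r → Step T (.seg i p p' [(q, r)])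
  | segJoin {i p p₁ p' : ℕ} {l : List (ℕ × ℕ × ℕ)} : i < S.t → p < S.B → p₁ < S.B → p' < S.B →
      S.ValidPat l → Linked linkPair l → InSequence l → T (.seg i p p₁ (pr 0 l)) →
      T (.seg i p₁ p' (pr 1 l)) → Step T (.seg i p p' (mg joinPair l))
  | leaf {i w : ℕ} {l : List (ℕ × ℕ × ℕ)} : i < S.t → w ≤ 1 → S.ValidPat l → Linked linkPair l →
      (mg joinPair l).length ≤ S.s + w → T (.seg i (S.pI i) (S.pF i) (mg joinPair l)) →
      Step T (.der {i} w (mg joinPair l))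
  | join {X Y : Finset ℕ} {w₁ w₂ w : ℕ} {l : List (ℕ × ℕ × ℕ)} : 0 < S.t → X ⊆ Finset.range S.t →
      Y ⊆ Finset.range S.t → Disjoint X Y → w₁ < S.B → w₂ < S.B → w ≤ 1 → S.ValidPat l →
      Linked linkPair l → (mg joinPair l).length ≤ S.s + w →
      (w₁ = 0 ∨ firstOwn l = 0 ∧ own l = 0 ∧ w = 1) →
      (w₂ = 0 ∨ firstOwn l = 1 ∧ own l = 1 ∧ w = 1) →
      T (.der X w₁ (pr 0 l)) → T (.der Y w₂ (pr 1 l)) → Step T (.der (X ∪ Y) w (mg joinPair l))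
  | acc {X : Finset ℕ} : 0 < S.t → S.qI < S.m → S.qF < S.m → X ⊆ Finset.range S.t →
      T (.der X 1 [(S.qI, S.qF)]) → Step T .acc

/-- The facts that can be derived with at most `r` layers of rules. -/
def Lev : ℕ → Fct → Prop
  | 0 => fun _ => False
  | r + 1 => fun f => Lev r f ∨ S.Step (Lev r) f

/-- Runs of the memory. -/
def MPath : ℕ → List Ltr → ℕ → Prop
  | q, [], r => q = r
  | q, e :: v, r => e.r = r ∧ S.Ms e.q e.x e.r ∧ MPath q v e.q

/-- Runs of thread `i`. -/
def APath (i : ℕ) : ℕ → List Ltr → ℕ → Prop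
  | p, [], p' => p = p'
  | p, e :: v, p' => ∃ p₁, S.As i p₁ e.x p' ∧ APath i p v p₁

theorem mPath_append {q r : ℕ} {w v : List Ltr} :
    S.MPath q (w ++ v) r ↔ ∃ p, S.MPath q v p ∧ S.MPath p w r := by
  induction w generalizing r with
  | nil => simp [MPath]
  | cons e w ih => simp only [List.cons_append, MPath, ih]; tauto

theorem aPath_append {i p p' : ℕ} {w v : List Ltr} :
    S.APath i p (w ++ v) p' ↔ ∃ p₁, S.APath i p v p₁ ∧ S.APath i p₁ w p' := by
  induction w generalizing p' with
  | nil => simp [APath]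
  | cons e w ih =>
    simp only [List.cons_append, APath, ih]
    constructor
    · rintro ⟨p₁, h, p₂, h', h''⟩
      exact ⟨p₂, h', p₁, h, h''⟩
    · rintro ⟨p₂, h', p₁, h, h''⟩
      exact ⟨p₁, h, p₂, h', h''⟩

/-- A nonempty word that takes the memory from one state to another. -/
def Runs (b : List Ltr) (p : ℕ × ℕ) : Prop := b ≠ [] ∧ S.MPath p.1 b p.2

/-- Membership of the thread of a letter in a set. -/
def _root_.inSet (X : Finset ℕ) (e : Ltr) : Bool := decide (e.i ∈ X)

/-- The list must not be empty: the rule for leaves concludes that thread `i` occurs in the word and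
hence is a node of its graph. -/
def SegSem (i p p' : ℕ) (σ : List (ℕ × ℕ)) : Prop :=
  ∃ ws, List.Forall₂ S.Runs ws σ ∧ ws ≠ [] ∧ (∀ w ∈ ws, ∀ e ∈ w, e.i = i) ∧
    S.APath i p ws.flatten p'

/-- The witnessing blocks are fixed, but the carving is claimed for every word `u` with these
blocks. This is possible because the cuts of subsets of `X` depend only on the blocks and on whether
`u` wraps, and it lets the rules join facts without knowledge of the surrounding word. -/
def DerSem (X : Finset ℕ) (w : ℕ) (σ : List (ℕ × ℕ)) : Prop :=
  ∃ ws, List.Forall₂ S.Runs ws σ ∧ (∀ w ∈ ws, ∀ e ∈ w, e.i ∈ X) ∧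
    (∀ i ∈ X, S.APath i (S.pI i) (ws.flatten.filter (·.i == i)) (S.pF i)) ∧
    ∀ u, blocks (inSet X) u = ws → (w = 1 → wraps (inSet X) u = 1) →
      (grph Ltr.i u).Carve S.s X

/-- `v` is a solution. -/
def Solution (v : List Ltr) : Prop :=
  v ≠ [] ∧ S.MPath S.qI v S.qF ∧
    (∀ i ∈ (grph Ltr.i v).V, S.APath i (S.pI i) (v.filter (·.i == i)) (S.pF i)) ∧
    (grph Ltr.i v).Carve S.s (grph Ltr.i v).V

/-- Facts are within the bounds. -/
def Valid : Fct → Prop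
  | .seg i p p' σ => i < S.t ∧ p < S.B ∧ p' < S.B ∧ ∀ b ∈ σ, b.1 < S.m ∧ b.2 < S.m
  | .der X w σ => X ⊆ Finset.range S.t ∧ w < S.B ∧ ∀ b ∈ σ, b.1 < S.m ∧ b.2 < S.m
  | .acc => True

def Sem : Fct → Prop
  | .seg i p p' σ => S.SegSem i p p' σ
  | .der X w σ => S.DerSem X w σ
  | .acc => ∃ v, S.Solution v

/-! ### Soundness of the rules -/

variable {S}

/-- The second claim carries the induction: the latest merged block ends in the state in which the
latest item ends, so that a linked item continues a run of the memory. -/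
theorem forall₂_mg {l' : List (ℕ × List Ltr)} {l : List (ℕ × ℕ × ℕ)}
    (h : List.Forall₂ (fun a b => a.1 = b.1 ∧ S.Runs a.2 b.2) l' l) (hl : Linked linkPair l) :
    List.Forall₂ S.Runs (mg (· ++ ·) l') (mg joinPair l) ∧
      ∀ it ∈ l.head?, ∃ c ∈ (mg joinPair l).head?, c.2 = it.2.2 := by
  induction h with
  | nil => exact ⟨.nil, by simp⟩
  | @cons a b l' l h ht ih =>
    obtain ⟨ih1, ih2⟩ := ih hl.2
    rw [mg, mg, h.1]
    split_ifs with h2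
    · obtain ⟨c, hc, hcl⟩ := hl.1 h2
      obtain ⟨d, hd, e⟩ := ih2 c hc
      cases hm : mg joinPair l with
      | nil => simp [hm] at hd
      | cons d' ds =>
        rw [hm] at ih1 hd
        obtain rfl : d' = d := by simpa using hd
        obtain ⟨w, ws, hw, hws, e'⟩ := List.forall₂_cons_right_iff.1 ih1
        rw [e']
        refine ⟨.cons ⟨by simp [hw.1], ?_⟩ hws, by simp [joinPair]⟩
        rw [mPath_append]
        refine ⟨b.2.1, ?_, h.2.2⟩
        have : b.2.1 = d'.2 := hcl.trans e.symm
        rw [this]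
        exact hw.2
    · exact ⟨.cons h.2 ih1, by simp⟩

/-- As `u` begins and ends in `Z`, its outermost letters are those of the pattern, and these belong
to the owner `o`. -/
theorem wraps_of_pattern {u : List Ltr} {Z X : Finset ℕ} {l : List (ℕ × List Ltr)}
    (hu : u.filter (inSet Z) = wordOf l) (hw : wraps (inSet Z) u = 1) (hne : ∀ it ∈ l, it.2 ≠ [])
    {o : ℕ} (ho : own l = o) (hf : firstOwn l = o) (h0 : ∀ w ∈ pr o l, ∀ e ∈ w, e.i ∈ X) :
    wraps (inSet X) u = 1 := by
  have h0' : ∀ w ∈ pr o l, ∀ e ∈ w, inSet X e = true := by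
    intro w hw e he
    simpa [inSet] using h0 w hw e he
  unfold wraps at hw
  split_ifs at hw with h
  rw [Bool.and_eq_true] at h
  have hl : l ≠ [] := by
    rintro rfl
    have := head_filter h.1
    rw [hu] at this
    rw [← this] at h
    simp [wordOf] at h
  have h1 := head_wordOf hne hl (ho.symm ▸ h0')
  have h2 := getLast_wordOf hne hl (hf.symm ▸ h0')
  rw [← hu, head_filter h.1] at h1
  rw [← hu, getLast_filter h.2] at h2
  simp [wraps, h1, h2]

theorem mem_mg_lt {m : ℕ} {l : List (ℕ × ℕ × ℕ)} (h : ∀ it ∈ l, it.2.1 < m ∧ it.2.2 < m) :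
    ∀ b ∈ mg joinPair l, b.1 < m ∧ b.2 < m := by
  induction l with
  | nil => simp [mg]
  | cons it l ih =>
    have ih := ih fun x hx => h x (List.mem_cons_of_mem _ hx)
    have h1 := h it (by simp)
    rw [mg]
    split_ifs
    · cases hm : mg joinPair l with
      | nil => simp
      | cons c cs =>
        rw [hm] at ih
        intro b hb
        rcases List.mem_cons.1 hb with rfl | hb
        · exact ⟨(ih c (by simp)).1, h1.2⟩
        · exact ih b (List.mem_cons_of_mem _ hb)
    · intro b hb
      rcases List.mem_cons.1 hb with rfl | hb
      · exact h1
      · exact ih b hb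

theorem Step.valid {T : Fct → Prop} {f : Fct} (h : S.Step T f) : S.Valid f := by
  cases h with
  | letter h1 h2 =>
    have := S.hA h1
    have := S.hM h2
    simp only [Valid, List.mem_singleton, forall_eq]
    tauto
  | segJoin hi hp h1 hp' hv => exact ⟨hi, hp, hp', mem_mg_lt hv.lt⟩
  | leaf hi hw hv =>
    have := S.hB
    exact ⟨by simpa using hi, by omega, mem_mg_lt hv.lt⟩
  | join _ hX hY _ _ _ hw hv =>
    have := S.hB
    exact ⟨Finset.union_subset hX hY, by omega, mem_mg_lt hv.lt⟩
  | acc => trivial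

/-- The rules are sound. -/
theorem Step.sem {T : Fct → Prop} (hT : ∀ f, T f → S.Sem f) {f : Fct} (h : S.Step T f) :
    S.Sem f := by
  cases h with
  | @letter i p p' q r x h1 h2 =>
    exact ⟨[[⟨q, x, i, r⟩]], .cons ⟨by simp, rfl, h2, rfl⟩ .nil, by simp, by simp, p, h1, rfl⟩
  | @segJoin i p p₁ p' l hi _ _ _ hv hl hs h0 h1 =>
    obtain ⟨ws₀, a0, b0, c0, d0⟩ := hT _ h0
    obtain ⟨ws₁, a1, b1, c1, d1⟩ := hT _ h1
    obtain ⟨l', hf, e0, e1⟩ := exists_pattern l hv.type a0 a1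
    have hlk := linked_of_forall₂ hf hl
    have hty : ∀ it ∈ l', it.1 ≤ 2 := by
      intro it hit
      obtain ⟨b, hb, h, -⟩ := exists_of_mem_forall₂ hf hit
      exact h ▸ hv.type b hb
    have hfl : (mg (· ++ ·) l').flatten = ws₁.flatten ++ ws₀.flatten := by
      rw [flatten_mg hlk, wordOf_of_inSequence ((inSequence_congr hf).2 hs) hty, e0, e1]
    refine ⟨mg (· ++ ·) l', (forall₂_mg hf hl).1, ?_, ?_, ?_⟩
    · cases l' with
      | nil => exact absurd e0.symm b0
      | cons it l' =>
        obtain ⟨c, cs, h⟩ := mg_eq_cons (f := (· ++ ·)) hlk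
        simp [h]
    · intro w hw e he
      have : e ∈ (mg (· ++ ·) l').flatten := List.mem_flatten.2 ⟨w, hw, he⟩
      rw [hfl, List.mem_append, List.mem_flatten, List.mem_flatten] at this
      rcases this with ⟨w, hw, he⟩ | ⟨w, hw, he⟩
      exacts [c1 w hw e he, c0 w hw e he]
    · rw [hfl, aPath_append]
      exact ⟨p₁, d0, d1⟩
  | @leaf i w l hi hw hv hl hlen h =>
    obtain ⟨ws, a, b, c, d⟩ := hT _ h
    have hall : ∀ e ∈ ws.flatten, e.i = i := by
      intro e he
      obtain ⟨w, hw, he⟩ := List.mem_flatten.1 he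
      exact c w hw e he
    refine ⟨ws, a, by simpa using c, ?_, fun u hu hwu => ?_⟩
    · intro j hj
      obtain rfl := Finset.mem_singleton.1 hj
      rwa [List.filter_eq_self.2 fun e he => by simp [hall e he]]
    · refine .leaf ?_ ?_
      -- A leaf has to be a node of the graph: there is a block, and blocks are nonempty, so thread
      -- `i` occurs in `u`.
      · obtain ⟨w, ws', rfl⟩ := List.exists_cons_of_ne_nil b
        obtain ⟨e, w', rfl⟩ := List.exists_cons_of_ne_nil
          (ne_nil_of_mem_blocks (inSet {i}) u w (by simp [hu]))
        have : e ∈ u.filter (inSet {i}) := by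
          rw [← flatten_blocks, hu]
          simp
        simp only [grph, List.mem_toFinset, List.mem_map]
        exact ⟨e, (List.mem_filter.1 this).1, hall e (by simp)⟩
      · rw [cutLe_grph_iff]
        change (blocks (inSet {i}) u).length ≤ S.s + wraps (inSet {i}) u
        rw [hu, a.length_eq]
        by_cases h1 : w = 1
        · rw [hwu h1]; omega
        · omega
  | @join X Y w₁ w₂ w l _ hX hY hd hw₁ hw₂ hw hv hl hlen c₁ c₂ h0 h1 =>
    obtain ⟨ws₀, a0, b0, d0, k0⟩ := hT _ h0
    obtain ⟨ws₁, a1, b1, d1, k1⟩ := hT _ h1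
    obtain ⟨l', hf, e0, e1⟩ := exists_pattern l hv.type a0 a1
    have hlk := linked_of_forall₂ hf hl
    have hty : ∀ it ∈ l', it.1 ≤ 2 := by
      intro it hit
      obtain ⟨b, hb, h, -⟩ := exists_of_mem_forall₂ hf hit
      exact h ▸ hv.type b hb
    have hne : ∀ it ∈ l', it.2 ≠ [] := by
      intro it hit
      obtain ⟨b, -, -, h⟩ := exists_of_mem_forall₂ hf hit
      exact h.1
    have hdis := Finset.disjoint_left.1 hd
    have hdis' := Finset.disjoint_right.1 hd
    rw [← e0] at b0
    rw [← e1] at b1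
    refine ⟨mg (· ++ ·) l', (forall₂_mg hf hl).1, ?_, ?_, ?_⟩
    · intro w hw e he
      have : e ∈ wordOf l' := by
        rw [← flatten_mg hlk]
        exact List.mem_flatten.2 ⟨w, hw, he⟩
      have h3 : e ∈ (wordOf l').filter (fun _ => true) := by simpa using this
      by_cases heX : e.i ∈ X
      · exact Finset.mem_union_left _ heX
      · have : e ∈ (wordOf l').filter (fun e => !inSet X e) :=
          List.mem_filter.2 ⟨this, by simp [inSet, heX]⟩
        rw [filter_wordOf (o := 1) le_rfl hty fun w hw e he => by simp [inSet, b0 w hw e he]] at this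
        obtain ⟨w, hw, he⟩ := List.mem_flatten.1 (List.mem_filter.1 this).1
        exact Finset.mem_union_right _ (b1 w hw e he)
    · intro i hi
      rw [flatten_mg hlk]
      rcases Finset.mem_union.1 hi with hi | hi
      · rw [filter_wordOf (o := 0) zero_le_one hty, e0]
        · exact d0 i hi
        · intro w hw e he
          have := b1 w hw e he
          simp only [beq_eq_false_iff_ne, ne_eq]
          rintro rfl
          exact hdis hi this
      · rw [filter_wordOf (o := 1) le_rfl hty, e1]
        · exact d1 i hi
        · intro w hw e he
          have := b0 w hw e he
          simp only [beq_eq_false_iff_ne, ne_eq]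
          rintro rfl
          exact hdis this hi
    · intro u hu hwu
      have hfil : u.filter (inSet (X ∪ Y)) = wordOf l' := by
        rw [← flatten_blocks, hu, flatten_mg hlk]
      refine .join (k0 u ?_ fun h => ?_) (k1 u ?_ fun h => ?_) hd ?_
      -- The blocks of `X` lie inside those of `X ∪ Y`, which are the merged items, and are
      -- therefore the items of owner `0`.
      · rw [blocks_eq_flatMap (g := inSet (X ∪ Y)), hu,
          flatMap_blocks_mg hlk hty hne (o := 0) zero_le_one, e0]
        · intro w hw e he
          simp [inSet, b0 w hw e he]
        · intro w hw e he
          simp [inSet, hdis' (b1 w hw e he)]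
        · intro e he
          simp only [inSet, decide_eq_true_eq, Finset.mem_union] at he ⊢
          exact .inl he
      · rcases c₁ with c | ⟨c1, c2, c3⟩
        · omega
        · exact wraps_of_pattern hfil (hwu c3) hne ((own_congr hf).trans c2)
            ((firstOwn_congr hf).trans c1) b0
      · rw [blocks_eq_flatMap (g := inSet (X ∪ Y)), hu,
          flatMap_blocks_mg hlk hty hne (o := 1) le_rfl, e1]
        · intro w hw e he
          simp [inSet, b1 w hw e he]
        · intro w hw e he
          simp [inSet, hdis (b0 w hw e he)]
        · intro e he
          simp only [inSet, decide_eq_true_eq, Finset.mem_union] at he ⊢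
          exact .inr he
      · rcases c₂ with c | ⟨c1, c2, c3⟩
        · omega
        · exact wraps_of_pattern hfil (hwu c3) hne ((own_congr hf).trans c2)
            ((firstOwn_congr hf).trans c1) b1
      · rw [cutLe_grph_iff]
        change (blocks (inSet (X ∪ Y)) u).length ≤ S.s + wraps (inSet (X ∪ Y)) u
        rw [hu, (forall₂_mg hf hl).1.length_eq]
        by_cases h1 : w = 1
        · rw [hwu h1]; omega
        · omega
  | @acc X _ _ _ hX h =>
    obtain ⟨ws, a, b, d, k⟩ := hT _ h
    obtain ⟨v, ws, hv, hws, rfl⟩ := List.forall₂_cons_right_iff.1 a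
    rw [List.forall₂_nil_right_iff] at hws
    subst hws
    have hall : ∀ e ∈ v, inSet X e = true := fun e he => by simpa [inSet] using b v (by simp) e he
    -- The word is a single block of `X`, and as such it begins and ends in `X`, so the premise may
    -- be used with `u = v`.
    have hC := k v (blocks_of_forall hv.1 hall) fun _ => by
      obtain ⟨e, v', rfl⟩ := List.exists_cons_of_ne_nil hv.1
      have h1 := hall e (by simp)
      have h2 := hall _ (List.getLast_mem hv.1)
      rw [wraps, List.getLast?_eq_some_getLast hv.1]
      simp only [List.head?_cons, Option.any_some, h1, h2]
      rfl
    have hVX : (grph Ltr.i v).V = X := by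
      refine subset_antisymm (fun i hi => ?_) hC.subset
      simp only [grph, List.mem_toFinset, List.mem_map] at hi
      obtain ⟨e, he, rfl⟩ := hi
      exact b v (by simp) e he
    refine ⟨v, hv.1, hv.2, ?_, hVX.symm ▸ hC⟩
    rw [hVX]
    simpa using d

end Sys

/-! ### Completeness of the rules -/

section Canonical

variable {γ : Type*}

/-- The pattern of a word whose letters have owner `0`, owner `1`, or no owner. -/
def patternOf (c : γ → ℕ) : List γ → List (ℕ × List γ)
  | [] => []
  | e :: v =>
    if c e ≤ 1 then
      if v.head?.any (fun d => c d == c e) then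
        (patternOf c v).modifyHead fun it => (it.1, e :: it.2)
      else if v.head?.any (fun d => decide (c d ≤ 1)) then (2, [e]) :: patternOf c v
      else (c e, [e]) :: patternOf c v
    else patternOf c v

/-- The older word `c` ends where the newer word `b` begins. -/
def linkWord (R : γ → γ → Prop) (b c : List γ) : Prop := ∃ x ∈ b.getLast?, ∃ y ∈ c.head?, R x y

/-- The fields `head` and `last` speak of the outermost letters. The former carries the induction
over `v`, and both give the side conditions on wrapping in the rule `join`. -/
structure Describes (c : γ → ℕ) (R : γ → γ → Prop) (v : List γ) (l : List (ℕ × List γ)) :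
    Prop where
  type : ∀ it ∈ l, it.1 ≤ 2
  ne_nil : ∀ it ∈ l, it.2 ≠ []
  pr_eq : ∀ o ≤ 1, pr o l = blocks (fun e => c e == o) v
  mg_eq : mg (· ++ ·) l = blocks (fun e => decide (c e ≤ 1)) v
  linked : Linked (linkWord R) l
  head : ∀ d ∈ v.head?, c d ≤ 1 → own l = c d ∧ ∃ it ∈ l.head?, it.2.head? = some d
  last : ∀ d ∈ v.getLast?, c d ≤ 1 → l ≠ [] ∧ firstOwn l = c d

/-- A new letter either has no owner, or prolongs the latest item, or directly follows a letter of
the other owner (type `2`), or follows a letter without owner and opens a block. The chain condition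
supplies the link in the third case. -/
theorem describes_patternOf (c : γ → ℕ) {R : γ → γ → Prop} {v : List γ} (hv : v.IsChain R) :
    Describes c R v (patternOf c v) := by
  induction v with
  | nil => exact ⟨by simp [patternOf], by simp [patternOf], fun _ _ => rfl, rfl, trivial,
      by simp, by simp⟩
  | cons e v ih =>
    have ih := ih hv.of_cons
    by_cases he : c e ≤ 1
    swap
    · have e1 : patternOf c (e :: v) = patternOf c v := by rw [patternOf, if_neg he]
      rw [e1]
      refine ⟨ih.type, ih.ne_nil, fun o ho => ?_, ?_, ih.linked, ?_, ?_⟩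
      · rw [ih.pr_eq o ho, blocks, if_neg]
        simp only [beq_iff_eq]
        omega
      · rw [ih.mg_eq, blocks, if_neg (by simpa using he)]
      · intro d hd hcd
        obtain rfl : e = d := by simpa using hd
        exact absurd hcd he
      · intro d hd hcd
        cases v with
        | nil =>
          obtain rfl : e = d := by simpa using hd
          exact absurd hcd he
        | cons f v => exact ih.last d (by simpa using hd) hcd
    cases v with
    | nil =>
      have e1 : patternOf c [e] = [(c e, [e])] := by simp [patternOf, he]
      have h2 : c e ≠ 2 := by omega
      rw [e1]
      refine ⟨by simp; omega, by simp, fun o ho => ?_, ?_, ⟨fun h => absurd h h2, trivial⟩, ?_, ?_⟩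
      · by_cases h : c e = o <;> simp [pr, own, blocks, h2, h]
        all_goals (intro; omega)
      · simp [mg, blocks, h2, he]
      · intro d hd hcd
        obtain rfl : e = d := by simpa using hd
        simp [own, h2]
      · intro d hd hcd
        obtain rfl : e = d := by simpa using hd
        simp [firstOwn, own, h2]
    | cons d v =>
      have hR : R e d := by
        rw [List.isChain_cons_cons] at hv
        exact hv.1
      have hlast : ∀ x ∈ (e :: d :: v).getLast?, c x ≤ 1 →
          patternOf c (d :: v) ≠ [] ∧ firstOwn (patternOf c (d :: v)) = c x := by
        intro x hx
        exact ih.last x (by simpa using hx)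
      by_cases h1 : c d = c e
      · obtain ⟨ho, it, hit, hd⟩ := ih.head d rfl (h1 ▸ he)
        have e1 : patternOf c (e :: d :: v) =
            (patternOf c (d :: v)).modifyHead fun it => (it.1, e :: it.2) := by
          rw [patternOf, if_pos he, if_pos (by simp [h1])]
        obtain ⟨l, hl⟩ : ∃ l, patternOf c (d :: v) = it :: l := by
          cases hp : patternOf c (d :: v) with
          | nil => simp [hp] at hit
          | cons it' l =>
            rw [hp] at hit
            obtain rfl : it' = it := by simpa using hit
            exact ⟨l, rfl⟩
        rw [e1]
        rw [hl] at ih ho hlast ⊢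
        rw [List.modifyHead_cons]
        have hit2 : it.2 ≠ [] := ih.ne_nil it (by simp)
        have hown : own ((it.1, e :: it.2) :: l) = own (it :: l) := rfl
        refine ⟨?_, ?_, fun o hole => ?_, ?_, ⟨fun h2 => ?_, ih.linked.2⟩, ?_, ?_⟩
        · have := ih.type
          simpa using this
        · have := ih.ne_nil
          simp only [List.mem_cons, forall_eq_or_imp] at this ⊢
          exact ⟨by simp, this.2⟩
        · have hp := ih.pr_eq o hole
          rw [pr] at hp ⊢
          rw [hown]
          by_cases hoo : own (it :: l) = o
          · rw [if_pos hoo] at hp ⊢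
            have h3 : c e = o := by omega
            rw [blocks, if_pos (by simp [h3]), if_pos (by simp [h1, h3]), ← hp]
            rfl
          · rw [if_neg hoo] at hp ⊢
            have h3 : ¬ c e = o := by omega
            rw [blocks, if_neg (by simp [h3]), hp]
        · have hm := ih.mg_eq
          rw [mg] at hm ⊢
          conv_rhs => rw [blocks, if_pos (by simp [he]), if_pos (by simp [h1, he]), ← hm]
          dsimp only
          split_ifs with h2
          · cases hml : mg (· ++ ·) l with
            | nil =>
              rw [if_pos h2, hml] at hm
              obtain ⟨b, bs, hb⟩ := blocks_of_head (f := fun e => decide (c e ≤ 1)) v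
                (e := d) (by simp [h1, he])
              rw [hb] at hm
              simp at hm
            | cons b bs => simp [consHead]
          · rfl
        · obtain ⟨w, hw, x, hx, y, hy, h⟩ := ih.linked.1 h2
          refine ⟨w, hw, x, ?_, y, hy, h⟩
          obtain ⟨z, zs, hz⟩ := List.exists_cons_of_ne_nil hit2
          change x ∈ (e :: it.2).getLast?
          rw [hz] at hx ⊢
          simpa using hx
        · intro x hx _
          obtain rfl : e = x := by simpa using hx
          exact ⟨hown.trans (ho.trans h1), _, rfl, rfl⟩
        · intro x hx hcx
          exact ⟨by simp, (hlast x hx hcx).2⟩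
      · by_cases h2 : c d ≤ 1
        · obtain ⟨ho, it, hit, hd⟩ := ih.head d rfl h2
          have e1 : patternOf c (e :: d :: v) = (2, [e]) :: patternOf c (d :: v) := by
            rw [patternOf, if_pos he, if_neg (by simp [h1]), if_pos (by simp [h2])]
          rw [e1]
          have hown : own ((2, [e]) :: patternOf c (d :: v)) = c e := by
            rw [own, if_pos rfl, ho]
            omega
          refine ⟨?_, ?_, fun o hole => ?_, ?_, ⟨fun _ => ?_, ih.linked⟩, ?_, ?_⟩
          · have := ih.type
            simpa using this
          · have := ih.ne_nil
            simpa using this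
          · have hp := ih.pr_eq o hole
            rw [pr, hown, hp]
            by_cases h3 : c e = o
            · rw [if_pos h3]
              conv_rhs => rw [blocks, if_pos (by simp [h3]), if_neg (by simp; omega)]
            · rw [if_neg h3]
              conv_rhs => rw [blocks, if_neg (by simp [h3])]
          · rw [mg, if_pos rfl, ih.mg_eq]
            conv_rhs => rw [blocks, if_pos (by simp [he]), if_pos (by simp [h2])]
            obtain ⟨b, bs, hb⟩ := blocks_of_head (f := fun e => decide (c e ≤ 1)) v
                (e := d) (by simp [h2])
            rw [hb]
            rfl
          · exact ⟨it, hit, e, rfl, d, hd, hR⟩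
          · intro x hx _
            obtain rfl : e = x := by simpa using hx
            exact ⟨hown, _, rfl, rfl⟩
          · intro x hx hcx
            obtain ⟨h3, h4⟩ := hlast x hx hcx
            refine ⟨by simp, ?_⟩
            rw [firstOwn, if_neg (by simpa using h3), h4]
        · have e1 : patternOf c (e :: d :: v) = (c e, [e]) :: patternOf c (d :: v) := by
            rw [patternOf, if_pos he, if_neg (by simp [h1]), if_neg (by simp [h2])]
          rw [e1]
          have hce : c e ≠ 2 := by omega
          have hown : own ((c e, [e]) :: patternOf c (d :: v)) = c e := by
            rw [own, if_neg hce]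
          refine ⟨?_, ?_, fun o hole => ?_, ?_, ⟨fun h => absurd h hce, ih.linked⟩, ?_, ?_⟩
          · have := ih.type
            simp only [List.mem_cons, forall_eq_or_imp]
            exact ⟨by omega, this⟩
          · have := ih.ne_nil
            simpa using this
          · have hp := ih.pr_eq o hole
            rw [pr, hown, hp]
            by_cases h3 : c e = o
            · rw [if_pos h3]
              conv_rhs => rw [blocks, if_pos (by simp [h3]), if_neg (by simp; omega)]
            · rw [if_neg h3]
              conv_rhs => rw [blocks, if_neg (by simp [h3])]
          · rw [mg, if_neg hce, ih.mg_eq]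
            conv_rhs => rw [blocks, if_pos (by simp [he]), if_neg (by simpa using h2)]
          · intro x hx _
            obtain rfl : e = x := by simpa using hx
            exact ⟨hown, _, rfl, rfl⟩
          · intro x hx hcx
            obtain ⟨h3, h4⟩ := hlast x hx hcx
            refine ⟨by simp, ?_⟩
            rw [firstOwn, if_neg (by simpa using h3), h4]

variable {δ : Type*}

theorem forall₂_map (k : γ → δ) (l : List (ℕ × γ)) :
    List.Forall₂ (fun a b => a.1 = b.1 ∧ b.2 = k a.2) l (l.map fun it => (it.1, k it.2)) := by
  induction l with
  | nil => exact .nil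
  | cons it l ih => exact .cons ⟨rfl, rfl⟩ ih

theorem pr_map (k : γ → δ) (o : ℕ) (l : List (ℕ × γ)) :
    pr o (l.map fun it => (it.1, k it.2)) = (pr o l).map k := by
  induction l with
  | nil => rfl
  | cons it l ih =>
    have := own_congr (R := fun a b => b = k a) (forall₂_map k (it :: l))
    rw [pr, this, List.map_cons, pr, ← List.map_cons (f := fun it : ℕ × γ => (it.1, k it.2)), ← this]
    split_ifs <;> simp [ih]

end Canonical

/-- The memory states before and after a nonempty word. -/
def ends (b : List Ltr) : ℕ × ℕ := ((b.getLast?.map Ltr.q).getD 0, (b.head?.map Ltr.r).getD 0)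

theorem ends_append {w c : List Ltr} (hw : w ≠ []) (hc : c ≠ []) :
    ends (w ++ c) = joinPair (ends w) (ends c) := by
  obtain ⟨x, w, rfl⟩ := List.exists_cons_of_ne_nil hw
  unfold ends joinPair
  rw [List.getLast?_append_of_ne_nil _ hc]
  simp

/-- The letter `y` ends in the state in which `x` begins. -/
def Chained (x y : Ltr) : Prop := x.q = y.r

theorem linkPair_of_linkWord {b c : List Ltr} (h : linkWord Chained b c) :
    linkPair (ends b) (ends c) := by
  obtain ⟨x, hx, y, hy, h⟩ := h
  rw [Option.mem_def] at hx hy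
  simp [linkPair, ends, hx, hy, h.symm]

theorem linked_map {l : List (ℕ × List Ltr)} (h : Linked (linkWord Chained) l) :
    Linked linkPair (l.map fun it => (it.1, ends it.2)) := by
  induction l with
  | nil => trivial
  | cons it l ih =>
    refine ⟨fun h2 => ?_, ih h.2⟩
    obtain ⟨c, hc, hl⟩ := h.1 h2
    cases l with
    | nil => simp at hc
    | cons d l =>
      obtain rfl : d = c := by simpa using hc
      exact ⟨_, rfl, linkPair_of_linkWord hl⟩

theorem mg_map {l : List (ℕ × List Ltr)} (hne : ∀ it ∈ l, it.2 ≠ []) :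
    (mg joinPair (l.map fun it => (it.1, ends it.2)) = (mg (· ++ ·) l).map ends) ∧
      ∀ b ∈ mg (· ++ ·) l, b ≠ [] := by
  induction l with
  | nil => exact ⟨rfl, by simp [mg]⟩
  | cons it l ih =>
    obtain ⟨ih1, ih2⟩ := ih fun x hx => hne x (List.mem_cons_of_mem _ hx)
    have hit := hne it (by simp)
    rw [List.map_cons, mg, mg]
    dsimp only
    split_ifs
    · rw [ih1]
      cases hm : mg (· ++ ·) l with
      | nil => simp
      | cons b bs =>
        rw [hm] at ih2
        have hb := ih2 b (by simp)
        simp only [List.map_cons, List.modifyHead_cons, ends_append hit hb, true_and]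
        intro x hx
        rcases List.mem_cons.1 hx with rfl | hx
        · simp [hit]
        · exact ih2 x (List.mem_cons_of_mem _ hx)
    · rw [ih1]
      refine ⟨rfl, fun x hx => ?_⟩
      rcases List.mem_cons.1 hx with rfl | hx
      · exact hit
      · exact ih2 x hx

/-- An increasing iteration within a finite set stops after as many steps as the set has elements. -/
theorem iterate_card_fixed {α : Type*} {F : Finset α → Finset α} {U : Finset α}
    (h1 : ∀ s, s ⊆ U → s ⊆ F s) (h2 : ∀ s, F s ⊆ U) :
    F (F^[U.card] ∅) = F^[U.card] ∅ := by
  have hU : ∀ n, F^[n] ∅ ⊆ U := by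
    intro n
    cases n with
    | zero => simp
    | succ n => rw [Function.iterate_succ_apply']; exact h2 _
  by_contra hne
  have key : ∀ n ≤ U.card + 1, n ≤ (F^[n] ∅).card := by
    intro n hn
    induction n with
    | zero => simp
    | succ n ih =>
      have ih := ih (by omega)
      rw [Function.iterate_succ_apply']
      have hss : F^[n] ∅ ⊆ F (F^[n] ∅) := h1 _ (hU n)
      have : F^[n] ∅ ≠ F (F^[n] ∅) := by
        intro e
        apply hne
        have hc : ∀ k, F^[n + k] ∅ = F^[n] ∅ := by
          intro k
          induction k with
          | zero => rfl
          | succ k ihk => rw [← add_assoc, Function.iterate_succ_apply', ihk, ← e]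
        have := hc (U.card - n)
        rw [show n + (U.card - n) = U.card by omega] at this
        rw [this, ← e]
      exact ih.trans_lt (Finset.card_lt_card (hss.ssubset_of_ne this))
  have h3 := key _ le_rfl
  have h4 := Finset.card_le_card (hU (U.card + 1))
  omega

/-! ### The depth of derivations -/

namespace Sys

variable {S : Sys}

theorem Lev.mono {r r' : ℕ} (h : r ≤ r') {f : Fct} (hf : S.Lev r f) : S.Lev r' f := by
  induction h with
  | refl => exact hf
  | step _ ih => exact .inl ih

theorem lev_succ {r : ℕ} {f : Fct} (h : S.Step (S.Lev r) f) : S.Lev (r + 1) f := .inr h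

theorem chained_of_mPath {q r : ℕ} {v : List Ltr} (h : S.MPath q v r) : v.IsChain Chained := by
  induction v generalizing r with
  | nil => simp
  | cons e v ih =>
    obtain ⟨h1, h2, h3⟩ := h
    cases v with
    | nil => simp
    | cons d v =>
      rw [List.isChain_cons_cons]
      exact ⟨h3.1.symm, ih h3⟩

/-- The second claim is needed for the induction: a letter that is added to the latest block must
begin in the state in which that block ends. -/
theorem runs_of_mem_blocks (f : Ltr → Bool) {q r : ℕ} {v : List Ltr} (h : S.MPath q v r) :
    (∀ b ∈ blocks f v, S.Runs b (ends b)) ∧ ∀ d ∈ v.head?, f d = true →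
      ∃ b ∈ (blocks f v).head?, b.head? = some d := by
  induction v generalizing r with
  | nil => simp [blocks]
  | cons e v ih =>
    obtain ⟨h1, h2, h3⟩ := h
    obtain ⟨ih1, ih2⟩ := ih h3
    have single : S.Runs [e] (ends [e]) := ⟨by simp, by simp [ends, MPath, h2]⟩
    rw [blocks]
    by_cases hf : f e = true
    · rw [if_pos hf]
      by_cases hh : v.head?.any f = true
      · rw [if_pos hh]
        obtain ⟨d, hd, hfd⟩ : ∃ d ∈ v.head?, f d = true := by
          cases v with
          | nil => simp at hh
          | cons d v => exact ⟨d, rfl, by simpa using hh⟩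
        obtain ⟨b, hb, hbd⟩ := ih2 d hd hfd
        cases hbs : blocks f v with
        | nil => simp [hbs] at hb
        | cons b' bs =>
          rw [hbs] at ih1 hb
          obtain rfl : b' = b := by simpa using hb
          refine ⟨fun c hc => ?_, fun x hx _ => ?_⟩
          · rcases List.mem_cons.1 hc with rfl | hc
            · refine ⟨by simp, ?_⟩
              have hrun := ih1 b' (by simp)
              have e1 : ends (e :: b') = joinPair (ends [e]) (ends b') :=
                ends_append (w := [e]) (by simp) hrun.1
              have e2 : (ends b').2 = e.q := by
                cases v with
                | nil => simp at hd
                | cons d' v =>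
                  obtain rfl : d' = d := by simpa using hd
                  simp [ends, hbd, h3.1]
              rw [e1]
              refine ⟨by simp [joinPair, ends], h2, ?_⟩
              have := hrun.2
              rw [e2] at this
              exact this
            · exact ih1 c (List.mem_cons_of_mem _ hc)
          · obtain rfl : e = x := by simpa using hx
            exact ⟨e :: b', rfl, rfl⟩
      · rw [if_neg hh]
        refine ⟨fun c hc => ?_, fun x hx _ => ?_⟩
        · rcases List.mem_cons.1 hc with rfl | hc
          exacts [single, ih1 c hc]
        · obtain rfl : e = x := by simpa using hx
          exact ⟨[e], rfl, rfl⟩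
    · rw [if_neg hf]
      refine ⟨ih1, fun x hx hfx => ?_⟩
      obtain rfl : e = x := by simpa using hx
      exact absurd hfx hf

theorem MPath.ends_eq {q r : ℕ} {v : List Ltr} (h : S.MPath q v r) (hv : v ≠ []) :
    ends v = (q, r) := by
  induction v generalizing r with
  | nil => exact absurd rfl hv
  | cons e v ih =>
    obtain ⟨h1, h2, h3⟩ := h
    by_cases hv' : v = []
    · subst hv'
      simp [ends, h1, MPath] at h3 ⊢
      exact h3.symm
    · have := ends_append (w := [e]) (by simp) hv'
      rw [List.singleton_append] at this
      rw [this, ih h3 hv']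
      simp [joinPair, ends, h1]

open Classical in
/-- One round of derivations of thread runs within a single block. -/
noncomputable def quadStep (S : Sys) (i : ℕ) (s : Finset (ℕ × ℕ × ℕ × ℕ)) :
    Finset (ℕ × ℕ × ℕ × ℕ) :=
  (Finset.range S.B ×ˢ Finset.range S.B ×ˢ Finset.range S.B ×ˢ Finset.range S.B).filter fun y =>
    y ∈ s ∨ (∃ x, S.As i y.1 x y.2.2.1 ∧ S.Ms y.2.1 x y.2.2.2) ∨
      ∃ p q, (y.1, y.2.1, p, q) ∈ s ∧ (p, q, y.2.2.1, y.2.2.2) ∈ s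

theorem lev_of_mem_quadStep {i n : ℕ} (hi : i < S.t) {p q p' r : ℕ}
    (h : (p, q, p', r) ∈ (quadStep S i)^[n] ∅) :
    S.Lev n (.seg i p p' [(q, r)]) ∧ p < S.B ∧ p' < S.B ∧ q < S.m ∧ r < S.m := by
  induction n generalizing p q p' r with
  | zero => simp at h
  | succ n ih =>
    rw [Function.iterate_succ_apply'] at h
    simp only [quadStep, Finset.mem_filter] at h
    obtain ⟨-, h | ⟨x, hA, hM⟩ | ⟨p₁, q₁, h1, h2⟩⟩ := h
    · exact ⟨.inl (ih h).1, (ih h).2⟩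
    · have := S.hA hA
      have := S.hM hM
      exact ⟨lev_succ (.letter hA hM), by tauto⟩
    · obtain ⟨l1, a1, b1, c1, d1⟩ := ih h1
      obtain ⟨l2, a2, b2, c2, d2⟩ := ih h2
      refine ⟨lev_succ ?_, a1, b2, c1, d2⟩
      -- The pattern has two items, and the later one continues the earlier: together they form the
      -- single block `(q, r)`.
      have := Step.segJoin (S := S) (T := S.Lev n) (p := p) (p₁ := p₁) (p' := p')
        (l := [(2, q₁, r), (0, q, q₁)]) hi a1 b1 b2
        ⟨by simp, by simp, by simp; tauto⟩
        ⟨fun _ => ⟨_, rfl, rfl⟩, fun h => absurd h (by simp), trivial⟩ (by simp [InSequence, own])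
        (by simpa [pr, own] using l1) (by simpa [pr, own] using l2)
      simpa [mg, joinPair] using this

/-- The word may be arbitrarily long, but only `B ^ 4` quadruples of states exist. The increasing
iteration `quadStep` is stationary after that many rounds, so its result is closed under adding a
letter and the depth does not depend on the length. -/
theorem lev_single {i : ℕ} (hi : i < S.t) {b : List Ltr} (hb : b ≠ []) {p q p' r : ℕ}
    (hM : S.MPath q b r) (hA : S.APath i p b p') :
    S.Lev (S.B ^ 4) (.seg i p p' [(q, r)]) := by
  set U := Finset.range S.B ×ˢ Finset.range S.B ×ˢ Finset.range S.B ×ˢ Finset.range S.B with hU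
  have hcard : U.card = S.B ^ 4 := by
    simp only [hU, Finset.card_product, Finset.card_range]
    ring
  have hfix := iterate_card_fixed (F := quadStep S i) (U := U)
    (fun s hs y hy => by
      simp only [quadStep, Finset.mem_filter]
      exact ⟨hs hy, .inl hy⟩)
    (fun s y hy => by
      simp only [quadStep, Finset.mem_filter] at hy
      exact hy.1)
  rw [hcard] at hfix
  suffices h : (p, q, p', r) ∈ (quadStep S i)^[S.B ^ 4] ∅ from (lev_of_mem_quadStep hi h).1
  induction b generalizing p' r with
  | nil => exact absurd rfl hb
  | cons e b ih =>
    obtain ⟨rfl, hM1, hM2⟩ := hM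
    obtain ⟨p₁, hA1, hA2⟩ := hA
    have h1 := S.hA hA1
    have h2 := S.hM hM1
    have h3 := S.hmB
    have hlet : (p₁, e.q, p', e.r) ∈ (quadStep S i)^[S.B ^ 4] ∅ := by
      rw [← hfix]
      simp only [quadStep, Finset.mem_filter, Finset.mem_product, Finset.mem_range]
      exact ⟨by omega, .inr (.inl ⟨_, hA1, hM1⟩)⟩
    by_cases hb' : b = []
    · subst hb'
      rw [show q = e.q from hM2, show p = p₁ from hA2]
      exact hlet
    · have := ih hb' hM2 hA2
      rw [← hfix]
      simp only [quadStep, Finset.mem_filter, Finset.mem_product, Finset.mem_range]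
      have hlt := lev_of_mem_quadStep hi this
      refine ⟨by omega, .inr (.inr ⟨_, _, this, hlet⟩)⟩

theorem own_map_zero {β : Type*} (k : β → β) (l : List β) :
    own (l.map fun w => (0, k w)) = 0 ∧ pr 0 (l.map fun w => (0, k w)) = l.map k ∧
    pr 1 (l.map fun w => (0, k w)) = [] := by
  induction l with
  | nil => exact ⟨rfl, rfl, rfl⟩
  | cons w l ih =>
    have h : own (((0 : ℕ), k w) :: l.map fun w => (0, k w)) = 0 := by simp [own]
    refine ⟨h, ?_, ?_⟩
    · rw [List.map_cons, pr, if_pos h, ih.2.1, List.map_cons]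
    · rw [List.map_cons, pr, if_neg (by omega), ih.2.2]

theorem APath.lt {i p p' : ℕ} {v : List Ltr} (h : S.APath i p v p') (hv : v ≠ []) :
    p < S.B ∧ p' < S.B := by
  induction v generalizing p' with
  | nil => exact absurd rfl hv
  | cons e v ih =>
    obtain ⟨p₁, h1, h2⟩ := h
    have := S.hA h1
    by_cases hv' : v = []
    · subst hv'
      rw [show p = p₁ from h2]
      exact ⟨this.2.1, this.2.2⟩
    · exact ⟨(ih h2 hv').1, this.2.2⟩

theorem MPath.lt {q r : ℕ} {v : List Ltr} (h : S.MPath q v r) (hv : v ≠ []) :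
    q < S.m ∧ r < S.m := by
  induction v generalizing r with
  | nil => exact absurd rfl hv
  | cons e v ih =>
    obtain ⟨h1, h2, h3⟩ := h
    have := S.hM h2
    by_cases hv' : v = []
    · subst hv'
      rw [show q = e.q from h3, ← h1]
      exact ⟨this.1, this.2.2⟩
    · exact ⟨(ih h3 hv').1, h1 ▸ this.2.2⟩

/-- Blocks are added one at a time, and each costs one level: the old blocks are items of type `0`,
the new one is an item of type `1`, and nothing is merged. -/
theorem lev_seg {i : ℕ} (hi : i < S.t) {ws : List (List Ltr)} (hws : ws ≠ [])
    (hr : ∀ b ∈ ws, S.Runs b (ends b)) {p p' : ℕ} (hA : S.APath i p ws.flatten p')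
    (hlen : ws.length ≤ 2 * S.s + 2) :
    S.Lev (S.B ^ 4 + ws.length) (.seg i p p' (ws.map ends)) := by
  induction ws generalizing p' with
  | nil => exact absurd rfl hws
  | cons b ws ih =>
    have hb := hr b (by simp)
    by_cases hws' : ws = []
    · subst hws'
      rw [List.flatten_cons, List.flatten_nil, List.append_nil] at hA
      exact (lev_single hi hb.1 hb.2 hA).mono (by omega)
    · rw [List.flatten_cons, aPath_append] at hA
      obtain ⟨p₁, hA1, hA2⟩ := hA
      rw [List.length_cons] at hlen
      have hne : ws.flatten ≠ [] := by
        obtain ⟨c, cs, rfl⟩ := List.exists_cons_of_ne_nil hws'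
        simp [(hr c (by simp)).1]
      have h1 := ih hws' (fun c hc => hr c (List.mem_cons_of_mem _ hc)) hA1 (by omega)
      have h2 := (lev_single hi hb.1 hb.2 hA2).mono (r' := S.B ^ 4 + ws.length) (by omega)
      obtain ⟨k1, k2, k3⟩ := own_map_zero id (ws.map ends)
      simp only [id_eq, List.map_id] at k1 k2 k3
      set l0 : List (ℕ × ℕ × ℕ) := (ws.map ends).map fun w => (0, w) with hl0
      have hl : ∀ it ∈ l0, it.1 = 0 ∧ it.2.1 < S.m ∧ it.2.2 < S.m := by
        intro it hit
        simp only [hl0, List.map_map, List.mem_map] at hit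
        obtain ⟨c, hc, rfl⟩ := hit
        have hc := hr c (List.mem_cons_of_mem _ hc)
        exact ⟨rfl, MPath.lt hc.2 hc.1⟩
      have hlk : ∀ l : List (ℕ × ℕ × ℕ), (∀ it ∈ l, it.1 = 0) →
          Linked linkPair l ∧ InSequence l ∧ mg joinPair l = l.map Prod.snd ∧ own l = 0 := by
        intro l hl
        induction l with
        | nil => exact ⟨trivial, trivial, rfl, rfl⟩
        | cons it l ih =>
          obtain ⟨i1, i2, i3, i4⟩ := ih fun x hx => hl x (List.mem_cons_of_mem _ hx)
          have h0 := hl it (by simp)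
          refine ⟨⟨fun h => by omega, i1⟩, ⟨fun h => by omega, i2⟩, ?_, ?_⟩
          · rw [mg, if_neg (by omega), i3, List.map_cons]
          · rw [own, if_neg (by omega), h0]
      obtain ⟨g1, g2, g3, g4⟩ := hlk l0 fun it hit => (hl it hit).1
      have hown : own (((1 : ℕ), ends b) :: l0) = 1 := by simp [own]
      have := Step.segJoin (S := S) (T := S.Lev (S.B ^ 4 + ws.length)) (p := p) (p₁ := p₁)
        (p' := p') (l := (1, ends b) :: l0) hi (APath.lt hA1 hne).1 (APath.lt hA1 hne).2
        (APath.lt hA2 hb.1).2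
        ⟨by simp [hl0, hlen], ?_, ?_⟩ ⟨fun h => absurd h (by simp), g1⟩ ⟨fun _ => hown, g2⟩
        (by rw [pr, if_neg (by omega), k2]; exact h1)
        (by rw [pr, if_pos hown, k3]; exact h2)
      · have e : mg joinPair (((1 : ℕ), ends b) :: l0) = (b :: ws).map ends := by
          rw [mg, if_neg (by simp), g3, hl0]
          simp [Function.comp_def]
        rw [e] at this
        rw [List.length_cons, ← add_assoc]
        exact lev_succ this
      · intro it hit
        rcases List.mem_cons.1 hit with rfl | hit
        · simp
        · simp [(hl it hit).1]
      · intro it hit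
        rcases List.mem_cons.1 hit with rfl | hit
        · exact MPath.lt hb.2 hb.1
        · exact (hl it hit).2

theorem wraps_le_one {α : Type*} (f : α → Bool) (v : List α) : wraps f v ≤ 1 := by
  unfold wraps
  split_ifs <;> simp

theorem mg_map_zero (σ : List (ℕ × ℕ)) :
    mg joinPair (σ.map fun b => ((0 : ℕ), b)) = σ ∧
      Linked linkPair (σ.map fun b => ((0 : ℕ), b)) := by
  induction σ with
  | nil => exact ⟨rfl, trivial⟩
  | cons b σ ih =>
    refine ⟨?_, fun h => absurd h (by simp), ih.2⟩
    rw [List.map_cons, mg, if_neg (by simp), ih.1]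

/-- The rules are complete. -/
theorem lev_of_carve {v : List Ltr} (hM : S.MPath S.qI v S.qF)
    (hA : ∀ i ∈ (grph Ltr.i v).V, S.APath i (S.pI i) (v.filter (·.i == i)) (S.pF i))
    {X : Finset ℕ} (hX : (grph Ltr.i v).Carve S.s X) :
    X ⊆ Finset.range S.t ∧ S.Lev (S.B ^ 4 + S.s + 1 + X.card)
      (.der X (wraps (inSet X) v) ((blocks (inSet X) v).map ends)) := by
  have hV : ∀ i ∈ (grph Ltr.i v).V, ∃ e ∈ v, e.i = i := by
    intro i hi
    simpa [grph] using hi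
  have hlt : ∀ i ∈ (grph Ltr.i v).V, i < S.t := by
    intro i hi
    obtain ⟨e, he, hei⟩ := hV i hi
    have h1 := hA i hi
    have h2 : e ∈ v.filter (·.i == i) := List.mem_filter.2 ⟨he, by simp [hei]⟩
    cases hf : v.filter (·.i == i) with
    | nil => simp [hf] at h2
    | cons d w =>
      rw [hf] at h1
      obtain ⟨p₁, h3, -⟩ := h1
      exact (S.hA h3).1
  have hcut : ∀ X, (grph Ltr.i v).Carve S.s X →
      ((blocks (inSet X) v).map ends).length ≤ S.s + wraps (inSet X) v := by
    intro X hX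
    rw [List.length_map]
    exact (cutLe_grph_iff Ltr.i v).1 hX.cutLe
  have hpos : 0 < S.t := by
    obtain ⟨x, hx⟩ := hX.nonempty
    exact (Nat.zero_le x).trans_lt (hlt x (hX.subset hx))
  induction hX with
  | @leaf i hi hc =>
    have hc' := hcut _ (.leaf hi hc)
    have hw := wraps_le_one (inSet {i}) v
    have hit := hlt i hi
    refine ⟨by simpa using hit, ?_⟩
    have hruns := (runs_of_mem_blocks (inSet {i}) hM).1
    have hin : (inSet {i} : Ltr → Bool) = (·.i == i) := by
      funext e
      by_cases h : e.i = i <;> simp [inSet, h]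
    have hne : blocks (inSet {i}) v ≠ [] := by
      intro h
      have := flatten_blocks (inSet {i}) v
      rw [h] at this
      obtain ⟨e, he, hei⟩ := hV i hi
      have h2 : e ∈ v.filter (inSet {i}) := List.mem_filter.2 ⟨he, by simp [inSet, hei]⟩
      rw [← this] at h2
      simp at h2
    have hA' := hA i hi
    rw [← hin, ← flatten_blocks] at hA'
    rw [List.length_map] at hc'
    -- There are at most `s + 1` blocks, so this fact has level at most `B ^ 4 + s + 1`; the rule
    -- for leaves adds one, the cardinality of `{i}`.
    have hlev := lev_seg hit hne hruns hA' (by omega)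
    obtain ⟨e1, e2⟩ := mg_map_zero ((blocks (inSet {i}) v).map ends)
    have := Step.leaf (S := S) (w := wraps (inSet {i}) v)
      (T := S.Lev (S.B ^ 4 + S.s + 1))
      (l := ((blocks (inSet {i}) v).map ends).map fun b => ((0 : ℕ), b)) hit hw
      ⟨by simp; omega, by simp, ?_⟩ e2 (by rw [e1, List.length_map]; exact hc')
      (by rw [e1]; exact hlev.mono (by omega))
    · rw [e1] at this
      rw [Finset.card_singleton]
      exact lev_succ this
    · intro it hit
      simp only [List.map_map, List.mem_map] at hit
      obtain ⟨b, hb, rfl⟩ := hit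
      exact MPath.lt (hruns b hb).2 (hruns b hb).1
  | @join X Y h1 h2 hd hc ih1 ih2 =>
    obtain ⟨x1, l1⟩ := ih1
    obtain ⟨x2, l2⟩ := ih2
    have hdis := Finset.disjoint_left.1 hd
    -- The value `2` stands for letters without owner.
    set c : Ltr → ℕ := fun e => if e.i ∈ X then 0 else if e.i ∈ Y then 1 else 2 with hcdef
    have hc0 : (fun e => c e == 0) = inSet X := by
      funext e
      by_cases h : e.i ∈ X <;> by_cases h' : e.i ∈ Y <;> simp [hcdef, inSet, h, h']
    have hc1 : (fun e => c e == 1) = inSet Y := by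
      funext e
      by_cases h : e.i ∈ X
      · simp [hcdef, inSet, h, hdis h]
      · by_cases h' : e.i ∈ Y <;> simp [hcdef, inSet, h, h']
    have hc2 : (fun e => decide (c e ≤ 1)) = inSet (X ∪ Y) := by
      funext e
      by_cases h : e.i ∈ X <;> by_cases h' : e.i ∈ Y <;> simp [hcdef, inSet, h, h']
    have D := describes_patternOf c (chained_of_mPath hM)
    set l := patternOf c v
    have d0 := D.pr_eq 0 zero_le_one
    have d1 := D.pr_eq 1 le_rfl
    have d2 := D.mg_eq
    rw [hc0] at d0
    rw [hc1] at d1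
    rw [hc2] at d2
    set l' := l.map fun it => (it.1, ends it.2) with hl'
    have hf := forall₂_map ends l
    have hmg := (mg_map D.ne_nil).1
    rw [d2] at hmg
    have hcutX := hcut _ h1
    have hcutY := hcut _ h2
    have hcutZ := hcut _ (.join h1 h2 hd hc)
    have wX := wraps_le_one (inSet X) v
    have wY := wraps_le_one (inSet Y) v
    have wZ := wraps_le_one (inSet (X ∪ Y)) v
    have hB := S.hB
    -- If the word begins and ends in one of the two sets, it does so in the union too, and the
    -- pattern begins and ends with the owner of that set.
    have hwrap : ∀ (Z : Finset ℕ) (o : ℕ), o ≤ 1 → (∀ e : Ltr, e.i ∈ Z → c e = o) →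
        (∀ e : Ltr, e.i ∈ Z → inSet (X ∪ Y) e = true) →
        wraps (inSet Z) v = 0 ∨ firstOwn l' = o ∧ own l' = o ∧ wraps (inSet (X ∪ Y)) v = 1 := by
      intro Z o ho hZ hZ'
      by_cases hw : wraps (inSet Z) v = 0
      · exact .inl hw
      · right
        unfold wraps at hw
        split_ifs at hw with hh
        · rw [Bool.and_eq_true] at hh
          cases hv : v.head? with
          | none => simp [hv] at hh
          | some x =>
            cases hv' : v.getLast? with
            | none => simp [hv'] at hh
            | some y =>
              simp only [hv, hv', Option.any_some, inSet, decide_eq_true_eq] at hh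
              have g1 := (D.head x hv (by rw [hZ x hh.1]; exact ho)).1
              have g2 := (D.last y hv' (by rw [hZ y hh.2]; exact ho)).2
              refine ⟨?_, ?_, ?_⟩
              · rw [← firstOwn_congr (R := fun a b => b = ends a) hf, g2, hZ y hh.2]
              · rw [← own_congr (R := fun a b => b = ends a) hf, g1, hZ x hh.1]
              · simp [wraps, hv, hv', hZ' x hh.1, hZ' y hh.2]
        · exact absurd rfl hw
    refine ⟨Finset.union_subset x1 x2, ?_⟩
    have hcardX := h1.nonempty.card_pos
    have hcardY := h2.nonempty.card_pos
    -- Neither set is empty, so both premises are available one level below the bound for `X ∪ Y`.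
    have := Step.join (S := S) (T := S.Lev (S.B ^ 4 + S.s + X.card + Y.card)) (X := X) (Y := Y)
      (w₁ := wraps (inSet X) v) (w₂ := wraps (inSet Y) v) (w := wraps (inSet (X ∪ Y)) v) (l := l')
      hpos x1 x2 hd (by omega) (by omega) wZ ⟨?_, ?_, ?_⟩ (linked_map D.linked)
      (by rw [hmg]; exact hcutZ)
      (hwrap X 0 zero_le_one (fun e he => by simp [hcdef, he])
        (fun e he => by simp [inSet, he]))
      (hwrap Y 1 le_rfl (fun e he => by
          have : e.i ∉ X := fun h => hdis h he
          simp [hcdef, he, this])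
        (fun e he => by simp [inSet, he]))
      (by rw [hl', pr_map, d0]; exact l1.mono (by omega))
      (by rw [hl', pr_map, d1]; exact l2.mono (by omega))
    · rw [hmg] at this
      rw [Finset.card_union_of_disjoint hd]
      exact (lev_succ this).mono (by omega)
    -- The items are the blocks of `X` and of `Y`, at most `s + 1` of each.
    · rw [hl', List.length_map, ← length_pr_add D.type, d0, d1]
      rw [List.length_map] at hcutX hcutY
      omega
    · intro it hit
      simp only [hl', List.mem_map] at hit
      obtain ⟨b, hb, rfl⟩ := hit
      exact D.type b hb
    · have hall : ∀ o ≤ 1, ∀ b ∈ pr o l, b ∈ blocks (fun e => c e == o) v := fun o ho b hb => by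
        rwa [← D.pr_eq o ho]
      have hmem : ∀ (k : List (ℕ × List Ltr)), (∀ it ∈ k, it.1 ≤ 2) → ∀ it ∈ k,
          ∃ o ≤ 1, it.2 ∈ pr o k := by
        intro k hk
        induction k with
        | nil => simp
        | cons b k ihk =>
          intro it hit
          rcases List.mem_cons.1 hit with rfl | hit
          · exact ⟨_, own_le_one hk, by rw [pr, if_pos rfl]; simp⟩
          · obtain ⟨o, ho, h⟩ := ihk (fun x hx => hk x (List.mem_cons_of_mem _ hx)) it hit
            refine ⟨o, ho, ?_⟩
            rw [pr]
            split_ifs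
            · exact List.mem_cons_of_mem _ h
            · exact h
      intro it hit
      simp only [hl', List.mem_map] at hit
      obtain ⟨b, hb, rfl⟩ := hit
      obtain ⟨o, ho, hbo⟩ := hmem l D.type b hb
      have := (runs_of_mem_blocks _ hM).1 b.2 (hall o ho _ hbo)
      exact MPath.lt this.2 this.1

/-- At most `t` threads occur, so the whole word is derived at level `B ^ 4 + s + 1 + t`, and
acceptance takes one more; `hB` shows that `B` covers the part after `B ^ 4`. -/
theorem lev_acc {v : List Ltr} (h : S.Solution v) :
    S.Lev (S.B ^ 4 + S.B) .acc := by
  obtain ⟨hne, hM, hA, hC⟩ := h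
  obtain ⟨hX, hL⟩ := lev_of_carve hM hA hC
  have hall : ∀ e ∈ v, inSet (grph Ltr.i v).V e = true := by
    intro e he
    simp only [inSet, grph, List.mem_toFinset, List.mem_map, decide_eq_true_eq]
    exact ⟨e, he, rfl⟩
  have hw : wraps (inSet (grph Ltr.i v).V) v = 1 := by
    obtain ⟨e, v', rfl⟩ := List.exists_cons_of_ne_nil hne
    have h1 := hall e (by simp)
    have h2 := hall _ (List.getLast_mem hne)
    rw [wraps, List.getLast?_eq_some_getLast hne]
    simp only [List.head?_cons, Option.any_some, h1, h2]
    rfl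
  rw [blocks_of_forall hne hall, hw, List.map_singleton, hM.ends_eq hne] at hL
  have hcard := Finset.card_le_card hX
  rw [Finset.card_range] at hcard
  have hB := S.hB
  have hlt := MPath.lt hM hne
  obtain ⟨x, hx⟩ := hC.nonempty
  have hpos : 0 < S.t := (Nat.zero_le x).trans_lt (Finset.mem_range.1 (hX hx))
  exact (lev_succ (.acc hpos hlt.1 hlt.2 hX hL)).mono (by omega)

end Sys

namespace RAM

/-! ### Derived commands -/

/-- The command is fixed, so loops are nested to a fixed depth, and each of them contributes one
factor `W`. -/
theorem Cm.exists_bd_le (c : Cm) : ∃ A k : ℕ, ∀ W, c.bd W ≤ A * (W + 1) ^ k := by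
  have hadd : ∀ {f g : ℕ → ℕ}, (∃ A k : ℕ, ∀ W, f W ≤ A * (W + 1) ^ k) →
      (∃ A k : ℕ, ∀ W, g W ≤ A * (W + 1) ^ k) → ∃ A k : ℕ, ∀ W, f W + g W ≤ A * (W + 1) ^ k := by
    rintro f g ⟨A, k, hf⟩ ⟨A', k', hg⟩
    refine ⟨A + A', k + k', fun W => ?_⟩
    have h1 : (W + 1) ^ k ≤ (W + 1) ^ (k + k') := Nat.pow_le_pow_right (by omega) (by omega)
    have h2 : (W + 1) ^ k' ≤ (W + 1) ^ (k + k') := Nat.pow_le_pow_right (by omega) (by omega)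
    rw [add_mul]
    exact add_le_add ((hf W).trans (Nat.mul_le_mul_left _ h1))
      ((hg W).trans (Nat.mul_le_mul_left _ h2))
  have hconst : ∀ n : ℕ, ∃ A k : ℕ, ∀ W : ℕ, n ≤ A * (W + 1) ^ k := fun n => ⟨n, 0, by simp⟩
  have hid : ∃ A k : ℕ, ∀ W : ℕ, W ≤ A * (W + 1) ^ k := ⟨1, 1, by simp⟩
  have hmul : ∀ {f : ℕ → ℕ}, (∃ A k : ℕ, ∀ W, f W ≤ A * (W + 1) ^ k) →
      ∃ A k : ℕ, ∀ W, W * f W ≤ A * (W + 1) ^ k := by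
    rintro f ⟨A, k, hf⟩
    refine ⟨A, k + 1, fun W => ?_⟩
    calc W * f W ≤ (W + 1) * (A * (W + 1) ^ k) := Nat.mul_le_mul (by omega) (hf W)
      _ = A * (W + 1) ^ (k + 1) := by ring
  have hex : ∀ e : Ex, ∃ A k : ℕ, ∀ W, e.bd W ≤ A * (W + 1) ^ k := by
    intro e
    induction e with
    | var => exact hconst 1
    | lit n => exact hconst (n + 1)
    | add a b iha ihb => exact hadd (hadd iha ihb) (hconst 1)
    | sub a b iha ihb => exact hadd (hadd iha ihb) (hconst 1)
    | mul a b iha ihb => exact hadd (hadd (hadd iha ihb) hid) (hconst 2)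
    | get a ih => exact hadd ih (hconst 1)
  induction c with
  | skip => exact hconst 1
  | set _ e => exact hadd (hex e) (hconst 1)
  | put a b => exact hadd (hadd (hex a) (hex b)) (hconst 1)
  | seq p q ihp ihq => exact hadd ihp ihq
  | ite e p q ihp ihq => exact hadd (hadd (hadd (hex e) ihp) ihq) (hconst 1)
  | rep e c ih => exact hadd (hadd (hex e) (hmul (hadd ih (hconst 2)))) (hconst 1)

/-- A sequence of commands. -/
def seqs : List Cm → Cm
  | [] => .skip
  | c :: cs => .seq c (seqs cs)

/-- A command that is executed only if all the given expressions are nonzero. -/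
def ifs : List Ex → Cm → Cm
  | [], c => c
  | e :: es, c => .ite e (ifs es c) .skip

/-- Set `x` to `a` if `e` is nonzero, and to `b` otherwise. -/
def cset (x : ℕ) (e a b : Ex) : Cm := .ite e (.set x a) (.set x b)

/-- Set the given variables to `0`. -/
def clear (xs : List ℕ) : Cm := seqs (xs.map fun x => .set x (.lit 0))

theorem sem_cset (x : ℕ) (e a b : Ex) (σ : Store) :
    (cset x e a b).sem σ = { σ with
      v := Function.update σ.v x (if e.eval σ ≠ 0 then a.eval σ else b.eval σ) } := by
  simp only [cset, Cm.sem]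
  split_ifs <;> rfl

theorem sem_ifs (es : List Ex) (c : Cm) (σ : Store) :
    ((∀ e ∈ es, e.eval σ ≠ 0) → (ifs es c).sem σ = c.sem σ) ∧
      (¬ (∀ e ∈ es, e.eval σ ≠ 0) → (ifs es c).sem σ = σ) := by
  induction es with
  | nil => simp [ifs]
  | cons e es ih =>
    simp only [ifs, Cm.sem, List.mem_cons, forall_eq_or_imp]
    by_cases h : e.eval σ ≠ 0
    · simpa [h] using ih
    · simp [h]

theorem ok_ifs {W : ℕ} {es : List Ex} {c : Cm} {σ : Store} (he : ∀ e ∈ es, e.ok W σ)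
    (hc : (∀ e ∈ es, e.eval σ ≠ 0) → c.ok W σ) : (ifs es c).ok W σ := by
  induction es with
  | nil => exact hc (by simp)
  | cons e es ih =>
    refine ⟨he e (by simp), fun h => ih (fun d hd => he d (List.mem_cons_of_mem _ hd)) fun h' => ?_,
      fun _ => trivial⟩
    refine hc fun d hd => ?_
    rcases List.mem_cons.1 hd with rfl | hd
    exacts [h, h' d hd]

theorem sem_clear (xs : List ℕ) (σ : Store) :
    (clear xs).sem σ = { σ with v := fun x => if x ∈ xs then 0 else σ.v x } := by
  induction xs generalizing σ with
  | nil => simp [clear, seqs, Cm.sem]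
  | cons x xs ih =>
    have : (clear (x :: xs)).sem σ = (clear xs).sem ((Cm.set x (.lit 0)).sem σ) := rfl
    rw [this, ih]
    simp only [Cm.sem, Ex.eval, Store.mk.injEq, and_true]
    funext y
    by_cases h : y ∈ xs
    · simp [h]
    · by_cases h' : y = x <;> simp [h, h']

theorem ok_clear {W : ℕ} (xs : List ℕ) (σ : Store) : (clear xs).ok W σ := by
  induction xs generalizing σ with
  | nil => trivial
  | cons x xs ih => exact ⟨trivial, ih _⟩

/-- The variables that a command may change. -/
def Cm.writes : Cm → List ℕ
  | skip => []
  | set x _ => [x]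
  | put _ _ => []
  | seq p q => p.writes ++ q.writes
  | ite _ p q => p.writes ++ q.writes
  | rep _ c => c.writes

/-- Whether a command leaves the memory unchanged. -/
def Cm.keepsMem : Cm → Bool
  | skip => true
  | set _ _ => true
  | put _ _ => false
  | seq p q => p.keepsMem && q.keepsMem
  | ite _ p q => p.keepsMem && q.keepsMem
  | rep _ c => c.keepsMem

theorem Cm.sem_v_of_notMem {x : ℕ} (c : Cm) (h : x ∉ c.writes) (σ : Store) :
    (c.sem σ).v x = σ.v x := by
  induction c generalizing σ with
  | skip => rfl
  | set y e =>
    simp only [Cm.writes, List.mem_singleton] at h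
    simp [Cm.sem, Function.update_of_ne h]
  | put => rfl
  | seq p q ihp ihq =>
    simp only [Cm.writes, List.mem_append, not_or] at h
    rw [Cm.sem, ihq h.2, ihp h.1]
  | ite e p q ihp ihq =>
    simp only [Cm.writes, List.mem_append, not_or] at h
    rw [Cm.sem]
    split_ifs
    exacts [ihp h.1 σ, ihq h.2 σ]
  | rep e c ih =>
    rw [Cm.sem]
    generalize e.eval σ = n
    induction n with
    | zero => rfl
    | succ n ihn => rw [Function.iterate_succ_apply', ih h, ihn]

theorem Cm.sem_m (c : Cm) (h : c.keepsMem = true) (σ : Store) : (c.sem σ).m = σ.m := by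
  induction c generalizing σ with
  | skip => rfl
  | set => rfl
  | put => simp [Cm.keepsMem] at h
  | seq p q ihp ihq =>
    simp only [Cm.keepsMem, Bool.and_eq_true] at h
    rw [Cm.sem, ihq h.2, ihp h.1]
  | ite e p q ihp ihq =>
    simp only [Cm.keepsMem, Bool.and_eq_true] at h
    rw [Cm.sem]
    split_ifs
    exacts [ihp h.1 σ, ihq h.2 σ]
  | rep e c ih =>
    rw [Cm.sem]
    generalize e.eval σ = n
    induction n with
    | zero => rfl
    | succ n ihn => rw [Function.iterate_succ_apply', ih h, ihn]

/-- The invariant rule for loops. -/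
theorem iterate_spec {W n : ℕ} {c : Cm} {I : ℕ → Store → Prop} {σ : Store} (h0 : I 0 σ)
    (hs : ∀ j < n, ∀ τ, I j τ → c.ok W τ ∧ I (j + 1) (c.sem τ)) :
    (∀ j < n, c.ok W (c.sem^[j] σ)) ∧ I n (c.sem^[n] σ) := by
  have key : ∀ j ≤ n, I j (c.sem^[j] σ) := by
    intro j hj
    induction j with
    | zero => exact h0
    | succ j ih =>
      rw [Function.iterate_succ_apply']
      exact (hs j hj _ (ih (by omega))).2
  exact ⟨fun j hj => (hs j hj _ (key j hj.le)).1, key n le_rfl⟩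

theorem rep_spec {W : ℕ} {e : Ex} {c : Cm} {I : ℕ → Store → Prop} {σ : Store} (he : e.ok W σ)
    (hW : e.eval σ ≤ W) (h0 : I 0 σ)
    (hs : ∀ j < e.eval σ, ∀ τ, I j τ → c.ok W τ ∧ I (j + 1) (c.sem τ)) :
    (Cm.rep e c).ok W σ ∧ I (e.eval σ) ((Cm.rep e c).sem σ) :=
  ⟨⟨he, hW, (iterate_spec h0 hs).1⟩, (iterate_spec h0 hs).2⟩

end RAM

/-! ### Codes of facts -/

/-- The number with digits `l` in base `C`; a digit `d` is represented by `d + 1`. -/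
def code (C : ℕ) : List ℕ → ℕ
  | [] => 0
  | d :: l => code C l * C + (d + 1)

/-- The shift of the digits by one excludes leading zeros, so lists of different lengths get
different codes as well. -/
theorem code_injective {B : ℕ} {l l' : List ℕ} (hl : ∀ d ∈ l, d < B) (hl' : ∀ d ∈ l', d < B)
    (h : code (B + 1) l = code (B + 1) l') : l = l' := by
  induction l generalizing l' with
  | nil =>
    cases l' with
    | nil => rfl
    | cons d l' => simp [code] at h
  | cons d l ih =>
    cases l' with
    | nil => simp [code] at h
    | cons d' l' =>
      simp only [List.mem_cons, forall_eq_or_imp] at hl hl'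
      simp only [code] at h
      have h1 := congrArg (· % (B + 1)) h
      have h2 := congrArg (· / (B + 1)) h
      have hd := hl.1
      have hd' := hl'.1
      simp only [Nat.mul_add_mod_self_right, Nat.mod_eq_of_lt (show d + 1 < B + 1 by omega),
        Nat.mod_eq_of_lt (show d' + 1 < B + 1 by omega)] at h1
      rw [Nat.mul_comm, Nat.mul_add_div (by omega), Nat.mul_comm, Nat.mul_add_div (by omega),
        Nat.div_eq_of_lt (show d + 1 < B + 1 by omega),
        Nat.div_eq_of_lt (show d' + 1 < B + 1 by omega), add_zero, add_zero] at h2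
      rw [ih hl.2 hl'.2 h2, Nat.succ.inj h1]

/-- The states of a list of blocks. -/
def flat : List (ℕ × ℕ) → List ℕ
  | [] => []
  | b :: σ => b.2 :: b.1 :: flat σ

theorem flat_injective {σ τ : List (ℕ × ℕ)} (h : flat σ = flat τ) : σ = τ := by
  induction σ generalizing τ with
  | nil => cases τ with
    | nil => rfl
    | cons => simp [flat] at h
  | cons b σ ih => cases τ with
    | nil => simp [flat] at h
    | cons c τ =>
      simp only [flat, List.cons.injEq] at h
      rw [ih h.2.2, Prod.ext h.2.1 h.1]

theorem flat_lt {m : ℕ} {σ : List (ℕ × ℕ)} (h : ∀ b ∈ σ, b.1 < m ∧ b.2 < m) :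
    ∀ d ∈ flat σ, d < m := by
  induction σ with
  | nil => simp [flat]
  | cons b σ ih =>
    simp only [List.mem_cons, forall_eq_or_imp] at h
    simp only [flat, List.mem_cons, forall_eq_or_imp]
    exact ⟨h.1.2, h.1.1, ih h.2⟩

/-- The indicator function of a set, up to `j`. -/
def bits : ℕ → Finset ℕ → List ℕ
  | 0, _ => []
  | j + 1, X => (if j ∈ X then 1 else 0) :: bits j X

theorem length_bits (j : ℕ) (X : Finset ℕ) : (bits j X).length = j := by
  induction j with
  | zero => rfl
  | succ j ih => simp [bits, ih]

theorem bits_le (j : ℕ) (X : Finset ℕ) : ∀ d ∈ bits j X, d ≤ 1 := by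
  induction j with
  | zero => simp [bits]
  | succ j ih =>
    simp only [bits, List.mem_cons, forall_eq_or_imp]
    exact ⟨by split_ifs <;> simp, ih⟩

theorem mem_of_bits_eq {j : ℕ} {X Y : Finset ℕ} (h : bits j X = bits j Y) :
    ∀ i < j, i ∈ X ↔ i ∈ Y := by
  induction j with
  | zero => simp
  | succ j ih =>
    simp only [bits, List.cons.injEq] at h
    intro i hi
    rcases Nat.lt_succ_iff_lt_or_eq.1 hi with hi | rfl
    · exact ih h.2 i hi
    · have := h.1
      by_cases h1 : i ∈ X <;> by_cases h2 : i ∈ Y <;> simp [h1, h2] at this ⊢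

/-- The digits that describe a fact. -/
def Fct.key (t : ℕ) : Fct → List ℕ
  | .seg i p p' σ => 1 :: p' :: p :: i :: flat σ
  | .der X w σ => 2 :: w :: (bits t X ++ flat σ)
  | .acc => [0]

theorem Sys.key_lt {S : Sys} {f : Fct} (hf : S.Valid f) : ∀ d ∈ f.key S.t, d < S.B := by
  have hB := S.hB
  have hm := S.hmB
  cases f with
  | seg i p p' σ =>
    obtain ⟨h1, h2, h3, h4⟩ := hf
    intro d hd
    simp only [Fct.key, List.mem_cons] at hd
    rcases hd with rfl | rfl | rfl | rfl | hd
    any_goals omega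
    exact (flat_lt h4 d hd).trans_le hm
  | der X w σ =>
    obtain ⟨h1, h2, h3⟩ := hf
    intro d hd
    simp only [Fct.key, List.mem_cons, List.mem_append] at hd
    rcases hd with rfl | rfl | hd | hd
    any_goals omega
    · have := bits_le _ _ d hd
      omega
    · exact (flat_lt h3 d hd).trans_le hm
  | acc =>
    intro d hd
    simp only [Fct.key, List.mem_singleton] at hd
    omega

/-- The first digit tells the kind of the fact, and the indicator of a set always has length `t`, so
the blocks after it can be separated. Validity ensures that sets have no elements beyond `t`. -/
theorem Sys.key_injective {S : Sys} {f g : Fct} (hf : S.Valid f) (hg : S.Valid g)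
    (h : f.key S.t = g.key S.t) : f = g := by
  cases f with
  | seg i p p' σ => cases g with
    | seg j r r' τ =>
      simp only [Fct.key, List.cons.injEq, true_and] at h
      rw [h.1, h.2.1, h.2.2.1, flat_injective h.2.2.2]
    | der => simp [Fct.key] at h
    | acc => simp [Fct.key] at h
  | der X w σ => cases g with
    | seg => simp [Fct.key] at h
    | der Y w' τ =>
      simp only [Fct.key, List.cons.injEq, true_and] at h
      obtain ⟨h1, h2⟩ := h
      obtain ⟨h2, h3⟩ := List.append_inj h2 (by rw [length_bits, length_bits])
      have h4 := mem_of_bits_eq h2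
      have : X = Y := by
        ext i
        constructor
        · intro hi
          exact (h4 i (Finset.mem_range.1 (hf.1 hi))).1 hi
        · intro hi
          exact (h4 i (Finset.mem_range.1 (hg.1 hi))).2 hi
      rw [this, h1, flat_injective h3]
    | acc => simp [Fct.key] at h
  | acc => cases g with
    | seg => simp [Fct.key] at h
    | der => simp [Fct.key] at h
    | acc => rfl

/-! ### Applications of rules, described by digits -/

namespace Sys

variable (S : Sys)

/-- The position of the first digit for a memory state. -/
def stPos : ℕ := 9 + S.t + 2 * S.s + 2

/-- The number of digits. -/
def numDigits : ℕ := S.stPos + 4 * S.s + 4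

/-- The base of a digit. -/
def rad (j : ℕ) : ℕ := if j < 9 then S.B else if j < S.stPos then 3 else S.m

/-- The first `n` items of the pattern, the last one first. -/
def pat (D : ℕ → ℕ) : ℕ → List (ℕ × ℕ × ℕ)
  | 0 => []
  | n + 1 => (D (9 + S.t + n), D (S.stPos + 2 * n), D (S.stPos + 2 * n + 1)) :: pat D n

/-- The threads of color `k`. -/
def cols (D : ℕ → ℕ) (k : ℕ) : Finset ℕ := (Finset.range S.t).filter fun j => D (9 + j) = k

/-- The threads of color different from `0`. -/
def colored (D : ℕ → ℕ) : Finset ℕ := (Finset.range S.t).filter fun j => D (9 + j) ≠ 0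

/-- The pattern is admissible. -/
structure Admissible (D : ℕ → ℕ) : Prop where
  thread : D 0 < S.t
  length : D 5 ≤ 2 * S.s + 2
  linked : Linked linkPair (S.pat D (D 5))

/-- The facts that result from `T` by the rule applications with the digits `D`. -/
inductive Fire (D : ℕ → ℕ) (T : Fct → Prop) : Fct → Prop
  | letter : D 5 = 1 → S.As (D 0) (D 1) (D 4) (D 2) →
      S.Ms (D S.stPos) (D 4) (D (S.stPos + 1)) →
      Fire D T (.seg (D 0) (D 1) (D 2) (mg joinPair (S.pat D (D 5))))
  | segJoin : InSequence (S.pat D (D 5)) → T (.seg (D 0) (D 1) (D 3) (pr 0 (S.pat D (D 5)))) →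
      T (.seg (D 0) (D 3) (D 2) (pr 1 (S.pat D (D 5)))) →
      Fire D T (.seg (D 0) (D 1) (D 2) (mg joinPair (S.pat D (D 5))))
  | leaf : (∀ k < S.t, D (9 + k) = if k = D 0 then 1 else 0) → D 8 ≤ 1 →
      (mg joinPair (S.pat D (D 5))).length ≤ S.s + D 8 →
      T (.seg (D 0) (S.pI (D 0)) (S.pF (D 0)) (mg joinPair (S.pat D (D 5)))) →
      Fire D T (.der (S.colored D) (D 8) (mg joinPair (S.pat D (D 5))))
  | join : D 8 ≤ 1 → (mg joinPair (S.pat D (D 5))).length ≤ S.s + D 8 →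
      (D 6 = 0 ∨ firstOwn (S.pat D (D 5)) = 0 ∧ own (S.pat D (D 5)) = 0 ∧ D 8 = 1) →
      (D 7 = 0 ∨ firstOwn (S.pat D (D 5)) = 1 ∧ own (S.pat D (D 5)) = 1 ∧ D 8 = 1) →
      T (.der (S.cols D 1) (D 6) (pr 0 (S.pat D (D 5)))) →
      T (.der (S.cols D 2) (D 7) (pr 1 (S.pat D (D 5)))) →
      Fire D T (.der (S.colored D) (D 8) (mg joinPair (S.pat D (D 5))))
  | acc : D 5 = 1 → D S.stPos = S.qI → D (S.stPos + 1) = S.qF →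
      T (.der (S.colored D) 1 (mg joinPair (S.pat D (D 5)))) → Fire D T .acc

/-! ### Digit vectors and applications of rules -/

variable {S} {D : ℕ → ℕ}

theorem length_pat (n : ℕ) : (S.pat D n).length = n := by
  induction n with
  | zero => rfl
  | succ n ih => simp [pat, ih]

theorem mem_pat {n : ℕ} {it : ℕ × ℕ × ℕ} (h : it ∈ S.pat D n) :
    ∃ k < n, it = (D (9 + S.t + k), D (S.stPos + 2 * k), D (S.stPos + 2 * k + 1)) := by
  induction n with
  | zero => simp [pat] at h
  | succ n ih =>
    rcases List.mem_cons.1 h with h | h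
    · exact ⟨n, by omega, h⟩
    · obtain ⟨k, hk, e⟩ := ih h
      exact ⟨k, by omega, e⟩

theorem rad_type {k : ℕ} (h : k < 2 * S.s + 2) : S.rad (9 + S.t + k) = 3 := by
  rw [rad, if_neg (by omega), if_pos (by simp only [stPos]; omega)]

theorem rad_color {k : ℕ} (h : k < S.t) : S.rad (9 + k) = 3 := by
  rw [rad, if_neg (by omega), if_pos (by simp only [stPos]; omega)]

theorem rad_state (k : ℕ) : S.rad (S.stPos + k) = S.m := by
  rw [rad, if_neg (by simp only [stPos]; omega), if_neg (by omega)]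

theorem rad_small {k : ℕ} (h : k < 9) : S.rad k = S.B := if_pos h

section Bounds

variable (hD : ∀ j < S.numDigits, D j < S.rad j)

include hD

theorem type_lt {k : ℕ} (h : k < 2 * S.s + 2) : D (9 + S.t + k) < 3 :=
  rad_type h ▸ hD (9 + S.t + k) (by simp only [numDigits, stPos]; omega)

theorem color_lt {k : ℕ} (h : k < S.t) : D (9 + k) < 3 :=
  rad_color h ▸ hD (9 + k) (by simp only [numDigits, stPos]; omega)

theorem state_lt {k : ℕ} (h : k < 4 * S.s + 4) : D (S.stPos + k) < S.m :=
  rad_state k ▸ hD (S.stPos + k) (by simp only [numDigits]; omega)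

theorem small_lt {k : ℕ} (h : k < 9) : D k < S.B :=
  rad_small h ▸ hD k (by simp only [numDigits, stPos]; omega)

theorem validPat_pat {n : ℕ} (hn : n ≤ 2 * S.s + 2) : S.ValidPat (S.pat D n) := by
  refine ⟨by rwa [length_pat], fun it h => ?_, fun it h => ?_⟩
  · obtain ⟨k, hk, rfl⟩ := mem_pat h
    have := type_lt hD (show k < 2 * S.s + 2 by omega)
    simp only
    omega
  · obtain ⟨k, hk, rfl⟩ := mem_pat h
    exact ⟨state_lt hD (by omega), by simpa [add_assoc] using state_lt hD (k := 2 * k + 1) (by omega)⟩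

theorem colored_eq : S.cols D 1 ∪ S.cols D 2 = S.colored D := by
  ext k
  simp only [cols, colored, Finset.mem_union, Finset.mem_filter, Finset.mem_range]
  constructor
  · rintro (h | h) <;> exact ⟨h.1, by omega⟩
  · rintro ⟨h, h'⟩
    have := color_lt hD h
    rcases (show D (9 + k) = 1 ∨ D (9 + k) = 2 by omega) with e | e
    exacts [.inl ⟨h, e⟩, .inr ⟨h, e⟩]

theorem Fire.step {T : Fct → Prop} {f : Fct} (hA : S.Admissible D) (hqI : S.qI < S.m)
    (hqF : S.qF < S.m) (h : S.Fire D T f) : S.Step T f := by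
  have ht := hA.thread
  have hl := validPat_pat hD hA.length
  have hlk := hA.linked
  have single : D 5 = 1 →
      mg joinPair (S.pat D (D 5)) = [(D S.stPos, D (S.stPos + 1))] := by
    intro h5
    rw [h5] at hlk ⊢
    simp only [pat, Linked, mg] at hlk ⊢
    rw [if_neg]
    · simp
    · intro h2
      simpa using hlk.1 h2
  cases h with
  | letter h5 hAs hMs =>
    rw [single h5]
    exact .letter hAs hMs
  | segJoin hs h1 h2 =>
    exact .segJoin ht (small_lt hD (by omega)) (small_lt hD (by omega)) (small_lt hD (by omega))
      hl hlk hs h1 h2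
  | leaf hc hw hlen h1 =>
    have : S.colored D = {D 0} := by
      ext k
      simp only [colored, Finset.mem_filter, Finset.mem_range, Finset.mem_singleton]
      constructor
      · rintro ⟨h, h'⟩
        rw [hc k h] at h'
        by_contra hk
        simp [hk] at h'
      · rintro rfl
        exact ⟨ht, by rw [hc _ ht]; simp⟩
    rw [this]
    exact .leaf ht hw hl hlk hlen h1
  | join hw hlen c1 c2 h1 h2 =>
    rw [← colored_eq hD]
    refine .join (by omega) (Finset.filter_subset _ _) (Finset.filter_subset _ _) ?_
      (small_lt hD (by omega)) (small_lt hD (by omega)) hw hl hlk hlen c1 c2 h1 h2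
    rw [Finset.disjoint_left]
    intro k h h'
    have h := (Finset.mem_filter.1 h).2
    have h' := (Finset.mem_filter.1 h').2
    omega
  | acc h5 e1 e2 h1 =>
    rw [single h5, e1, e2] at h1
    exact .acc (by omega) hqI hqF (Finset.filter_subset _ _) h1

end Bounds

/-- Digits for given parameters. -/
theorem exists_digits (hm : 0 < S.m) {d : ℕ → ℕ} (hd : ∀ k < 9, d k < S.B) {X Y : Finset ℕ}
    (hX : X ⊆ Finset.range S.t) (hY : Y ⊆ Finset.range S.t) (hXY : Disjoint X Y)
    {l : List (ℕ × ℕ × ℕ)} (hl : S.ValidPat l) (h5 : d 5 = l.length) :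
    ∃ D : ℕ → ℕ, (∀ j < S.numDigits, D j < S.rad j) ∧ (∀ k < 9, D k = d k) ∧
      S.pat D (D 5) = l ∧ S.cols D 1 = X ∧ S.cols D 2 = Y ∧ S.colored D = X ∪ Y ∧
      ∀ k < S.t, D (9 + k) = if k ∈ X then 1 else if k ∈ Y then 2 else 0 := by
  -- In `pat` the item with the highest index comes first, hence the reversal. Indices beyond the
  -- pattern are filled with zeros, which are legal digits because `0 < S.m`.
  set it : ℕ → ℕ × ℕ × ℕ := fun k => l.reverse.getD k (0, 0, 0) with hit
  have hitm : ∀ k, (it k).1 < 3 ∧ (it k).2.1 < S.m ∧ (it k).2.2 < S.m := by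
    intro k
    by_cases h : k < l.reverse.length
    · have : it k ∈ l := by
        simp only [hit, List.getD_eq_getElem _ _ h]
        exact List.mem_reverse.1 (List.getElem_mem h)
      exact ⟨by have := hl.type _ this; omega, hl.lt _ this⟩
    · simp only [hit, List.getD_eq_default _ _ (not_lt.1 h)]
      exact ⟨by norm_num, hm, hm⟩
  set D : ℕ → ℕ := fun j =>
    if j < 9 then d j else
    if j < 9 + S.t then (if j - 9 ∈ X then 1 else if j - 9 ∈ Y then 2 else 0) else
    if j < S.stPos then (it (j - (9 + S.t))).1 else
    if (j - S.stPos) % 2 = 0 then (it ((j - S.stPos) / 2)).2.1 else (it ((j - S.stPos) / 2)).2.2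
    with hDdef
  have hsmall : ∀ k < 9, D k = d k := fun k hk => by simp only [hDdef, if_pos hk]
  have hcol : ∀ k < S.t, D (9 + k) = if k ∈ X then 1 else if k ∈ Y then 2 else 0 := by
    intro k hk
    simp only [hDdef, if_neg (show ¬ 9 + k < 9 by omega), if_pos (show 9 + k < 9 + S.t by omega),
      Nat.add_sub_cancel_left]
  have htype : ∀ k < 2 * S.s + 2, D (9 + S.t + k) = (it k).1 := by
    intro k hk
    simp only [hDdef, if_neg (show ¬ 9 + S.t + k < 9 by omega),
      if_neg (show ¬ 9 + S.t + k < 9 + S.t by omega),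
      if_pos (show 9 + S.t + k < S.stPos by simp only [stPos]; omega), Nat.add_sub_cancel_left]
  have hst : ∀ k, D (S.stPos + k) = if k % 2 = 0 then (it (k / 2)).2.1 else (it (k / 2)).2.2 := by
    intro k
    simp only [hDdef, if_neg (show ¬ S.stPos + k < 9 by simp only [stPos]; omega),
      if_neg (show ¬ S.stPos + k < 9 + S.t by simp only [stPos]; omega),
      if_neg (show ¬ S.stPos + k < S.stPos by omega), Nat.add_sub_cancel_left]
  have hpat : ∀ n ≤ l.length, S.pat D n = (l.reverse.take n).reverse := by
    intro n hn
    induction n with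
    | zero => simp [pat]
    | succ n ih =>
      have hlen := hl.length
      rw [pat, ih (by omega), htype n (by omega), hst, add_assoc, hst,
        if_pos (by omega), if_neg (by omega), show 2 * n / 2 = n by omega,
        show (2 * n + 1) / 2 = n by omega,
        List.take_succ_eq_append_getElem (by simpa using hn), List.reverse_append]
      have hn' : n < l.reverse.length := by simpa using hn
      simp [hit, List.getElem?_eq_getElem hn']
  refine ⟨D, ?_, hsmall, ?_, ?_, ?_, ?_, hcol⟩
  · intro j hj
    by_cases h1 : j < 9
    · rw [hsmall j h1, rad_small h1]
      exact hd j h1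
    by_cases h2 : j < 9 + S.t
    · obtain ⟨k, rfl⟩ := Nat.exists_eq_add_of_le (not_lt.1 h1)
      rw [hcol k (by omega), rad_color (by omega)]
      split_ifs <;> omega
    by_cases h3 : j < S.stPos
    · obtain ⟨k, rfl⟩ := Nat.exists_eq_add_of_le (not_lt.1 h2)
      have : k < 2 * S.s + 2 := by simp only [stPos] at h3; omega
      rw [htype k this, rad_type this]
      exact (hitm k).1
    · obtain ⟨k, rfl⟩ := Nat.exists_eq_add_of_le (not_lt.1 h3)
      rw [hst, rad_state]
      split_ifs
      exacts [(hitm _).2.1, (hitm _).2.2]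
  · rw [hsmall 5 (by norm_num), h5, hpat _ le_rfl, ← List.length_reverse, List.take_length,
      List.reverse_reverse]
  · ext k
    simp only [cols, Finset.mem_filter, Finset.mem_range]
    constructor
    · rintro ⟨h, h'⟩
      rw [hcol k h] at h'
      by_contra hk
      rw [if_neg hk] at h'
      split_ifs at h'
      simp at h'
    · intro h
      have hk := Finset.mem_range.1 (hX h)
      exact ⟨hk, by rw [hcol k hk, if_pos h]⟩
  · ext k
    simp only [cols, Finset.mem_filter, Finset.mem_range]
    constructor
    · rintro ⟨h, h'⟩
      rw [hcol k h] at h'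
      by_contra hk
      split_ifs at h'
      simp at h'
    · intro h
      have hk := Finset.mem_range.1 (hY h)
      exact ⟨hk, by rw [hcol k hk, if_neg (Finset.disjoint_right.1 hXY h), if_pos h]⟩
  · ext k
    simp only [colored, Finset.mem_filter, Finset.mem_range, Finset.mem_union]
    constructor
    · rintro ⟨h, h'⟩
      rw [hcol k h] at h'
      by_contra hk
      rw [not_or] at hk
      simp [hk.1, hk.2] at h'
    · intro h
      have hk : k < S.t := h.elim (fun h => Finset.mem_range.1 (hX h))
        fun h => Finset.mem_range.1 (hY h)
      refine ⟨hk, ?_⟩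
      rw [hcol k hk]
      rcases h with h | h
      · simp [h]
      · split_ifs <;> simp

/-- With `Fire.step`, this shows that running through all digit vectors is the same as applying all
rules. Digits that a rule does not use are set to `0`, and sets that it does not use to `∅`. -/
theorem Step.exists_fire {T : Fct → Prop} {f : Fct} (hm : 0 < S.m) (ha : S.a ≤ S.B)
    (h : S.Step T f) :
    ∃ D : ℕ → ℕ, (∀ j < S.numDigits, D j < S.rad j) ∧ S.Admissible D ∧ S.Fire D T f := by
  have hB := S.hB
  have hdig : ∀ i p p' p₁ x n w₁ w₂ w : ℕ, i < S.B → p < S.B → p' < S.B → p₁ < S.B → x < S.B →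
      n < S.B → w₁ < S.B → w₂ < S.B → w < S.B → ∀ k < 9,
      ([i, p, p', p₁, x, n, w₁, w₂, w].getD k 0) < S.B := by
    intro i p p' p₁ x n w₁ w₂ w h0 h1 h2 h3 h4 h5 h6 h7 h8 k hk
    interval_cases k <;> assumption
  have hsing : ∀ {q r : ℕ}, q < S.m → r < S.m → S.ValidPat [(0, q, r)] := by
    intro q r hq hr
    refine ⟨by simp, ?_, ?_⟩ <;> simp [hq, hr]
  cases h with
  | @letter i p p' q r x hAs hMs =>
    obtain ⟨hi, hp, hp'⟩ := S.hA hAs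
    obtain ⟨hq, hx, hr⟩ := S.hM hMs
    obtain ⟨D, hD, hs, hpat, -, -, -, -⟩ := exists_digits (X := ∅) (Y := ∅) hm
      (hdig i p p' 0 x 1 0 0 0 (by omega) hp hp' (by omega) (by omega) (by omega) (by omega)
        (by omega) (by omega)) (by simp) (by simp) (by simp) (hsing hq hr) rfl
    have e5 : D 5 = 1 := hs 5 (by norm_num)
    have hq' : D S.stPos = q ∧ D (S.stPos + 1) = r := by
      rw [e5] at hpat
      have := (List.cons.inj hpat).1
      simp only [mul_zero, add_zero, Prod.mk.injEq] at this
      exact this.2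
    refine ⟨D, hD, ⟨by rw [hs 0 (by norm_num)]; exact hi, by omega, by simp [hpat, Linked]⟩, ?_⟩
    have := Fire.letter (S := S) (D := D) (T := T) e5
      (by rw [hs 0 (by norm_num), hs 1 (by norm_num), hs 2 (by norm_num), hs 4 (by norm_num)]
          exact hAs)
      (by rw [hq'.1, hq'.2, hs 4 (by norm_num)]; exact hMs)
    rw [hpat, hs 0 (by norm_num), hs 1 (by norm_num), hs 2 (by norm_num)] at this
    exact this
  | @segJoin i p p₁ p' l hi hp hp₁ hp' hl hlk hseq h1 h2 =>
    have hlen := hl.length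
    obtain ⟨D, hD, hs, hpat, -, -, -, -⟩ := exists_digits (X := ∅) (Y := ∅) hm
      (hdig i p p' p₁ 0 l.length 0 0 0 (by omega) hp hp' hp₁ (by omega) (by omega) (by omega)
        (by omega) (by omega)) (by simp) (by simp) (by simp) hl rfl
    refine ⟨D, hD, ⟨by rw [hs 0 (by norm_num)]; exact hi, by rw [hs 5 (by norm_num)]; exact hlen,
      by rwa [hpat]⟩, ?_⟩
    have := Fire.segJoin (S := S) (D := D) (T := T) (by rwa [hpat])
      (by rw [hpat, hs 0 (by norm_num), hs 1 (by norm_num), hs 3 (by norm_num)]; exact h1)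
      (by rw [hpat, hs 0 (by norm_num), hs 2 (by norm_num), hs 3 (by norm_num)]; exact h2)
    rw [hpat, hs 0 (by norm_num), hs 1 (by norm_num), hs 2 (by norm_num)] at this
    exact this
  | @leaf i w l hi hw hl hlk hle h1 =>
    have hlen := hl.length
    obtain ⟨D, hD, hs, hpat, -, -, hu, hcol⟩ := exists_digits (X := {i}) (Y := ∅) hm
      (hdig i 0 0 0 0 l.length 0 0 w (by omega) (by omega) (by omega) (by omega) (by omega)
        (by omega) (by omega) (by omega) (by omega)) (by simpa using hi) (by simp) (by simp) hl rfl
    refine ⟨D, hD, ⟨by rw [hs 0 (by norm_num)]; exact hi, by rw [hs 5 (by norm_num)]; exact hlen,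
      by rwa [hpat]⟩, ?_⟩
    have := Fire.leaf (S := S) (D := D) (T := T)
      (by rw [hs 0 (by norm_num)]; simpa using hcol)
      (by rw [hs 8 (by norm_num)]; exact hw)
      (by rw [hpat, hs 8 (by norm_num)]; exact hle)
      (by rw [hpat, hs 0 (by norm_num)]; exact h1)
    rw [hpat, hs 8 (by norm_num), hu] at this
    simpa using this
  | @join X Y w₁ w₂ w l ht hX hY hXY hw₁ hw₂ hw hl hlk hle hc1 hc2 h1 h2 =>
    have hlen := hl.length
    obtain ⟨D, hD, hs, hpat, hu1, hu2, hu, -⟩ := exists_digits hm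
      (hdig 0 0 0 0 0 l.length w₁ w₂ w (by omega) (by omega) (by omega) (by omega) (by omega)
        (by omega) (by omega) (by omega) (by omega)) hX hY hXY hl rfl
    refine ⟨D, hD, ⟨by rw [hs 0 (by norm_num)]; exact ht, by rw [hs 5 (by norm_num)]; exact hlen,
      by rwa [hpat]⟩, ?_⟩
    have := Fire.join (S := S) (D := D) (T := T)
      (by rw [hs 8 (by norm_num)]; exact hw)
      (by rw [hpat, hs 8 (by norm_num)]; exact hle)
      (by rw [hpat, hs 8 (by norm_num), hs 6 (by norm_num)]; exact hc1)
      (by rw [hpat, hs 8 (by norm_num), hs 7 (by norm_num)]; exact hc2)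
      (by rw [hpat, hs 6 (by norm_num), hu1]; exact h1)
      (by rw [hpat, hs 7 (by norm_num), hu2]; exact h2)
    rw [hpat, hs 8 (by norm_num), hu] at this
    exact this
  | @acc X ht hqI hqF hX h1 =>
    obtain ⟨D, hD, hs, hpat, -, -, hu, -⟩ := exists_digits (Y := ∅) hm
      (hdig 0 0 0 0 0 1 0 0 0 (by omega) (by omega) (by omega) (by omega) (by omega)
        (by omega) (by omega) (by omega) (by omega)) hX (by simp) (by simp) (hsing hqI hqF) rfl
    have e5 : D 5 = 1 := hs 5 (by norm_num)
    have hq' : D S.stPos = S.qI ∧ D (S.stPos + 1) = S.qF := by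
      rw [e5] at hpat
      have := (List.cons.inj hpat).1
      simp only [mul_zero, add_zero, Prod.mk.injEq] at this
      exact this.2
    refine ⟨D, hD, ⟨by rw [hs 0 (by norm_num)]; exact ht, by omega, by simp [hpat, Linked]⟩, ?_⟩
    refine .acc e5 hq'.1 hq'.2 ?_
    rw [hpat, hu, Finset.union_empty]
    exact h1

end Sys

namespace RAM

open Ex

/-! ### The program -/

instance : Add Ex := ⟨.add⟩
instance : Sub Ex := ⟨.sub⟩
instance : Mul Ex := ⟨.mul⟩
instance (n : ℕ) : OfNat Ex n := ⟨.lit n⟩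

/-- Find the address of the thread with number `cnt`, and the number of its states. -/
def offLoop (cnt : Ex) : Cm := seqs [
  .set 30 (6 + var 1 * var 2 * var 2),
  .rep cnt (seqs [
    .set 31 (get (var 30)),
    -- The total number of thread states is a by-product; `setup` needs it to compute `B`.
    .set 49 (var 49 + var 31),
    .set 30 (var 30 + 3 + var 1 * var 31 * var 31)]),
  .set 31 (get (var 30))]

/-- The base of the digit with number `var 32`. -/
def setRad : Cm := seqs [
  .set 48 (var 2),
  -- A truncated difference serves as a comparison: it is nonzero iff the position lies before
  -- `stPos`. The next assignment overrides this one for the first nine digits.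
  cset 48 (var 10 - var 32) 3 (var 48),
  cset 48 (9 - var 32) (var 5) (var 48)]

/-- Read the parameters. -/
def setup : Cm := seqs [
  .set 1 (get 0), .set 2 (get 1), .set 3 (get 2), .set 4 (get 3),
  offLoop (var 3),
  .set 5 (var 1 + var 2 + var 3 + var 4 + var 4 + 10 + var 49),
  .set 6 (var 5 + 1),
  .set 7 (var 30),
  .set 10 (9 + var 3 + var 4 + var 4 + 2),
  .set 9 (var 10 + var 4 + var 4 + var 4 + var 4 + 4),
  .set 8 (var 7 + var 9),
  -- The number of rounds, `B ^ 4 + B`. The loop below multiplies it by all bases and so obtains the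
  -- number of iterations.
  .set 11 (var 5 * var 5 * var 5 * var 5 + var 5),
  .rep (var 9) (seqs [setRad, .set 11 (var 11 * var 48), .set 32 (var 32 + 1)])]

/-- Append a block to a code. -/
def push (x : ℕ) : Ex := (var x * var 6 + (var 34 + 1)) * var 6 + (var 35 + 1)

/-- Process one item of the pattern. -/
def patStep : Cm := seqs [
  .set 33 (get (var 7 + (9 + var 3 + var 32))),
  .set 34 (get (var 7 + (var 10 + (var 32 + var 32)))),
  .set 35 (get (var 7 + (var 10 + (var 32 + var 32) + 1))),
  -- The type is at most `2`, so `var 33 - 1` tests for type `2`. The sum of both truncated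
  -- differences is the distance of the two states, and the flag drops to `0` if they differ.
  cset 38 (var 33 - 1) (var 38 - (var 34 - var 37 + (var 37 - var 34))) (var 38),
  cset 49 (var 33 - 1) (1 - var 36) (var 33),
  -- Merging a linked item only changes the final state of the latest block. That state is the
  -- lowest digit of the code and equals `var 34`, so it is exchanged by one addition and one
  -- subtraction.
  cset 43 (var 33 - 1) (var 43 + var 35 - var 34) (push 43),
  cset 44 (var 33 - 1) (var 44) (var 44 + 1),
  -- This grows exactly when the owner passes from `1` back to `0`, that is, when the items are not
  -- in sequence.
  .set 39 (var 39 + (var 36 - var 49)),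
  .set 36 (var 49),
  cset 40 (var 32) (var 40) (var 36),
  cset 42 (var 36) (push 42) (var 42),
  cset 41 (var 36) (var 41) (push 41),
  .set 37 (var 35),
  .set 32 (var 32 + 1)]

def patLoop : Cm := seqs [.set 37 (var 2), .set 38 1, .rep (var 25) patStep]

/-- The code of a fact about a thread, given the code of its blocks. -/
def segCode (x : ℕ) (i p p' : Ex) : Ex :=
  (((var x * var 6 + (i + 1)) * var 6 + (p + 1)) * var 6 + (p' + 1)) * var 6 + 2

def derCode (x : ℕ) (w : Ex) : Ex := (var x * var 6 + (w + 1)) * var 6 + 3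

/-- Enter the fact with the given code if the expressions are nonzero. -/
def enter (es : List Ex) (e : Ex) : Cm := ifs es (.put (var 8 + e) 1)

/-- Look up the fact with the given code. -/
def look (e : Ex) : Ex := get (var 8 + e)

/-- The digits for thread states and operations range up to `B`. Without the three comparisons the
indices could leave the tables of the thread and of the memory. -/
def letterRule : Cm := enter [
  var 38, var 25, 2 - var 25, var 31 - var 21, var 31 - var 22, var 1 - var 24,
  get (var 30 + 3 + ((var 21 * var 1 + var 24) * var 31 + var 22)),
  get (6 + ((var 34 * var 1 + var 24) * var 2 + var 35))]
  (segCode 43 (var 20) (var 21) (var 22))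

def segRule : Cm := enter [
  var 38, 1 - var 39, look (segCode 41 (var 20) (var 21) (var 23)),
  look (segCode 42 (var 20) (var 23) (var 22))]
  (segCode 43 (var 20) (var 21) (var 22))

/-- Look up the fact for the rule for leaves. -/
def setLeaf : Cm := .set 45 (look (segCode 43 (var 20) (get (var 30 + 1)) (get (var 30 + 2))))

/-- Extend the codes by the color of a thread. -/
def colorStep : Cm := seqs [
  .set 33 (get (var 7 + (9 + var 32))),
  -- The bit `1 - (x - 1 + (1 - x))` is the indicator of `x = 1`, and the final `1` is the shift of
  -- digits in `code`. The following lines treat color `2` and nonzero colors in the same way.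
  .set 41 (var 41 * var 6 + (1 - (var 33 - 1 + (1 - var 33)) + 1)),
  .set 42 (var 42 * var 6 + (1 - (var 33 - 2 + (2 - var 33)) + 1)),
  .set 43 (var 43 * var 6 + (1 - (1 - var 33) + 1)),
  .set 47 (1 - (var 32 - var 20 + (var 20 - var 32))),
  .set 46 (var 46 - (var 33 - var 47 + (var 47 - var 33))),
  .set 32 (var 32 + 1)]

def colorLoop : Cm := seqs [.set 32 0, .set 46 1, .rep (var 3) colorStep]

def leafRule : Cm := enter [
  var 38, var 45, var 46, var 4 + var 28 + 1 - var 44, 2 - var 28] (derCode 43 (var 28))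

def joinRule : Cm := enter [
  var 38, look (derCode 41 (var 26)), look (derCode 42 (var 27)),
  var 4 + var 28 + 1 - var 44, 2 - var 28,
  -- A sum of truncated differences encodes the disjunction: the first child does not claim to wrap,
  -- or the pattern begins and ends with owner `0` and the result wraps.
  1 - var 26 + (1 - (var 40 + var 36 + (1 - var 28))),
  1 - var 27 + (1 - (1 - var 40 + (1 - var 36) + (1 - var 28)))] (derCode 43 (var 28))

def accRule : Cm := enter [
  var 38, var 25, 2 - var 25, 1 - (var 34 - get 4 + (get 4 - var 34)),
  1 - (var 35 - get 5 + (get 5 - var 35)), look (derCode 43 1)] 1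

def loadDigits : Cm := seqs [
  .set 20 (get (var 7 + 0)), .set 21 (get (var 7 + 1)), .set 22 (get (var 7 + 2)),
  .set 23 (get (var 7 + 3)), .set 24 (get (var 7 + 4)), .set 25 (get (var 7 + 5)),
  .set 26 (get (var 7 + 6)), .set 27 (get (var 7 + 7)), .set 28 (get (var 7 + 8))]

/-- Apply the rules described by the current digits. -/
def body : Cm := .seq loadDigits (ifs [var 3 - var 20, var 4 + var 4 + 3 - var 25] (seqs [
  offLoop (var 20), patLoop, letterRule, segRule, setLeaf, colorLoop, leafRule, joinRule,
  accRule]))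

def incStep : Cm := seqs [
  setRad,
  .set 33 (get (var 7 + var 32) + var 47),
  cset 49 (var 48 - var 33) (var 33) 0,
  cset 47 (var 48 - var 33) 0 1,
  .put (var 7 + var 32) (var 49),
  .set 32 (var 32 + 1)]

/-- Go to the next digits. -/
def increment : Cm := seqs [.set 47 1, .rep (var 9) incStep]

/-- Clear the work variables. -/
def clearWork : Cm := clear ((List.range 30).map (20 + ·))

def iteration : Cm := seqs [body, clearWork, increment, clearWork]

/-- Derivations only speak of nonempty words. The empty word is in the language iff the memory
starts in its final state, and its scheduling dimension is `0`. The address `1` is the code of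
`Fct.acc`. -/
def finish : Cm :=
  cset 0 (get 4 - get 5 + (get 5 - get 4)) (look 1) 1

def program : Cm := seqs [setup, clearWork, .rep (var 11) iteration, finish]

/-! ### Simplification of commands -/

def Store.upd (σ : Store) (x n : ℕ) : Store := { σ with v := Function.update σ.v x n }

section Simp

variable {W : ℕ} {σ : Store} {a b e : Ex}

@[simp] theorem Store.upd_v (x n y : ℕ) : (σ.upd x n).v y = if y = x then n else σ.v y := by
  simp [Store.upd, Function.update_apply]

@[simp] theorem Store.upd_m (x n : ℕ) : (σ.upd x n).m = σ.m := rfl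

@[simp] theorem eval_add : (a + b).eval σ = a.eval σ + b.eval σ := rfl

@[simp] theorem eval_sub : (a - b).eval σ = a.eval σ - b.eval σ := rfl

@[simp] theorem eval_mul : (a * b).eval σ = a.eval σ * b.eval σ := rfl

@[simp] theorem eval_ofNat (n : ℕ) [n.AtLeastTwo] : (no_index (OfNat.ofNat n) : Ex).eval σ = OfNat.ofNat n := rfl

@[simp] theorem eval_zero : (0 : Ex).eval σ = 0 := rfl

@[simp] theorem eval_one : (1 : Ex).eval σ = 1 := rfl

@[simp] theorem eval_var (x : ℕ) : (var x).eval σ = σ.v x := rfl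

@[simp] theorem eval_get : (get a).eval σ = σ.m (a.eval σ) := rfl

@[simp] theorem ok_add : (a + b).ok W σ ↔ a.ok W σ ∧ b.ok W σ := Iff.rfl

@[simp] theorem ok_sub : (a - b).ok W σ ↔ a.ok W σ ∧ b.ok W σ := Iff.rfl

@[simp] theorem ok_mul : (a * b).ok W σ ↔ a.ok W σ ∧ b.ok W σ ∧ b.eval σ ≤ W := Iff.rfl

@[simp] theorem ok_ofNat (n : ℕ) [n.AtLeastTwo] : (no_index (OfNat.ofNat n) : Ex).ok W σ ↔ True := Iff.rfl

@[simp] theorem ok_zero : (0 : Ex).ok W σ ↔ True := Iff.rfl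

@[simp] theorem ok_one : (1 : Ex).ok W σ ↔ True := Iff.rfl

@[simp] theorem ok_var (x : ℕ) : (var x).ok W σ ↔ True := Iff.rfl

@[simp] theorem ok_get : (get a).ok W σ ↔ a.ok W σ := Iff.rfl

@[simp] theorem sem_set (x : ℕ) : (Cm.set x e).sem σ = σ.upd x (e.eval σ) := rfl

@[simp] theorem sem_cset' (x : ℕ) : (cset x e a b).sem σ =
    σ.upd x (if e.eval σ ≠ 0 then a.eval σ else b.eval σ) := sem_cset x e a b σ

@[simp] theorem ok_set (x : ℕ) : (Cm.set x e).ok W σ ↔ e.ok W σ := Iff.rfl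

@[simp] theorem ok_cset' (x : ℕ) : (cset x e a b).ok W σ ↔
    e.ok W σ ∧ (e.eval σ ≠ 0 → a.ok W σ) ∧ (e.eval σ = 0 → b.ok W σ) := Iff.rfl

@[simp] theorem sem_seqs_nil : (seqs []).sem σ = σ := rfl

@[simp] theorem sem_seqs_cons (c : Cm) (cs : List Cm) : (seqs (c :: cs)).sem σ = (seqs cs).sem (c.sem σ) :=
  rfl

@[simp] theorem ok_seqs_nil : (seqs []).ok W σ ↔ True := Iff.rfl

@[simp] theorem ok_seqs_cons (c : Cm) (cs : List Cm) :
    (seqs (c :: cs)).ok W σ ↔ c.ok W σ ∧ (seqs cs).ok W (c.sem σ) := Iff.rfl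

theorem sem_put : (Cm.put a b).sem σ =
    { σ with m := Function.update σ.m (a.eval σ) (b.eval σ) } := rfl

@[simp] theorem ok_put : (Cm.put a b).ok W σ ↔ a.ok W σ ∧ b.ok W σ := Iff.rfl

end Simp

end RAM

/-! ### Inputs and tables in the memory -/

/-- The memory contents `w` describe `S`, in addresses below `off S.t`. -/
structure Input (S : Sys) (w off nn : ℕ → ℕ) : Prop where
  a : w 0 = S.a
  m : w 1 = S.m
  t : w 2 = S.t
  s : w 3 = S.s
  qI : w 4 = S.qI
  qF : w 5 = S.qF
  off_zero : off 0 = 6 + S.a * S.m * S.m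
  off_succ : ∀ i < S.t, off (i + 1) = off i + 3 + S.a * nn i * nn i
  count : ∀ i < S.t, w (off i) = nn i
  pI : ∀ i < S.t, w (off i + 1) = S.pI i
  pF : ∀ i < S.t, w (off i + 2) = S.pF i
  mem : ∀ q x r, S.Ms q x r ↔ q < S.m ∧ x < S.a ∧ r < S.m ∧ w (6 + ((q * S.a + x) * S.m + r)) ≠ 0
  thread : ∀ i p x p', S.As i p x p' ↔ i < S.t ∧ p < nn i ∧ x < S.a ∧ p' < nn i ∧
    w (off i + 3 + ((p * S.a + x) * nn i + p')) ≠ 0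
  B : S.B = S.a + S.m + S.t + 2 * S.s + 10 + ∑ i ∈ Finset.range S.t, nn i
  le : ∀ k, w k ≤ S.B
  zero : ∀ k, off S.t ≤ k → w k = 0
  qI_lt : S.qI < S.m
  qF_lt : S.qF < S.m

namespace Sys

variable (S : Sys)

/-- Facts that hold. -/
def Good (f : Fct) : Prop := S.Valid f ∧ S.Sem f

/-- The facts `T'` contain `T`, and are good if those in `T` are. -/
structure Sandwich (T T' : Fct → Prop) : Prop where
  sub : ∀ f, T f → T' f
  good : (∀ f, T f → S.Good f) → ∀ f, T' f → S.Good f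

variable {S}

theorem Sandwich.refl (T : Fct → Prop) : S.Sandwich T T := ⟨fun _ h => h, fun h => h⟩

theorem Sandwich.trans {T T' T'' : Fct → Prop} (h : S.Sandwich T T') (h' : S.Sandwich T' T'') :
    S.Sandwich T T'' :=
  ⟨fun f hf => h'.sub f (h.sub f hf), fun hT => h'.good (h.good hT)⟩

/-- The code of a fact. -/
def fcode (S : Sys) (f : Fct) : ℕ := code (S.B + 1) (f.key S.t)

end Sys

/-- The memory `μ` holds the input `w`, the digits `D`, and a table of the facts in `T`; `L` is the
length of the input. -/
structure Table (S : Sys) (w : ℕ → ℕ) (L : ℕ) (μ D : ℕ → ℕ) (T : Fct → Prop) : Prop where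
  inp : ∀ k < L, μ k = w k
  dig : ∀ j < S.numDigits, μ (L + j) = D j
  mem : ∀ f, S.Valid f → (μ (L + S.numDigits + S.fcode f) ≠ 0 ↔ T f)
  one : ∀ f, S.Valid f → μ (L + S.numDigits + S.fcode f) ≤ 1
  le : ∀ k, μ k ≤ S.B

/-- The table lies behind the input and the digits, and valid facts have different codes, so one
write adds one fact and disturbs nothing else. -/
theorem Table.insert {S : Sys} {w : ℕ → ℕ} {L : ℕ} {μ D : ℕ → ℕ} {T : Fct → Prop}
    (h : Table S w L μ D T) {f : Fct} (hf : S.Valid f) :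
    Table S w L (Function.update μ (L + S.numDigits + S.fcode f) 1) D fun g => T g ∨ g = f := by
  have hne : ∀ k < L + S.numDigits, k ≠ L + S.numDigits + S.fcode f := fun k hk => by omega
  have hB := S.hB
  refine ⟨fun k hk => ?_, fun j hj => ?_, fun g hg => ?_, fun g hg => ?_, fun k => ?_⟩
  · rw [Function.update_of_ne (hne k (by omega)), h.inp k hk]
  · rw [Function.update_of_ne (hne _ (by omega)), h.dig j hj]
  · by_cases e : g = f
    · simp [e]
    · rw [Function.update_of_ne, h.mem g hg]
      · simp [e]
      · intro e'
        refine e (Sys.key_injective hg hf (code_injective (Sys.key_lt hg) (Sys.key_lt hf) ?_))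
        simpa [Sys.fcode] using e'
  · rw [Function.update_apply]
    split_ifs
    exacts [le_rfl, h.one g hg]
  · rw [Function.update_apply]
    split_ifs
    exacts [by omega, h.le k]

theorem Input.off_add_lt {S : Sys} {w off nn : ℕ → ℕ} (h : Input S w off nn) {i : ℕ}
    (hi : i < S.t) : off i + 3 + S.a * nn i * nn i ≤ off S.t := by
  have key : ∀ k, i + 1 + k ≤ S.t → off (i + 1) ≤ off (i + 1 + k) := by
    intro k
    induction k with
    | zero => simp
    | succ k ih =>
      intro hk
      have := ih (by omega)
      have := h.off_succ (i + 1 + k) (by omega)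
      rw [← add_assoc]
      omega
  have := key (S.t - (i + 1)) (by omega)
  rw [show i + 1 + (S.t - (i + 1)) = S.t by omega] at this
  rw [← h.off_succ i hi]
  exact this

theorem Input.off_zero_le {S : Sys} {w off nn : ℕ → ℕ} (h : Input S w off nn) :
    off 0 ≤ off S.t := by
  rcases Nat.eq_zero_or_pos S.t with e | e
  · rw [e]
  · have key : ∀ k ≤ S.t, off 0 ≤ off k := by
      intro k
      induction k with
      | zero => simp
      | succ k ih =>
        intro hk
        have := ih (by omega)
        have := h.off_succ k (by omega)
        omega
    exact key _ le_rfl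

theorem index_lt {a m q x r : ℕ} {n : ℕ} (hq : q < n) (hx : x < a) (hr : r < m) :
    (q * a + x) * m + r < a * n * m := by
  calc (q * a + x) * m + r < (q * a + x) * m + m := by omega
    _ = (q * a + x + 1) * m := by ring
    _ ≤ (a * n) * m := Nat.mul_le_mul_right _ (by nlinarith)

theorem Input.nn_le {S : Sys} {w off nn : ℕ → ℕ} (h : Input S w off nn) {i : ℕ} (hi : i < S.t) :
    nn i ≤ S.B := h.count i hi ▸ h.le _

/-! ### Locating a thread in the input -/

namespace RAM

open Ex

variable {S : Sys} {w off nn : ℕ → ℕ}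

/-- The effect of `offLoop`. -/
theorem offLoop_spec (hI : Input S w off nn) {σ : Store} {cnt : Ex} {n : ℕ} (hn : n ≤ S.t)
    (hcn : cnt.eval (σ.upd 30 (off 0)) = n) (hc' : cnt.ok (5 * S.B) (σ.upd 30 (off 0)))
    (h1 : σ.v 1 = S.a) (h2 : σ.v 2 = S.m)
    (hm : ∀ k < off S.t, σ.m k = w k) :
    (offLoop cnt).ok (5 * S.B) σ ∧ ((offLoop cnt).sem σ).v 30 = off n ∧
      ((offLoop cnt).sem σ).v 31 = σ.m (off n) ∧
      ((offLoop cnt).sem σ).v 49 = σ.v 49 + ∑ i ∈ Finset.range n, nn i := by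
  have hB := S.hB
  have hmB := S.hmB
  set c := seqs [
    .set 31 (get (var 30)),
    .set 49 (var 49 + var 31),
    .set 30 (var 30 + 3 + var 1 * var 31 * var 31)] with hcdef
  set σ1 := σ.upd 30 (off 0) with hσ1
  have e1 : (Cm.set 30 (6 + var 1 * var 2 * var 2)).sem σ = σ1 := by
    simp [hσ1, h1, h2, hI.off_zero]
  have hk := rep_spec (W := 5 * S.B) (e := cnt) (c := c) (σ := σ1)
    (I := fun j τ => τ.m = σ.m ∧ τ.v 1 = S.a ∧ τ.v 30 = off j ∧
      τ.v 49 = σ.v 49 + ∑ i ∈ Finset.range j, nn i) hc' (by rw [hcn]; omega)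
    (by simp [hσ1, h1]) (by
      rw [hcn]
      rintro j hj τ ⟨i1, i2, i3, i4⟩
      have hj' : j < S.t := by omega
      have hlt := hI.off_add_lt hj'
      have e : σ.m (off j) = nn j := by rw [hm _ (by omega), hI.count j hj']
      have := hI.nn_le hj'
      refine ⟨?_, ?_, ?_, ?_, ?_⟩
      · simp [hcdef, i1, i2, i3, e]
        omega
      · simp [hcdef, i1]
      · simp [hcdef, i2]
      · simp [hcdef, i1, i2, i3, e, hI.off_succ j hj']
      · simp [hcdef, i1, i2, i3, i4, e, Finset.sum_range_succ, add_assoc])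
  rw [hcn] at hk
  obtain ⟨hok, i1, -, i3, i4⟩ := hk
  have e2 : (offLoop cnt).sem σ = (Cm.set 31 (get (var 30))).sem ((Cm.rep cnt c).sem σ1) := by
    rw [← e1]; rfl
  refine ⟨?_, ?_, ?_, ?_⟩
  · have : (Cm.set 30 (6 + var 1 * var 2 * var 2)).ok (5 * S.B) σ := by
      simp [h2]; omega
    refine ⟨this, ?_, ?_⟩
    · rw [e1]; exact hok
    · simp
  · rw [e2]; simp [i3]
  · rw [e2]; simp [i3, i1]
  · rw [e2]; simp [i4]

end RAM

theorem mg_joinPair_cons {it : ℕ × ℕ × ℕ} {l : List (ℕ × ℕ × ℕ)} (h : Linked linkPair (it :: l)) :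
    ∃ c cs, mg joinPair (it :: l) = (c, it.2.2) :: cs := by
  rw [mg]
  split_ifs with h2
  · obtain ⟨d, hd, -⟩ := h.1 h2
    cases l with
    | nil => simp at hd
    | cons d l =>
      obtain ⟨c, cs, e⟩ := mg_eq_cons (f := joinPair) h.2
      exact ⟨c.1, cs, by rw [e]; rfl⟩
  · exact ⟨it.2.1, _, rfl⟩

/-- The state reached by a pattern. -/
def lastState (m : ℕ) : List (ℕ × ℕ × ℕ) → ℕ
  | [] => m
  | it :: _ => it.2.2

/-- The value `m` for the empty pattern is not a state, so a first item of type `2` fails the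
comparison without a case distinction in the program. -/
theorem linked_cons_iff {m : ℕ} {it : ℕ × ℕ × ℕ} {l : List (ℕ × ℕ × ℕ)} (hm : it.2.1 < m) :
    Linked linkPair (it :: l) ↔
      (it.1 = 2 → it.2.1 = lastState m l) ∧ Linked linkPair l := by
  rw [Linked]
  refine and_congr_left fun _ => imp_congr_right fun _ => ?_
  cases l with
  | nil => simp [lastState]; omega
  | cons d l => simp [lastState, linkPair]

/-! ### Evaluation of a pattern -/

namespace RAM

open Ex

/-- The parameters are in place. -/
structure Config (S : Sys) (L : ℕ) (σ : Store) : Prop where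
  a : σ.v 1 = S.a
  m : σ.v 2 = S.m
  t : σ.v 3 = S.t
  s : σ.v 4 = S.s
  B : σ.v 5 = S.B
  C : σ.v 6 = S.B + 1
  digs : σ.v 7 = L
  tab : σ.v 8 = L + S.numDigits
  num : σ.v 9 = S.numDigits
  st : σ.v 10 = S.stPos

/-- The variables after the first items of the pattern. -/
structure PatState (S : Sys) (L : ℕ) (l : List (ℕ × ℕ × ℕ)) (z₁ z₂ z₃ : List ℕ) (σ : Store) :
    Prop where
  config : Config S L σ
  last : ∀ it ∈ l.head?, σ.v 34 = it.2.1 ∧ σ.v 35 = it.2.2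
  le : σ.v 38 ≤ 1
  linked : σ.v 38 ≠ 0 ↔ Linked linkPair l
  seq : σ.v 39 = 0 ↔ InSequence l
  own : σ.v 36 = own l
  first : σ.v 40 = firstOwn l
  acc₁ : σ.v 41 = code (S.B + 1) (z₁ ++ flat (pr 0 l))
  acc₂ : σ.v 42 = code (S.B + 1) (z₂ ++ flat (pr 1 l))
  acc₃ : Linked linkPair l → σ.v 43 = code (S.B + 1) (z₃ ++ flat (mg joinPair l))
  length : Linked linkPair l → σ.v 44 = (mg joinPair l).length

theorem config_of_notMem {S : Sys} {L : ℕ} {σ : Store} (h : Config S L σ) (c : Cm)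
    (hc : ∀ x ∈ c.writes, x = 0 ∨ 10 < x) : Config S L (c.sem σ) := by
  have key : ∀ x, x ≠ 0 → x ≤ 10 → (c.sem σ).v x = σ.v x := fun x h0 h10 =>
    c.sem_v_of_notMem (fun hx => by have := hc x hx; omega) σ
  constructor <;> (rw [key _ (by norm_num) (by norm_num)])
  exacts [h.a, h.m, h.t, h.s, h.B, h.C, h.digs, h.tab, h.num, h.st]

variable {S : Sys} {w off nn : ℕ → ℕ} {L : ℕ} {D : ℕ → ℕ} {T : Fct → Prop}

/-- The code and the number of the merged blocks are controlled for linked patterns only: otherwise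
exchanging the lowest digit gives a meaningless number, but the flag `var 38` then blocks every
rule. -/
theorem patStep_spec {j : ℕ} (hj : j < 2 * S.s + 2)
    (hD : ∀ j < S.numDigits, D j < S.rad j) {σ : Store}
    (hT : ∀ j < S.numDigits, σ.m (L + j) = D j)
    (h : PatState S L (S.pat D j) [] [] [] σ) (h32 : σ.v 32 = j)
    (h37 : σ.v 37 = lastState S.m (S.pat D j)) :
    patStep.ok (5 * S.B) σ ∧ PatState S L (S.pat D (j + 1)) [] [] [] (patStep.sem σ) ∧
      (patStep.sem σ).v 32 = j + 1 ∧
      (patStep.sem σ).v 37 = lastState S.m (S.pat D (j + 1)) := by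
  have hB := S.hB
  have hc := h.config
  have hst : S.stPos + (4 * S.s + 4) = S.numDigits := by simp only [Sys.numDigits]; omega
  have hst' : 9 + S.t + (2 * S.s + 2) = S.stPos := by simp only [Sys.stPos]; omega
  have r1 : σ.m (L + (9 + S.t + j)) = D (9 + S.t + j) := hT _ (by omega)
  have r2 : σ.m (L + (S.stPos + (j + j))) = D (S.stPos + 2 * j) := by
    rw [hT _ (by omega), two_mul]
  have r3 : σ.m (L + (S.stPos + (j + j) + 1)) = D (S.stPos + 2 * j + 1) := by
    rw [hT _ (by omega), two_mul]
  have hty := Sys.type_lt hD hj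
  have hq := Sys.state_lt hD (k := 2 * j) (by omega)
  set ty := D (9 + S.t + j) with hty'
  set q := D (S.stPos + 2 * j) with hq'
  set q' := D (S.stPos + 2 * j + 1) with hq''
  set l := S.pat D j with hl
  have el : S.pat D (j + 1) = (ty, q, q') :: l := rfl
  have hlen : l.length = j := Sys.length_pat j
  have hownle : own l ≤ 1 := own_le_one (Sys.validPat_pat hD (by omega)).type
  have hown : own ((ty, q, q') :: l) = if ty = 2 then 1 - own l else ty := rfl
  have hle1 : own ((ty, q, q') :: l) ≤ 1 := by rw [hown]; split_ifs <;> omega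
  have ety : ty - 1 = 0 ↔ ty ≠ 2 := by omega
  have hlk := linked_cons_iff (m := S.m) (it := (ty, q, q')) (l := l) hq
  have c34 : (patStep.sem σ).v 34 = q := by simp [patStep, hc.digs, hc.st, h32, r2]
  have c35 : (patStep.sem σ).v 35 = q' := by simp [patStep, hc.digs, hc.st, h32, r3]
  have c37 : (patStep.sem σ).v 37 = q' := by simp [patStep, hc.digs, hc.st, h32, r3]
  have c38 : (patStep.sem σ).v 38 =
      if ty = 2 then σ.v 38 - (q - lastState S.m l + (lastState S.m l - q)) else σ.v 38 := by
    simp [patStep, hc.digs, hc.st, hc.t, h32, r1, r2, h37, ety]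
  have c36 : (patStep.sem σ).v 36 = own ((ty, q, q') :: l) := by
    rw [hown]
    simp [patStep, hc.digs, hc.t, h32, r1, ety, h.own]
  have c39 : (patStep.sem σ).v 39 = σ.v 39 + (own l - own ((ty, q, q') :: l)) := by
    rw [hown]
    simp [patStep, hc.digs, hc.t, h32, r1, ety, h.own]
  have c40 : (patStep.sem σ).v 40 = if j = 0 then own ((ty, q, q') :: l) else σ.v 40 := by
    rw [hown]
    simp [patStep, hc.digs, hc.t, h32, r1, ety, h.own]
  have c41 : (patStep.sem σ).v 41 = if own ((ty, q, q') :: l) = 0 then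
      (σ.v 41 * (S.B + 1) + (q + 1)) * (S.B + 1) + (q' + 1) else σ.v 41 := by
    rw [hown]
    simp [patStep, push, hc.digs, hc.t, hc.st, hc.C, h32, r1, r2, r3, ety, h.own]
  have c42 : (patStep.sem σ).v 42 = if own ((ty, q, q') :: l) = 0 then σ.v 42 else
      (σ.v 42 * (S.B + 1) + (q + 1)) * (S.B + 1) + (q' + 1) := by
    rw [hown]
    simp [patStep, push, hc.digs, hc.t, hc.st, hc.C, h32, r1, r2, r3, ety, h.own]
  have c43 : (patStep.sem σ).v 43 = if ty = 2 then σ.v 43 + q' - q else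
      (σ.v 43 * (S.B + 1) + (q + 1)) * (S.B + 1) + (q' + 1) := by
    simp [patStep, push, hc.digs, hc.t, hc.st, hc.C, h32, r1, r2, r3, ety]
  have c44 : (patStep.sem σ).v 44 = if ty = 2 then σ.v 44 else σ.v 44 + 1 := by
    simp [patStep, hc.digs, hc.t, h32, r1, ety]
  refine ⟨?_, ⟨config_of_notMem hc _ (by decide), ?_, ?_, ?_, ?_, ?_, ?_, ?_, ?_, ?_, ?_⟩, ?_, ?_⟩
  · simp [patStep, push, hc.C]
    omega
  · rw [el]
    simp [c34, c35]
  · have := h.le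
    rw [c38]
    split_ifs <;> omega
  · have := h.le
    rw [el, hlk, c38, ← h.linked]
    simp only
    split_ifs with h2
    · simp only [h2, true_imp_iff]
      omega
    · simp [h2]
  · rw [el, c39, InSequence, ← h.seq]
    omega
  · rw [el, c36]
  · rw [el, c40, h.first, firstOwn, hlen]
  · rw [el, c41, h.acc₁, pr]
    split_ifs <;> simp [flat, code]
  · rw [el, c42, h.acc₂, pr]
    rcases Nat.le_one_iff_eq_zero_or_eq_one.1 hle1 with e | e <;> simp [e, flat, code]
  · rw [el]
    intro hlk'
    have hl' := (hlk.1 hlk').2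
    rw [c43, h.acc₃ hl', mg]
    split_ifs with h2
    -- By linkedness the lowest digit of the code so far is `q + 1`, so adding `q'` and subtracting
    -- `q` makes it `q' + 1`.
    · have hq := (hlk.1 hlk').1 h2
      obtain ⟨d, hd, -⟩ := hlk'.1 h2
      obtain ⟨e, l', e'⟩ : ∃ e l', l = e :: l' := by
        cases hl'' : l with
        | nil => simp [hl''] at hd
        | cons e l' => exact ⟨e, l', rfl⟩
      rw [e'] at hq hl' ⊢
      obtain ⟨c, cs, hc⟩ := mg_joinPair_cons hl'
      simp only [lastState] at hq
      rw [hc, ← hq]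
      simp [flat, code, joinPair]
      omega
    · simp [flat, code]
  · rw [el]
    intro hlk'
    have hl' := (hlk.1 hlk').2
    rw [c44, h.length hl', mg]
    split_ifs <;> simp
  · simp [patStep, h32]
  · rw [c37]; rfl

theorem patLoop_spec (hD : ∀ j < S.numDigits, D j < S.rad j) {σ : Store}
    (hT : ∀ j < S.numDigits, σ.m (L + j) = D j) (hc : Config S L σ) (h25 : σ.v 25 = D 5)
    (h5 : D 5 ≤ 2 * S.s + 2)
    (h0 : ∀ x ∈ [32, 36, 39, 40, 41, 42, 43, 44], σ.v x = 0) :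
    patLoop.ok (5 * S.B) σ ∧ PatState S L (S.pat D (D 5)) [] [] [] (patLoop.sem σ) := by
  have hB := S.hB
  simp only [List.mem_cons, List.not_mem_nil, or_false, forall_eq_or_imp, forall_eq] at h0
  obtain ⟨z1, z2, z3, z4, z5, z6, z7, z8⟩ := h0
  set σ1 := (σ.upd 37 S.m).upd 38 1 with hσ1
  have e1 : (Cm.set 38 1).sem ((Cm.set 37 (var 2)).sem σ) = σ1 := by simp [hσ1, hc.m]
  have hc1 : Config S L σ1 := by
    rw [← e1]
    exact config_of_notMem (config_of_notMem hc _ (by decide)) _ (by decide)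
  have he : (var 25).eval σ1 = D 5 := by simp [hσ1, h25]
  have hk := rep_spec (W := 5 * S.B) (e := var 25) (c := patStep) (σ := σ1)
    (I := fun j τ => τ.m = σ.m ∧ PatState S L (S.pat D j) [] [] [] τ ∧ τ.v 32 = j ∧
      τ.v 37 = lastState S.m (S.pat D j)) (by simp) (by rw [he]; omega)
    ⟨rfl, ⟨hc1, by simp [Sys.pat], by simp [hσ1], by simp [hσ1, Sys.pat, Linked],
      by simp [hσ1, Sys.pat, InSequence, z3], by simp [hσ1, Sys.pat, own, z2],
      by simp [hσ1, Sys.pat, firstOwn, z4], by simp [hσ1, Sys.pat, pr, z5, code, flat],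
      by simp [hσ1, Sys.pat, pr, z6, code, flat], by simp [hσ1, Sys.pat, mg, z7, code, flat],
      by simp [hσ1, Sys.pat, mg, z8]⟩, by simp [hσ1, z1], by simp [hσ1, Sys.pat, lastState]⟩ (by
      rw [he]
      rintro j hj τ ⟨i1, i2, i3, i4⟩
      obtain ⟨k1, k2, k3, k4⟩ := patStep_spec (by omega) hD (by rwa [i1]) i2 i3 i4
      exact ⟨k1, by rw [Cm.sem_m _ (by decide), i1], k2, k3, k4⟩)
  rw [he] at hk
  have e2 : patLoop.sem σ = (Cm.rep (var 25) patStep).sem σ1 := by rw [← e1]; rfl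
  refine ⟨⟨trivial, trivial, ?_, trivial⟩, ?_⟩
  · rw [e1]; exact hk.1
  · rw [e2]; exact hk.2.2.1

end RAM

theorem mem_pr {β : Type*} {o : ℕ} {l : List (ℕ × β)} {b : β} (h : b ∈ pr o l) :
    ∃ it ∈ l, it.2 = b := by
  induction l with
  | nil => simp [pr] at h
  | cons it l ih =>
    rw [pr] at h
    split_ifs at h
    · rcases List.mem_cons.1 h with rfl | h
      · exact ⟨it, by simp, rfl⟩
      · obtain ⟨x, hx, e⟩ := ih h
        exact ⟨x, List.mem_cons_of_mem _ hx, e⟩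
    · obtain ⟨x, hx, e⟩ := ih h
      exact ⟨x, List.mem_cons_of_mem _ hx, e⟩

theorem Sys.ValidPat.pr_lt {S : Sys} {l : List (ℕ × ℕ × ℕ)} (h : S.ValidPat l) (o : ℕ) :
    ∀ b ∈ pr o l, b.1 < S.m ∧ b.2 < S.m := by
  intro b hb
  obtain ⟨it, hit, rfl⟩ := mem_pr hb
  exact h.lt it hit

theorem firstOwn_le_one {β : Type*} {l : List (ℕ × β)} (h : ∀ it ∈ l, it.1 ≤ 2) :
    firstOwn l ≤ 1 := by
  induction l with
  | nil => simp [firstOwn]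
  | cons it l ih =>
    rw [firstOwn]
    split_ifs
    exacts [own_le_one h, ih fun x hx => h x (List.mem_cons_of_mem _ hx)]

/-! ### Correctness of the rule commands -/

namespace RAM

open Ex

/-- The variables before the application of a rule. -/
structure Ready (S : Sys) (L : ℕ) (D off nn : ℕ → ℕ) (z₁ z₂ z₃ : List ℕ) (σ : Store) : Prop
    extends PatState S L (S.pat D (D 5)) z₁ z₂ z₃ σ where
  d : ∀ k < 9, σ.v (20 + k) = D k
  addr : σ.v 30 = off (D 0)
  count : σ.v 31 = nn (D 0)

variable {S : Sys} {w off nn : ℕ → ℕ} {L : ℕ} {D : ℕ → ℕ} {T : Fct → Prop} {σ : Store}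
  {z₁ z₂ z₃ : List ℕ}

theorem Ready.of_v {σ' : Store} (h : Ready S L D off nn z₁ z₂ z₃ σ) (e : σ'.v = σ.v) :
    Ready S L D off nn z₁ z₂ z₃ σ' := by
  obtain ⟨v, m⟩ := σ
  obtain ⟨v', m'⟩ := σ'
  obtain rfl : v' = v := e
  obtain ⟨⟨⟨c1, c2, c3, c4, c5, c6, c7, c8, c9, c10⟩, h2, h3, h4, h5, h6, h7, h8, h9, h10, h11⟩,
    h12, h13, h14⟩ := h
  exact ⟨⟨⟨c1, c2, c3, c4, c5, c6, c7, c8, c9, c10⟩, h2, h3, h4, h5, h6, h7, h8, h9, h10, h11⟩,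
    h12, h13, h14⟩

/-- The effect of a rule. -/
structure RuleSpec (S : Sys) (w : ℕ → ℕ) (L : ℕ) (D : ℕ → ℕ) (T : Fct → Prop) (σ : Store) (c : Cm)
    (P : (Fct → Prop) → Prop) : Prop where
  ok : c.ok (5 * S.B) σ
  v : (c.sem σ).v = σ.v
  table : ∃ T', Table S w L (c.sem σ).m D T' ∧ S.Sandwich T T' ∧ P T'

/-- Only a legitimate step may pass the guards, which keeps the table sound; conversely the fact is
present afterwards whenever the guards hold, which gives completeness. -/
theorem enter_spec (hT : Table S w L σ.m D T) (h8 : σ.v 8 = L + S.numDigits) {es : List Ex}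
    {a : Ex} {f : Fct} (hes : ∀ e ∈ es, e.ok (5 * S.B) σ) (ha : a.ok (5 * S.B) σ)
    (hstep : (∀ e ∈ es, e.eval σ ≠ 0) → S.Step T f ∧ a.eval σ = S.fcode f) :
    RuleSpec S w L D T σ (enter es a) fun T' => (∀ e ∈ es, e.eval σ ≠ 0) → T' f := by
  obtain ⟨s1, s2⟩ := sem_ifs es (.put (var 8 + a) 1) σ
  have hok : (enter es a).ok (5 * S.B) σ := ok_ifs hes fun _ => ⟨⟨trivial, ha⟩, trivial⟩
  by_cases h : ∀ e ∈ es, e.eval σ ≠ 0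
  · obtain ⟨hs, e⟩ := hstep h
    have e1 : (enter es a).sem σ =
        ⟨σ.v, Function.update σ.m (L + S.numDigits + S.fcode f) 1⟩ := by
      rw [enter, s1 h, sem_put, eval_add, eval_var, h8, e]; rfl
    refine ⟨hok, by rw [e1], fun g => T g ∨ g = f, by rw [e1]; exact hT.insert hs.valid,
      ⟨fun g hg => Or.inl hg, ?_⟩, fun _ => Or.inr rfl⟩
    rintro hg g (hg' | rfl)
    · exact hg g hg'
    · exact ⟨hs.valid, hs.sem fun f hf => (hg f hf).2⟩
  · have e1 : (enter es a).sem σ = σ := s2 h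
    exact ⟨hok, by rw [e1], T, by rwa [e1], .refl T, fun h' => absurd h' h⟩

theorem look_eval (hT : Table S w L σ.m D T) (h8 : σ.v 8 = L + S.numDigits) {a : Ex} {f : Fct}
    (hf : S.Valid f) (ha : a.eval σ = S.fcode f) : (look a).eval σ ≠ 0 ↔ T f := by
  rw [← hT.mem f hf]
  simp [look, h8, ha]

theorem eval_segCode {x : ℕ} {i p p' : Ex} {l : List (ℕ × ℕ)} (h6 : σ.v 6 = S.B + 1)
    (hx : σ.v x = code (S.B + 1) (flat l)) :
    (segCode x i p p').eval σ = S.fcode (.seg (i.eval σ) (p.eval σ) (p'.eval σ) l) := by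
  simp [segCode, Sys.fcode, Fct.key, code, h6, hx]

theorem eval_derCode {x : ℕ} {w : Ex} {X : Finset ℕ} {l : List (ℕ × ℕ)} (h6 : σ.v 6 = S.B + 1)
    (hx : σ.v x = code (S.B + 1) (bits S.t X ++ flat l)) :
    (derCode x w).eval σ = S.fcode (.der X (w.eval σ) l) := by
  simp [derCode, Sys.fcode, Fct.key, code, h6, hx]

theorem ok_segCode {x : ℕ} {i p p' : Ex} (h6 : σ.v 6 = S.B + 1) (hi : i.ok (5 * S.B) σ)
    (hp : p.ok (5 * S.B) σ) (hp' : p'.ok (5 * S.B) σ) : (segCode x i p p').ok (5 * S.B) σ := by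
  have := S.hB
  simp [segCode, h6, hi, hp, hp']
  omega

theorem ok_derCode {x : ℕ} {w : Ex} (h6 : σ.v 6 = S.B + 1) (hw : w.ok (5 * S.B) σ) :
    (derCode x w).ok (5 * S.B) σ := by
  have := S.hB
  simp [derCode, h6, hw]
  omega

section Rules

variable (hI : Input S w off nn) (hD : ∀ j < S.numDigits, D j < S.rad j)
  (ht : D 0 < S.t) (h5 : D 5 ≤ 2 * S.s + 2) (hT : Table S w (off S.t) σ.m D T)

include hI hD ht h5 hT

theorem letterRule_spec (h : Ready S (off S.t) D off nn [] [] [] σ) :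
    RuleSpec S w (off S.t) D T σ letterRule fun T' => Linked linkPair (S.pat D (D 5)) → D 5 = 1 →
      S.As (D 0) (D 1) (D 4) (D 2) → S.Ms (D S.stPos) (D 4) (D (S.stPos + 1)) →
      T' (.seg (D 0) (D 1) (D 2) (mg joinPair (S.pat D (D 5)))) := by
  have hB := S.hB
  have hmB := S.hmB
  have hc := h.config
  have d0 : σ.v 20 = D 0 := h.d 0 (by norm_num)
  have d1 : σ.v 21 = D 1 := h.d 1 (by norm_num)
  have d2 : σ.v 22 = D 2 := h.d 2 (by norm_num)
  have d4 : σ.v 24 = D 4 := h.d 4 (by norm_num)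
  have d5 : σ.v 25 = D 5 := h.d 5 (by norm_num)
  have hnn := hI.nn_le ht
  have hab : S.a ≤ S.B := hI.a ▸ hI.le 0
  have h34 : D 5 = 1 → σ.v 34 = D S.stPos ∧ σ.v 35 = D (S.stPos + 1) := fun e => by
    simpa [e, Sys.pat] using h.last
  have hq := Sys.state_lt hD (k := 0) (by omega)
  have hq' := Sys.state_lt hD (k := 1) (by omega)
  have rA : D 1 < nn (D 0) → D 4 < S.a → D 2 < nn (D 0) →
      (σ.m (off (D 0) + 3 + ((D 1 * S.a + D 4) * nn (D 0) + D 2)) ≠ 0 ↔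
      S.As (D 0) (D 1) (D 4) (D 2)) := by
    intro h1 h2 h3
    have := index_lt h1 h2 h3
    have := hI.off_add_lt ht
    rw [hT.inp _ (by omega), hI.thread]
    simp [ht, h1, h2, h3]
  have rM : D 4 < S.a → (σ.m (6 + ((D S.stPos * S.a + D 4) * S.m + D (S.stPos + 1))) ≠ 0 ↔
      S.Ms (D S.stPos) (D 4) (D (S.stPos + 1))) := by
    intro h1
    have := index_lt hq h1 hq'
    have := hI.off_zero_le
    have := hI.off_zero
    rw [hT.inp _ (by simp at *; omega), hI.mem]
    simp [h1, hq']
    simpa using fun _ => hq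
  have hiff : (∀ e ∈ [var 38, var 25, 2 - var 25, var 31 - var 21, var 31 - var 22, var 1 - var 24,
      get (var 30 + 3 + ((var 21 * var 1 + var 24) * var 31 + var 22)),
      get (6 + ((var 34 * var 1 + var 24) * var 2 + var 35))], e.eval σ ≠ 0) ↔
      Linked linkPair (S.pat D (D 5)) ∧ D 5 = 1 ∧ S.As (D 0) (D 1) (D 4) (D 2) ∧
      S.Ms (D S.stPos) (D 4) (D (S.stPos + 1)) := by
    simp only [List.mem_cons, List.not_mem_nil, or_false, forall_eq_or_imp, forall_eq, eval_var,
      eval_sub, eval_add, eval_mul, eval_get, eval_ofNat, h.linked, d1, d2, d4, d5, h.addr,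
      h.count, hc.a, hc.m]
    constructor
    · rintro ⟨k1, k2, k3, k4, k5, k6, k7, k8⟩
      have e5 : D 5 = 1 := by omega
      rw [(h34 e5).1, (h34 e5).2] at k8
      exact ⟨k1, e5, (rA (by omega) (by omega) (by omega)).1 k7, (rM (by omega)).1 k8⟩
    · rintro ⟨k1, k2, k3, k4⟩
      obtain ⟨-, l1, l2, l3, -⟩ := (hI.thread _ _ _ _).1 k3
      rw [(h34 k2).1, (h34 k2).2]
      exact ⟨k1, by omega, by omega, by omega, by omega, by omega, (rA l1 l2 l3).2 k3,
        (rM l2).2 k4⟩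
  obtain ⟨r1, r2, T', r3, r4, r5⟩ := enter_spec (f := .seg (D 0) (D 1) (D 2)
    (mg joinPair (S.pat D (D 5)))) hT hc.tab (es := [var 38, var 25, 2 - var 25, var 31 - var 21,
      var 31 - var 22, var 1 - var 24,
      get (var 30 + 3 + ((var 21 * var 1 + var 24) * var 31 + var 22)),
      get (6 + ((var 34 * var 1 + var 24) * var 2 + var 35))])
    (a := segCode 43 (var 20) (var 21) (var 22))
    (by simp [hc.a, hc.m, h.count]; omega) (ok_segCode hc.C trivial trivial trivial) (by
      rw [hiff]
      rintro ⟨k1, k2, k3, k4⟩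
      exact ⟨(Sys.Fire.letter k2 k3 k4).step hD ⟨ht, h5, k1⟩ hI.qI_lt hI.qF_lt,
        by rw [eval_segCode hc.C (h.acc₃ k1)]; simp [d0, d1, d2]⟩)
  exact ⟨r1, r2, T', r3, r4, fun k1 k2 k3 k4 => r5 (hiff.2 ⟨k1, k2, k3, k4⟩)⟩

theorem segRule_spec (h : Ready S (off S.t) D off nn [] [] [] σ) :
    RuleSpec S w (off S.t) D T σ segRule fun T' => Linked linkPair (S.pat D (D 5)) →
      InSequence (S.pat D (D 5)) → T (.seg (D 0) (D 1) (D 3) (pr 0 (S.pat D (D 5)))) →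
      T (.seg (D 0) (D 3) (D 2) (pr 1 (S.pat D (D 5)))) →
      T' (.seg (D 0) (D 1) (D 2) (mg joinPair (S.pat D (D 5)))) := by
  have hc := h.config
  have d0 : σ.v 20 = D 0 := h.d 0 (by norm_num)
  have d1 : σ.v 21 = D 1 := h.d 1 (by norm_num)
  have d2 : σ.v 22 = D 2 := h.d 2 (by norm_num)
  have d3 : σ.v 23 = D 3 := h.d 3 (by norm_num)
  have hv := Sys.validPat_pat hD h5
  have b : ∀ k < 9, D k < S.B := fun k hk => Sys.small_lt hD hk
  have l1 : (look (segCode 41 (var 20) (var 21) (var 23))).eval σ ≠ 0 ↔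
      T (.seg (D 0) (D 1) (D 3) (pr 0 (S.pat D (D 5)))) :=
    look_eval hT hc.tab ⟨ht, b 1 (by norm_num), b 3 (by norm_num), hv.pr_lt 0⟩
      (by rw [eval_segCode hc.C h.acc₁]; simp [d0, d1, d3])
  have l2 : (look (segCode 42 (var 20) (var 23) (var 22))).eval σ ≠ 0 ↔
      T (.seg (D 0) (D 3) (D 2) (pr 1 (S.pat D (D 5)))) :=
    look_eval hT hc.tab ⟨ht, b 3 (by norm_num), b 2 (by norm_num), hv.pr_lt 1⟩
      (by rw [eval_segCode hc.C h.acc₂]; simp [d0, d2, d3])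
  have hiff : (∀ e ∈ [var 38, 1 - var 39, look (segCode 41 (var 20) (var 21) (var 23)),
      look (segCode 42 (var 20) (var 23) (var 22))], e.eval σ ≠ 0) ↔
      Linked linkPair (S.pat D (D 5)) ∧ InSequence (S.pat D (D 5)) ∧
      T (.seg (D 0) (D 1) (D 3) (pr 0 (S.pat D (D 5)))) ∧
      T (.seg (D 0) (D 3) (D 2) (pr 1 (S.pat D (D 5)))) := by
    simp only [List.mem_cons, List.not_mem_nil, or_false, forall_eq_or_imp, forall_eq, eval_var,
      eval_sub, eval_one, h.linked, l1, l2, ← h.seq]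
    exact and_congr_right fun _ => and_congr_left fun _ => by omega
  obtain ⟨r1, r2, T', r3, r4, r5⟩ := enter_spec (f := .seg (D 0) (D 1) (D 2)
    (mg joinPair (S.pat D (D 5)))) hT hc.tab (es := [var 38, 1 - var 39,
      look (segCode 41 (var 20) (var 21) (var 23)), look (segCode 42 (var 20) (var 23) (var 22))])
    (a := segCode 43 (var 20) (var 21) (var 22))
    (by simp [look, ok_segCode hc.C]) (ok_segCode hc.C trivial trivial trivial) (by
      rw [hiff]
      rintro ⟨k1, k2, k3, k4⟩
      exact ⟨(Sys.Fire.segJoin k2 k3 k4).step hD ⟨ht, h5, k1⟩ hI.qI_lt hI.qF_lt,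
        by rw [eval_segCode hc.C (h.acc₃ k1)]; simp [d0, d1, d2]⟩)
  exact ⟨r1, r2, T', r3, r4, fun k1 k2 k3 k4 => r5 (hiff.2 ⟨k1, k2, k3, k4⟩)⟩

theorem setLeaf_spec (h : Ready S (off S.t) D off nn [] [] [] σ)
    (hl : Linked linkPair (S.pat D (D 5))) :
    (setLeaf.sem σ).v 45 ≠ 0 ↔
      T (.seg (D 0) (S.pI (D 0)) (S.pF (D 0)) (mg joinPair (S.pat D (D 5)))) := by
  have hc := h.config
  have d0 : σ.v 20 = D 0 := h.d 0 (by norm_num)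
  have hv := Sys.validPat_pat hD h5
  have hlt := hI.off_add_lt ht
  have e1 : σ.m (off (D 0) + 1) = S.pI (D 0) := by rw [hT.inp _ (by omega), hI.pI _ ht]
  have e2 : σ.m (off (D 0) + 2) = S.pF (D 0) := by rw [hT.inp _ (by omega), hI.pF _ ht]
  have : (setLeaf.sem σ).v 45 =
      (look (segCode 43 (var 20) (get (var 30 + 1)) (get (var 30 + 2)))).eval σ := by
    simp [setLeaf]
  rw [this]
  exact look_eval hT hc.tab ⟨ht, S.hpI _ ht, S.hpF _ ht, Sys.mem_mg_lt hv.lt⟩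
    (by rw [eval_segCode hc.C (h.acc₃ hl)]; simp [d0, h.addr, e1, e2])

/-- The premise of this rule is looked up before the color loop, which extends `var 43` by the
colors and thereby destroys the code of the segment. The proposition `P` stands for the result of
that earlier look-up. -/
theorem leafRule_spec (h : Ready S (off S.t) D off nn (bits S.t (S.cols D 1))
    (bits S.t (S.cols D 2)) (bits S.t (S.colored D)) σ) {P : Prop}
    (hP : P → T (.seg (D 0) (S.pI (D 0)) (S.pF (D 0)) (mg joinPair (S.pat D (D 5)))))
    (h45 : Linked linkPair (S.pat D (D 5)) → (σ.v 45 ≠ 0 ↔ P))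
    (h46 : σ.v 46 ≠ 0 ↔ ∀ k < S.t, D (9 + k) = if k = D 0 then 1 else 0) :
    RuleSpec S w (off S.t) D T σ leafRule fun T' => Linked linkPair (S.pat D (D 5)) →
      (∀ k < S.t, D (9 + k) = if k = D 0 then 1 else 0) → D 8 ≤ 1 →
      (mg joinPair (S.pat D (D 5))).length ≤ S.s + D 8 → P →
      T' (.der (S.colored D) (D 8) (mg joinPair (S.pat D (D 5)))) := by
  have hc := h.config
  have d8 : σ.v 28 = D 8 := h.d 8 (by norm_num)
  have hiff : (∀ e ∈ [var 38, var 45, var 46, var 4 + var 28 + 1 - var 44, 2 - var 28],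
      e.eval σ ≠ 0) ↔
      Linked linkPair (S.pat D (D 5)) ∧ (∀ k < S.t, D (9 + k) = if k = D 0 then 1 else 0) ∧
      D 8 ≤ 1 ∧ (mg joinPair (S.pat D (D 5))).length ≤ S.s + D 8 ∧ P := by
    simp only [List.mem_cons, List.not_mem_nil, or_false, forall_eq_or_imp, forall_eq, eval_var,
      eval_sub, eval_add, eval_one, eval_ofNat, h.linked, h46, hc.s, d8]
    refine and_congr_right fun hl => ?_
    rw [h45 hl, h.length hl]
    constructor
    · rintro ⟨k1, k2, k3, k4⟩
      exact ⟨k2, by omega, by omega, k1⟩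
    · rintro ⟨k1, k2, k3, k4⟩
      exact ⟨k4, k1, by omega, by omega⟩
  obtain ⟨r1, r2, T', r3, r4, r5⟩ := enter_spec (f := .der (S.colored D) (D 8)
    (mg joinPair (S.pat D (D 5)))) hT hc.tab (es := [var 38, var 45, var 46,
      var 4 + var 28 + 1 - var 44, 2 - var 28]) (a := derCode 43 (var 28))
    (by simp) (ok_derCode hc.C trivial) (by
      rw [hiff]
      rintro ⟨k1, k2, k3, k4, k5⟩
      exact ⟨(Sys.Fire.leaf k2 k3 k4 (hP k5)).step hD ⟨ht, h5, k1⟩ hI.qI_lt hI.qF_lt,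
        by rw [eval_derCode hc.C (h.acc₃ k1)]; simp [d8]⟩)
  exact ⟨r1, r2, T', r3, r4, fun k1 k2 k3 k4 k5 => r5 (hiff.2 ⟨k1, k2, k3, k4, k5⟩)⟩

theorem joinRule_spec (h : Ready S (off S.t) D off nn (bits S.t (S.cols D 1))
    (bits S.t (S.cols D 2)) (bits S.t (S.colored D)) σ) :
    RuleSpec S w (off S.t) D T σ joinRule fun T' => Linked linkPair (S.pat D (D 5)) →
      D 8 ≤ 1 → (mg joinPair (S.pat D (D 5))).length ≤ S.s + D 8 →
      (D 6 = 0 ∨ firstOwn (S.pat D (D 5)) = 0 ∧ own (S.pat D (D 5)) = 0 ∧ D 8 = 1) →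
      (D 7 = 0 ∨ firstOwn (S.pat D (D 5)) = 1 ∧ own (S.pat D (D 5)) = 1 ∧ D 8 = 1) →
      T (.der (S.cols D 1) (D 6) (pr 0 (S.pat D (D 5)))) →
      T (.der (S.cols D 2) (D 7) (pr 1 (S.pat D (D 5)))) →
      T' (.der (S.colored D) (D 8) (mg joinPair (S.pat D (D 5)))) := by
  have hc := h.config
  have d6 : σ.v 26 = D 6 := h.d 6 (by norm_num)
  have d7 : σ.v 27 = D 7 := h.d 7 (by norm_num)
  have d8 : σ.v 28 = D 8 := h.d 8 (by norm_num)
  have hv := Sys.validPat_pat hD h5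
  have b : ∀ k < 9, D k < S.B := fun k hk => Sys.small_lt hD hk
  have l1 : (look (derCode 41 (var 26))).eval σ ≠ 0 ↔
      T (.der (S.cols D 1) (D 6) (pr 0 (S.pat D (D 5)))) :=
    look_eval hT hc.tab ⟨Finset.filter_subset _ _, b 6 (by norm_num), hv.pr_lt 0⟩
      (by rw [eval_derCode hc.C h.acc₁]; simp [d6])
  have l2 : (look (derCode 42 (var 27))).eval σ ≠ 0 ↔
      T (.der (S.cols D 2) (D 7) (pr 1 (S.pat D (D 5)))) :=
    look_eval hT hc.tab ⟨Finset.filter_subset _ _, b 7 (by norm_num), hv.pr_lt 1⟩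
      (by rw [eval_derCode hc.C h.acc₂]; simp [d7])
  have ho := own_le_one hv.type
  have hf : firstOwn (S.pat D (D 5)) ≤ 1 := firstOwn_le_one hv.type
  have hiff : (∀ e ∈ [var 38, look (derCode 41 (var 26)), look (derCode 42 (var 27)),
      var 4 + var 28 + 1 - var 44, 2 - var 28,
      1 - var 26 + (1 - (var 40 + var 36 + (1 - var 28))),
      1 - var 27 + (1 - (1 - var 40 + (1 - var 36) + (1 - var 28)))], e.eval σ ≠ 0) ↔
      Linked linkPair (S.pat D (D 5)) ∧
      D 8 ≤ 1 ∧ (mg joinPair (S.pat D (D 5))).length ≤ S.s + D 8 ∧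
      (D 6 = 0 ∨ firstOwn (S.pat D (D 5)) = 0 ∧ own (S.pat D (D 5)) = 0 ∧ D 8 = 1) ∧
      (D 7 = 0 ∨ firstOwn (S.pat D (D 5)) = 1 ∧ own (S.pat D (D 5)) = 1 ∧ D 8 = 1) ∧
      T (.der (S.cols D 1) (D 6) (pr 0 (S.pat D (D 5)))) ∧
      T (.der (S.cols D 2) (D 7) (pr 1 (S.pat D (D 5)))) := by
    simp only [List.mem_cons, List.not_mem_nil, or_false, forall_eq_or_imp, forall_eq, eval_var,
      eval_sub, eval_add, eval_one, eval_ofNat, h.linked, hc.s, d6, d7, d8, l1, l2, h.own, h.first]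
    refine and_congr_right fun hl => ?_
    rw [h.length hl]
    constructor
    · rintro ⟨k1, k2, k3, k4, k5, k6⟩
      exact ⟨by omega, by omega, by omega, by omega, k1, k2⟩
    · rintro ⟨k1, k2, k3, k4, k5, k6⟩
      exact ⟨k5, k6, by omega, by omega, by omega, by omega⟩
  obtain ⟨r1, r2, T', r3, r4, r5⟩ := enter_spec (f := .der (S.colored D) (D 8)
    (mg joinPair (S.pat D (D 5)))) hT hc.tab (es := [var 38, look (derCode 41 (var 26)),
      look (derCode 42 (var 27)), var 4 + var 28 + 1 - var 44, 2 - var 28,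
      1 - var 26 + (1 - (var 40 + var 36 + (1 - var 28))),
      1 - var 27 + (1 - (1 - var 40 + (1 - var 36) + (1 - var 28)))]) (a := derCode 43 (var 28))
    (by simp [look, ok_derCode hc.C]) (ok_derCode hc.C trivial) (by
      rw [hiff]
      rintro ⟨k1, k2, k3, k4, k5, k6, k7⟩
      exact ⟨(Sys.Fire.join k2 k3 k4 k5 k6 k7).step hD ⟨ht, h5, k1⟩ hI.qI_lt hI.qF_lt,
        by rw [eval_derCode hc.C (h.acc₃ k1)]; simp [d8]⟩)
  exact ⟨r1, r2, T', r3, r4, fun k1 k2 k3 k4 k5 k6 k7 => r5 (hiff.2 ⟨k1, k2, k3, k4, k5, k6, k7⟩)⟩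

theorem accRule_spec (h : Ready S (off S.t) D off nn (bits S.t (S.cols D 1))
    (bits S.t (S.cols D 2)) (bits S.t (S.colored D)) σ) :
    RuleSpec S w (off S.t) D T σ accRule fun T' => Linked linkPair (S.pat D (D 5)) →
      D 5 = 1 → D S.stPos = S.qI → D (S.stPos + 1) = S.qF →
      T (.der (S.colored D) 1 (mg joinPair (S.pat D (D 5)))) → T' .acc := by
  have hB := S.hB
  have hc := h.config
  have d5 : σ.v 25 = D 5 := h.d 5 (by norm_num)
  have hv := Sys.validPat_pat hD h5
  have h34 : D 5 = 1 → σ.v 34 = D S.stPos ∧ σ.v 35 = D (S.stPos + 1) := fun e => by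
    simpa [e, Sys.pat] using h.last
  have h0 := hI.off_zero_le
  have h0' := hI.off_zero
  have e4 : σ.m 4 = S.qI := by rw [hT.inp _ (by omega), hI.qI]
  have e5 : σ.m 5 = S.qF := by rw [hT.inp _ (by omega), hI.qF]
  have l1 : Linked linkPair (S.pat D (D 5)) → ((look (derCode 43 1)).eval σ ≠ 0 ↔
      T (.der (S.colored D) 1 (mg joinPair (S.pat D (D 5))))) := fun hl =>
    look_eval hT hc.tab ⟨Finset.filter_subset _ _, by omega, Sys.mem_mg_lt hv.lt⟩
      (by rw [eval_derCode hc.C (h.acc₃ hl)]; simp)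
  have hiff : (∀ e ∈ [var 38, var 25, 2 - var 25, 1 - (var 34 - get 4 + (get 4 - var 34)),
      1 - (var 35 - get 5 + (get 5 - var 35)), look (derCode 43 1)], e.eval σ ≠ 0) ↔
      Linked linkPair (S.pat D (D 5)) ∧ D 5 = 1 ∧ D S.stPos = S.qI ∧ D (S.stPos + 1) = S.qF ∧
      T (.der (S.colored D) 1 (mg joinPair (S.pat D (D 5)))) := by
    simp only [List.mem_cons, List.not_mem_nil, or_false, forall_eq_or_imp, forall_eq, eval_var,
      eval_sub, eval_add, eval_get, eval_one, eval_ofNat, h.linked, d5, e4, e5]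
    refine and_congr_right fun hl => ?_
    rw [l1 hl]
    constructor
    · rintro ⟨k1, k2, k3, k4, k5⟩
      obtain ⟨e1, e2⟩ := h34 (by omega)
      exact ⟨by omega, by omega, by omega, k5⟩
    · rintro ⟨k1, k2, k3, k4⟩
      obtain ⟨e1, e2⟩ := h34 (by omega)
      exact ⟨by omega, by omega, by omega, by omega, k4⟩
  obtain ⟨r1, r2, T', r3, r4, r5⟩ := enter_spec (f := .acc) hT hc.tab (es := [var 38, var 25,
      2 - var 25, 1 - (var 34 - get 4 + (get 4 - var 34)),
      1 - (var 35 - get 5 + (get 5 - var 35)), look (derCode 43 1)]) (a := 1)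
    (by simp [look, ok_derCode hc.C]) trivial (by
      rw [hiff]
      rintro ⟨k1, k2, k3, k4, k5⟩
      exact ⟨(Sys.Fire.acc k2 k3 k4 k5).step hD ⟨ht, h5, k1⟩ hI.qI_lt hI.qF_lt,
        by simp [Sys.fcode, Fct.key, code]⟩)
  exact ⟨r1, r2, T', r3, r4, fun k1 k2 k3 k4 k5 => r5 (hiff.2 ⟨k1, k2, k3, k4, k5⟩)⟩

end Rules

end RAM

/-! ### The colors of the threads and the body of the main loop -/

namespace RAM

open Ex

variable {S : Sys} {w off nn : ℕ → ℕ} {L : ℕ} {D : ℕ → ℕ} {T : Fct → Prop} {σ : Store}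

theorem colorStep_spec (hD : ∀ j < S.numDigits, D j < S.rad j) {j : ℕ} (hj : j < S.t)
    {F₁ F₂ F₃ : List ℕ} {P : Prop} (hd : ∀ j < S.numDigits, σ.m (L + j) = D j) (h6 : σ.v 6 = S.B + 1)
    (h7 : σ.v 7 = L) (h20 : σ.v 20 = D 0) (h32 : σ.v 32 = j) (hle : σ.v 46 ≤ 1)
    (h46 : σ.v 46 ≠ 0 ↔ ∀ k < j, D (9 + k) = if k = D 0 then 1 else 0)
    (h41 : σ.v 41 = code (S.B + 1) (bits j (S.cols D 1) ++ F₁))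
    (h42 : σ.v 42 = code (S.B + 1) (bits j (S.cols D 2) ++ F₂))
    (h43 : P → σ.v 43 = code (S.B + 1) (bits j (S.colored D) ++ F₃)) :
    colorStep.ok (5 * S.B) σ ∧ (colorStep.sem σ).v 32 = j + 1 ∧ (colorStep.sem σ).v 46 ≤ 1 ∧
      ((colorStep.sem σ).v 46 ≠ 0 ↔ ∀ k < j + 1, D (9 + k) = if k = D 0 then 1 else 0) ∧
      (colorStep.sem σ).v 41 = code (S.B + 1) (bits (j + 1) (S.cols D 1) ++ F₁) ∧
      (colorStep.sem σ).v 42 = code (S.B + 1) (bits (j + 1) (S.cols D 2) ++ F₂) ∧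
      (P → (colorStep.sem σ).v 43 = code (S.B + 1) (bits (j + 1) (S.colored D) ++ F₃)) := by
  have hB := S.hB
  have hlt := Sys.color_lt hD hj
  have r : σ.m (L + (9 + j)) = D (9 + j) := hd _ (by simp only [Sys.numDigits, Sys.stPos]; omega)
  have m1 : j ∈ S.cols D 1 ↔ D (9 + j) = 1 := by simp [Sys.cols, hj]
  have m2 : j ∈ S.cols D 2 ↔ D (9 + j) = 2 := by simp [Sys.cols, hj]
  have m3 : j ∈ S.colored D ↔ D (9 + j) ≠ 0 := by simp [Sys.colored, hj]
  have c46 : (colorStep.sem σ).v 46 = σ.v 46 - (D (9 + j) - (1 - (j - D 0 + (D 0 - j))) +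
      (1 - (j - D 0 + (D 0 - j)) - D (9 + j))) := by
    simp [colorStep, h7, h20, h32, r]
  have hsucc : (∀ k < j + 1, D (9 + k) = if k = D 0 then 1 else 0) ↔
      (∀ k < j, D (9 + k) = if k = D 0 then 1 else 0) ∧
        D (9 + j) = if j = D 0 then 1 else 0 := by
    constructor
    · exact fun h => ⟨fun k hk => h k (by omega), h j (by omega)⟩
    · rintro ⟨h, h'⟩ k hk
      rcases Nat.lt_succ_iff_lt_or_eq.1 hk with hk | rfl
      exacts [h k hk, h']
  refine ⟨?_, ?_, ?_, ?_, ?_, ?_, fun hP => ?_⟩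
  · simp [colorStep, h6]
    omega
  · simp [colorStep, h32]
  · rw [c46]; omega
  · rw [c46, hsucc, ← h46]
    split_ifs <;> omega
  · simp only [bits, List.cons_append, code, ← h41, m1]
    simp [colorStep, h7, h6, h32, r]
    split_ifs <;> omega
  · simp only [bits, List.cons_append, code, ← h42, m2]
    simp [colorStep, h7, h6, h32, r]
    split_ifs <;> omega
  · simp only [bits, List.cons_append, code, ← h43 hP, m3]
    simp [colorStep, h7, h6, h32, r]
    split_ifs <;> omega

theorem colorLoop_spec (hD : ∀ j < S.numDigits, D j < S.rad j)
    (hd : ∀ j < S.numDigits, σ.m (L + j) = D j)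
    (h : Ready S L D off nn [] [] [] σ) :
    colorLoop.ok (5 * S.B) σ ∧ (colorLoop.sem σ).m = σ.m ∧
      (colorLoop.sem σ).v 45 = σ.v 45 ∧
      ((colorLoop.sem σ).v 46 ≠ 0 ↔ ∀ k < S.t, D (9 + k) = if k = D 0 then 1 else 0) ∧
      Ready S L D off nn (bits S.t (S.cols D 1)) (bits S.t (S.cols D 2)) (bits S.t (S.colored D))
        (colorLoop.sem σ) := by
  have hB := S.hB
  have hc := h.config
  set σ1 := (σ.upd 32 0).upd 46 1 with hσ1
  have e1 : (Cm.set 46 1).sem ((Cm.set 32 0).sem σ) = σ1 := by simp [hσ1]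
  have he : (var 3).eval σ1 = S.t := by simp [hσ1, hc.t]
  have hk := rep_spec (W := 5 * S.B) (e := var 3) (c := colorStep) (σ := σ1)
    (I := fun j τ => τ.m = σ.m ∧ τ.v 6 = S.B + 1 ∧ τ.v 7 = L ∧ τ.v 20 = D 0 ∧ τ.v 32 = j ∧
      τ.v 46 ≤ 1 ∧ (τ.v 46 ≠ 0 ↔ ∀ k < j, D (9 + k) = if k = D 0 then 1 else 0) ∧
      τ.v 41 = code (S.B + 1) (bits j (S.cols D 1) ++ flat (pr 0 (S.pat D (D 5)))) ∧
      τ.v 42 = code (S.B + 1) (bits j (S.cols D 2) ++ flat (pr 1 (S.pat D (D 5)))) ∧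
      (Linked linkPair (S.pat D (D 5)) → τ.v 43 =
        code (S.B + 1) (bits j (S.colored D) ++ flat (mg joinPair (S.pat D (D 5))))))
    (by simp) (by rw [he]; omega)
    ⟨rfl, by simp [hσ1, hc.C], by simp [hσ1, hc.digs], by simpa [hσ1] using h.d 0 (by norm_num),
      by simp [hσ1], by simp [hσ1], by simp [hσ1], by simpa [hσ1, bits] using h.acc₁,
      by simpa [hσ1, bits] using h.acc₂, by simpa [hσ1, bits] using h.acc₃⟩ (by
      rw [he]
      rintro j hj τ ⟨i1, i2, i3, i4, i5, i6, i7, i8, i9, i10⟩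
      obtain ⟨k1, k2⟩ := colorStep_spec hD hj (by rwa [i1]) i2 i3 i4 i5 i6 i7 i8 i9 i10
      refine ⟨k1, by rw [Cm.sem_m _ (by decide), i1], ?_, ?_, ?_, k2⟩
      · rw [Cm.sem_v_of_notMem _ (by decide), i2]
      · rw [Cm.sem_v_of_notMem _ (by decide), i3]
      · rw [Cm.sem_v_of_notMem _ (by decide), i4])
  rw [he] at hk
  have e2 : colorLoop.sem σ = (Cm.rep (var 3) colorStep).sem σ1 := by rw [← e1]; rfl
  obtain ⟨hok, i1, -, -, -, -, -, i7, i8, i9, i10⟩ := hk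
  rw [← e2] at i1 i7 i8 i9 i10
  have fr : ∀ x, x ∉ colorLoop.writes → (colorLoop.sem σ).v x = σ.v x := fun x hx =>
    Cm.sem_v_of_notMem _ hx σ
  refine ⟨⟨trivial, trivial, by rw [e1]; exact hok, trivial⟩, i1, fr _ (by decide), i7,
    ⟨⟨config_of_notMem hc _ (by decide), ?_, ?_, ?_, ?_, ?_, ?_, i8, i9, i10, ?_⟩, ?_, ?_, ?_⟩⟩
  · rw [fr 34 (by decide), fr 35 (by decide)]; exact h.last
  · rw [fr _ (by decide)]; exact h.le
  · rw [fr _ (by decide)]; exact h.linked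
  · rw [fr _ (by decide)]; exact h.seq
  · rw [fr _ (by decide)]; exact h.own
  · rw [fr _ (by decide)]; exact h.first
  · rw [fr _ (by decide)]; exact h.length
  · intro k hk
    rw [fr _ (by interval_cases k <;> decide)]
    exact h.d k hk
  · rw [fr _ (by decide)]; exact h.addr
  · rw [fr _ (by decide)]; exact h.count

/-- The effect of `body`. -/
theorem body_spec (hI : Input S w off nn) (hD : ∀ j < S.numDigits, D j < S.rad j)
    (hT : Table S w (off S.t) σ.m D T) (hc : Config S (off S.t) σ)
    (h0 : ∀ x, 20 ≤ x → x < 50 → σ.v x = 0) :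
    body.ok (5 * S.B) σ ∧ ∃ T', Table S w (off S.t) (body.sem σ).m D T' ∧ S.Sandwich T T' ∧
      (S.Admissible D → ∀ f, S.Fire D T f → T' f) := by
  have hB := S.hB
  have hmB := S.hmB
  have hnd : 9 ≤ S.numDigits := by simp only [Sys.numDigits, Sys.stPos]; omega
  set σ1 := loadDigits.sem σ with hσ1
  have m1 : σ1.m = σ.m := Cm.sem_m _ (by decide) σ
  have c1 : Config S (off S.t) σ1 := config_of_notMem hc _ (by decide)
  have d1 : ∀ k < 9, σ1.v (20 + k) = D k := by
    intro k hk
    have := hT.dig k (by omega)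
    interval_cases k <;> (simp [hσ1, loadDigits, hc.digs]; exact this)
  have z1 : ∀ x, 29 ≤ x → x < 50 → σ1.v x = 0 := by
    intro x hx hx'
    rw [hσ1, Cm.sem_v_of_notMem _ _ σ, h0 x (by omega) hx']
    simp [loadDigits, seqs, Cm.writes]
    omega
  have d0 : σ1.v 20 = D 0 := d1 0 (by norm_num)
  have d5 : σ1.v 25 = D 5 := d1 5 (by norm_num)
  have okl : loadDigits.ok (5 * S.B) σ := by simp [loadDigits]
  set es : List Ex := [var 3 - var 20, var 4 + var 4 + 3 - var 25] with hes
  set rest := seqs [offLoop (var 20), patLoop, letterRule, segRule, setLeaf, colorLoop, leafRule,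
    joinRule, accRule] with hrest
  have hiff : (∀ e ∈ es, e.eval σ1 ≠ 0) ↔ D 0 < S.t ∧ D 5 ≤ 2 * S.s + 2 := by
    simp only [hes, List.mem_cons, List.not_mem_nil, or_false, forall_eq_or_imp, forall_eq,
      eval_var, eval_sub, eval_add, eval_ofNat, c1.t, c1.s, d0, d5]
    omega
  obtain ⟨s1, s2⟩ := sem_ifs es rest σ1
  have eb : body.sem σ = (ifs es rest).sem σ1 := rfl
  have okes : ∀ e ∈ es, e.ok (5 * S.B) σ1 := by simp [hes]
  by_cases hcond : ∀ e ∈ es, e.eval σ1 ≠ 0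
  swap
  -- If the guard fails, the body leaves the table alone, and rightly so, since the digits are not
  -- admissible.
  · rw [eb, s2 hcond]
    refine ⟨⟨okl, ok_ifs okes fun h => absurd h hcond⟩, T, by rwa [m1], .refl T, fun hA => ?_⟩
    exact absurd (hiff.2 ⟨hA.thread, hA.length⟩) hcond
  obtain ⟨ht, h5⟩ := hiff.1 hcond
  rw [eb, s1 hcond]
  suffices H : rest.ok (5 * S.B) σ1 ∧ ∃ T', Table S w (off S.t) (rest.sem σ1).m D T' ∧
      S.Sandwich T T' ∧ (S.Admissible D → ∀ f, S.Fire D T f → T' f) from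
    ⟨⟨okl, ok_ifs okes fun _ => H.1⟩, H.2⟩
  set σ2 := (offLoop (var 20)).sem σ1 with hσ2
  obtain ⟨ok2, a2, b2, -⟩ := offLoop_spec hI (n := D 0) (cnt := var 20) (σ := σ1) ht.le (by simp [d0])
    (by simp) c1.a c1.m (by rw [m1]; exact hT.inp)
  rw [← hσ2] at a2 b2
  have m2 : σ2.m = σ.m := (Cm.sem_m _ (by decide) σ1).trans m1
  have c2 : Config S (off S.t) σ2 := config_of_notMem c1 _ (by decide)
  have fr2 : ∀ x, x ∉ (offLoop (var 20)).writes → σ2.v x = σ1.v x := fun x hx =>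
    Cm.sem_v_of_notMem _ hx σ1
  set σ3 := patLoop.sem σ2 with hσ3
  obtain ⟨ok3, p3⟩ := patLoop_spec hD (by rw [m2]; exact hT.dig) c2
    (by rw [fr2 _ (by decide), d5]) h5 (by
      intro x hx
      simp only [List.mem_cons, List.not_mem_nil, or_false] at hx
      rcases hx with rfl | rfl | rfl | rfl | rfl | rfl | rfl | rfl <;>
        (rw [fr2 _ (by decide)]; exact z1 _ (by norm_num) (by norm_num)))
  rw [← hσ3] at p3
  have m3 : σ3.m = σ.m := (Cm.sem_m _ (by decide) σ2).trans m2
  have fr3 : ∀ x, x ∉ patLoop.writes → σ3.v x = σ2.v x := fun x hx => Cm.sem_v_of_notMem _ hx σ2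
  have hlt := hI.off_add_lt ht
  have r3 : Ready S (off S.t) D off nn [] [] [] σ3 := by
    refine ⟨p3, fun k hk => ?_, ?_, ?_⟩
    · rw [fr3 _ (by interval_cases k <;> decide), fr2 _ (by interval_cases k <;> decide), d1 k hk]
    · rw [fr3 _ (by decide), a2]
    · rw [fr3 _ (by decide), b2, m1, hT.inp _ (by omega), hI.count _ ht]
  have t3 : Table S w (off S.t) σ3.m D T := by rwa [m3]
  obtain ⟨ok4, v4, T4, t4, sw4, f4⟩ := letterRule_spec hI hD ht h5 t3 r3
  set σ4 := letterRule.sem σ3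
  have r4 := r3.of_v v4
  obtain ⟨ok5, v5, T5, t5, sw5, f5⟩ := segRule_spec hI hD ht h5 t4 r4
  set σ5 := segRule.sem σ4
  have r5 := r4.of_v v5
  have l6 := setLeaf_spec hI hD ht h5 t5 r5
  set σ6 := setLeaf.sem σ5 with hσ6
  have ok6 : setLeaf.ok (5 * S.B) σ5 := by
    simp only [setLeaf, look, ok_set, ok_get, ok_add, ok_var, true_and]
    exact ok_segCode r5.config.C trivial (by simp) (by simp)
  have fr6 : ∀ x, x ≠ 45 → σ6.v x = σ5.v x := fun x hx => by simp [hσ6, setLeaf, hx]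
  have r6 : Ready S (off S.t) D off nn [] [] [] σ6 := by
    refine ⟨⟨config_of_notMem r5.config _ (by decide), ?_, ?_, ?_, ?_, ?_, ?_, ?_, ?_, ?_, ?_⟩,
      ?_, ?_, ?_⟩
    · rw [fr6 34 (by decide), fr6 35 (by decide)]; exact r5.last
    · rw [fr6 _ (by decide)]; exact r5.le
    · rw [fr6 _ (by decide)]; exact r5.linked
    · rw [fr6 _ (by decide)]; exact r5.seq
    · rw [fr6 _ (by decide)]; exact r5.own
    · rw [fr6 _ (by decide)]; exact r5.first
    · rw [fr6 _ (by decide)]; exact r5.acc₁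
    · rw [fr6 _ (by decide)]; exact r5.acc₂
    · rw [fr6 _ (by decide)]; exact r5.acc₃
    · rw [fr6 _ (by decide)]; exact r5.length
    · intro k hk
      rw [fr6 _ (by omega)]
      exact r5.d k hk
    · rw [fr6 _ (by decide)]; exact r5.addr
    · rw [fr6 _ (by decide)]; exact r5.count
  have m6 : σ6.m = σ5.m := rfl
  have t6 : Table S w (off S.t) σ6.m D T5 := by rwa [m6]
  obtain ⟨ok7, m7, v45, v46, r7⟩ := colorLoop_spec hD t6.dig r6
  set σ7 := colorLoop.sem σ6
  have t7 : Table S w (off S.t) σ7.m D T5 := by rwa [m7]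
  obtain ⟨ok8, v8, T8, t8, sw8, f8⟩ := leafRule_spec hI hD ht h5 t7 r7 (P := T5 _) id
    (fun hl => by rw [v45]; exact l6 hl) v46
  set σ8 := leafRule.sem σ7
  have r8 := r7.of_v v8
  obtain ⟨ok9, v9, T9, t9, sw9, f9⟩ := joinRule_spec hI hD ht h5 t8 r8
  set σ9 := joinRule.sem σ8
  have r9 := r8.of_v v9
  obtain ⟨ok10, v10, T10, t10, sw10, f10⟩ := accRule_spec hI hD ht h5 t9 r9
  refine ⟨⟨ok2, ok3, ok4, ok5, ok6, ok7, ok8, ok9, ok10, trivial⟩, T10, t10,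
    ((((sw4.trans sw5).trans sw8).trans sw9).trans sw10), fun hA f hf => ?_⟩
  have hl := hA.linked
  have i5 : ∀ f, T f → T5 f := (sw4.trans sw5).sub
  have i9 : ∀ f, T5 f → T9 f := (sw8.trans sw9).sub
  have i10 : ∀ f, T5 f → T10 f := fun f hf => sw10.sub _ (i9 f hf)
  cases hf with
  | letter h1 h2 h3 => exact i10 _ (sw5.sub _ (f4 hl h1 h2 h3))
  | segJoin h1 h2 h3 => exact i10 _ (f5 hl h1 (sw4.sub _ h2) (sw4.sub _ h3))
  | leaf h1 h2 h3 h4 => exact sw10.sub _ (sw9.sub _ (f8 hl h1 h2 h3 (i5 _ h4)))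
  | join h1 h2 h3 h4 h5 h6 =>
    exact sw10.sub _ (f9 hl h1 h2 h3 h4 (sw8.sub _ (i5 _ h5)) (sw8.sub _ (i5 _ h6)))
  | acc h1 h2 h3 h4 => exact f10 hl h1 h2 h3 (i9 _ (i5 _ h4))

end RAM

/-! ### Mixed radix numbers -/

/-- The number of sequences of `n` digits. -/
def radProd (r : ℕ → ℕ) (n : ℕ) : ℕ := ∏ j ∈ Finset.range n, r j

/-- The number with the digits `D`, the least significant one first. -/
def radVal (r D : ℕ → ℕ) (n : ℕ) : ℕ := ∑ j ∈ Finset.range n, D j * radProd r j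

theorem radVal_succ (r D : ℕ → ℕ) (n : ℕ) :
    radVal r D (n + 1) = radVal r D n + D n * radProd r n := Finset.sum_range_succ _ _

theorem radProd_succ (r : ℕ → ℕ) (n : ℕ) : radProd r (n + 1) = radProd r n * r n :=
  Finset.prod_range_succ _ _

theorem radVal_lt {r D : ℕ → ℕ} {n : ℕ} (h : ∀ j < n, D j < r j) :
    radVal r D n < radProd r n := by
  induction n with
  | zero => simp [radVal, radProd]
  | succ n ih =>
    have h1 := ih fun j hj => h j (by omega)
    have h2 := h n (by omega)
    rw [radVal_succ, radProd_succ]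
    calc radVal r D n + D n * radProd r n < radProd r n + D n * radProd r n := by omega
      _ = radProd r n * (D n + 1) := by ring
      _ ≤ radProd r n * r n := Nat.mul_le_mul_left _ h2

theorem radVal_injective {r D E : ℕ → ℕ} {n : ℕ} (hD : ∀ j < n, D j < r j)
    (hE : ∀ j < n, E j < r j) (h : radVal r D n = radVal r E n) : ∀ j < n, D j = E j := by
  induction n with
  | zero => simp
  | succ n ih =>
    have h1 := radVal_lt (n := n) fun j hj => hD j (by omega)
    have h2 := radVal_lt (n := n) fun j hj => hE j (by omega)
    rw [radVal_succ, radVal_succ] at h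
    have hdiv : D n = E n := by
      have := congrArg (· / radProd r n) h
      simpa [Nat.add_mul_div_right _ _ (Nat.zero_lt_of_lt h1), Nat.div_eq_of_lt h1,
        Nat.div_eq_of_lt h2] using this
    intro j hj
    rcases Nat.lt_succ_iff_lt_or_eq.1 hj with hj | rfl
    · refine ih (fun j hj => hD j (by omega)) (fun j hj => hE j (by omega)) ?_ j hj
      rw [hdiv] at h
      omega
    · exact hdiv

theorem radVal_congr {r D E : ℕ → ℕ} {n : ℕ} (h : ∀ j < n, D j = E j) :
    radVal r D n = radVal r E n :=
  Finset.sum_congr rfl fun j hj => by rw [h j (Finset.mem_range.1 hj)]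

theorem Sys.rad_le (S : Sys) (j : ℕ) : S.rad j ≤ S.B := by
  have := S.hB
  have := S.hmB
  rw [rad]
  split_ifs <;> omega

theorem Table.congr {S : Sys} {w : ℕ → ℕ} {L : ℕ} {μ D E : ℕ → ℕ} {T : Fct → Prop}
    (h : Table S w L μ D T) (hE : ∀ j < S.numDigits, D j = E j) : Table S w L μ E T :=
  ⟨h.inp, fun j hj => by rw [h.dig j hj, hE j hj], h.mem, h.one, h.le⟩

theorem Table.update {S : Sys} {w : ℕ → ℕ} {L : ℕ} {μ D : ℕ → ℕ} {T : Fct → Prop}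
    (h : Table S w L μ D T) {j d : ℕ} (hj : j < S.numDigits) (hd : d ≤ S.B) :
    Table S w L (Function.update μ (L + j) d) (Function.update D j d) T := by
  refine ⟨fun k hk => ?_, fun k hk => ?_, fun g hg => ?_, fun g hg => ?_, fun k => ?_⟩
  · rw [Function.update_of_ne (by omega), h.inp k hk]
  · by_cases e : k = j
    · simp [e]
    · rw [Function.update_of_ne (by omega), Function.update_of_ne e, h.dig k hk]
  · rw [Function.update_of_ne (by omega), h.mem g hg]
  · rw [Function.update_of_ne (by omega)]
    exact h.one g hg
  · rw [Function.update_apply]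
    split_ifs
    exacts [hd, h.le k]

/-! ### The counter and the invariant of the main loop -/

namespace RAM

open Ex

variable {S : Sys} {w off nn : ℕ → ℕ} {L : ℕ} {D : ℕ → ℕ} {T : Fct → Prop} {σ : Store}

theorem setRad_v (h2 : σ.v 2 = S.m) (h5 : σ.v 5 = S.B) (h10 : σ.v 10 = S.stPos) :
    (setRad.sem σ).v 48 = S.rad (σ.v 32) := by
  simp [setRad, h2, h5, h10, Sys.rad]
  split_ifs <;> first | rfl | omega

theorem incStep_spec {j : ℕ} (hj : j < S.numDigits) (hD : ∀ j < S.numDigits, D j < S.rad j)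
    (hT : Table S w L σ.m D T) (hc : Config S L σ) (h32 : σ.v 32 = j) (h47 : σ.v 47 ≤ 1) :
    incStep.ok (5 * S.B) σ ∧ (incStep.sem σ).v 32 = j + 1 ∧ (incStep.sem σ).v 47 ≤ 1 ∧
      ∃ d < S.rad j, Table S w L (incStep.sem σ).m (Function.update D j d) T ∧
        d + (incStep.sem σ).v 47 * S.rad j = D j + σ.v 47 := by
  have hDj := hD j hj
  have hr := S.rad_le j
  set σ1 := setRad.sem σ with hσ1
  have v48 : σ1.v 48 = S.rad j := by rw [hσ1, setRad_v hc.m hc.B hc.st, h32]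
  have m1 : σ1.m = σ.m := Cm.sem_m _ (by decide) σ
  have fr : ∀ x, x ≠ 48 → σ1.v x = σ.v x := fun x hx =>
    Cm.sem_v_of_notMem _ (by simp [setRad, seqs, cset, Cm.writes, hx]) σ
  have r : σ.m (L + j) = D j := hT.dig j hj
  have f7 := fr 7 (by decide)
  have f32 := fr 32 (by decide)
  have f47 := fr 47 (by decide)
  have okr : setRad.ok (5 * S.B) σ := by simp [setRad]
  have em : (incStep.sem σ).m = Function.update σ.m (L + j)
      (if D j + σ.v 47 < S.rad j then D j + σ.v 47 else 0) := by
    simp only [incStep, sem_seqs_cons, ← hσ1]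
    simp [sem_put, f7, f32, f47, v48, m1, h32, hc.digs, r, Nat.sub_eq_zero_iff_le]
  have e47 : (incStep.sem σ).v 47 = if D j + σ.v 47 < S.rad j then 0 else 1 := by
    simp only [incStep, sem_seqs_cons, ← hσ1]
    simp [sem_put, f7, f32, f47, v48, m1, h32, hc.digs, r, Nat.sub_eq_zero_iff_le]
  refine ⟨?_, ?_, ?_, if D j + σ.v 47 < S.rad j then D j + σ.v 47 else 0, ?_, ?_, ?_⟩
  · refine ⟨okr, ?_⟩
    rw [← hσ1]
    simp [ok_put]
  · simp only [incStep, sem_seqs_cons, ← hσ1]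
    simp [sem_put, f32, h32]
  · rw [e47]
    split_ifs <;> omega
  · split_ifs <;> omega
  · rw [em]
    exact hT.update hj (by split_ifs <;> omega)
  · rw [e47]
    split_ifs <;> omega

theorem increment_spec (hD : ∀ j < S.numDigits, D j < S.rad j)
    (hT : Table S w L σ.m D T) (hc : Config S L σ) (h32 : σ.v 32 = 0) :
    increment.ok (5 * S.B) σ ∧ ∃ E, (∀ j < S.numDigits, E j < S.rad j) ∧
      Table S w L (increment.sem σ).m E T ∧
      radVal S.rad E S.numDigits =
        (radVal S.rad D S.numDigits + 1) % radProd S.rad S.numDigits := by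
  have hB := S.hB
  set σ1 := σ.upd 47 1 with hσ1
  have e1 : (Cm.set 47 1).sem σ = σ1 := by simp [hσ1]
  have c1 : Config S L σ1 := by rw [← e1]; exact config_of_notMem hc _ (by decide)
  have he : (var 9).eval σ1 = S.numDigits := by simp [hσ1, hc.num]
  have hk := rep_spec (W := 5 * S.B) (e := var 9) (c := incStep) (σ := σ1)
    (I := fun j τ => Config S L τ ∧ τ.v 32 = j ∧ τ.v 47 ≤ 1 ∧ ∃ E : ℕ → ℕ,
      (∀ k < S.numDigits, E k < S.rad k) ∧ Table S w L τ.m E T ∧ (∀ k, j ≤ k → E k = D k) ∧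
      radVal S.rad E j + τ.v 47 * radProd S.rad j = radVal S.rad D j + 1)
    (by simp) (by rw [he]; simp only [Sys.numDigits, Sys.stPos]; omega)
    ⟨c1, by simp [hσ1, h32], by simp [hσ1], D, hD, hT, fun _ _ => rfl,
      by simp [radVal, radProd, hσ1]⟩ (by
      rw [he]
      rintro j hj τ ⟨i1, i2, i3, E, i4, i5, i6, i7⟩
      obtain ⟨k1, k2, k3, d, k4, k5, k6⟩ := incStep_spec hj i4 i5 i1 i2 i3
      refine ⟨k1, config_of_notMem i1 _ (by decide), k2, k3, Function.update E j d, ?_, k5, ?_, ?_⟩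
      · intro k hk
        rw [Function.update_apply]
        split_ifs with e
        exacts [e ▸ k4, i4 k hk]
      · intro k hk
        rw [Function.update_of_ne (by omega), i6 k (by omega)]
      · rw [radVal_succ, radVal_succ, radProd_succ, Function.update_self,
          radVal_congr (E := E) fun k hk => Function.update_of_ne (by omega) _ _]
        have := congrArg (· * radProd S.rad j) k6
        simp only [i6 j le_rfl] at this
        linarith)
  rw [he] at hk
  obtain ⟨hok, -, -, i3, E, i4, i5, -, i7⟩ := hk
  have e2 : increment.sem σ = (Cm.rep (var 9) incStep).sem σ1 := by rw [← e1]; rfl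
  rw [← e2] at i3 i5 i7
  refine ⟨⟨trivial, by rw [e1]; exact hok, trivial⟩, E, i4, i5, ?_⟩
  -- The carry out of the highest digit is dropped, so after the last vector the counter starts
  -- again at `0`.
  have hlt := radVal_lt i4
  rw [← i7, Nat.add_mul_mod_self_right, Nat.mod_eq_of_lt hlt]

theorem clearWork_sem (σ : Store) :
    clearWork.sem σ = ⟨fun x => if 20 ≤ x ∧ x < 50 then 0 else σ.v x, σ.m⟩ := by
  rw [clearWork, sem_clear]
  congr 1
  funext x
  congr 1
  simp only [List.mem_map, List.mem_range, eq_iff_iff]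
  constructor
  · rintro ⟨k, hk, rfl⟩
    omega
  · rintro ⟨h1, h2⟩
    exact ⟨x - 20, by omega, by omega⟩

/-- The work variables are `0`. -/
def Clean (v : ℕ → ℕ) : Prop := ∀ x, 20 ≤ x → x < 50 → v x = 0

theorem clearWork_v {v : ℕ → ℕ} (hv : Clean v) {c : Cm} (hc : ∀ x ∈ c.writes, 20 ≤ x ∧ x < 50)
    (hσ : σ.v = v) : (clearWork.sem (c.sem σ)).v = v := by
  rw [clearWork_sem]
  funext x
  simp only
  split_ifs with h
  · exact (hv x h.1 h.2).symm
  · rw [Cm.sem_v_of_notMem _ (fun hx => h (hc x hx)), hσ]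

theorem _root_.Sys.Fire.mono {S : Sys} {T T' : Fct → Prop} (h : ∀ f, T f → T' f) {f : Fct}
    (hf : S.Fire D T f) : S.Fire D T' f := by
  cases hf with
  | letter h1 h2 h3 => exact .letter h1 h2 h3
  | segJoin h1 h2 h3 => exact .segJoin h1 (h _ h2) (h _ h3)
  | leaf h1 h2 h3 h4 => exact .leaf h1 h2 h3 (h _ h4)
  | join h1 h2 h3 h4 h5 h6 => exact .join h1 h2 h3 h4 (h _ h5) (h _ h6)
  | acc h1 h2 h3 h4 => exact .acc h1 h2 h3 (h _ h4)

/-- The situation after `n` iterations. -/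
def LoopInv (S : Sys) (w : ℕ → ℕ) (L : ℕ) (v : ℕ → ℕ) (n : ℕ) (σ : Store) : Prop :=
  σ.v = v ∧ ∃ (D : ℕ → ℕ) (T : Fct → Prop), (∀ j < S.numDigits, D j < S.rad j) ∧
    Table S w L σ.m D T ∧
    radVal S.rad D S.numDigits = n % radProd S.rad S.numDigits ∧ (∀ f, T f → S.Good f) ∧
    ∀ r E, (∀ j < S.numDigits, E j < S.rad j) →
      r * radProd S.rad S.numDigits + radVal S.rad E S.numDigits < n → S.Admissible E →
      ∀ f, S.Fire E (S.Lev r) f → T f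

/-- After `r` complete passes over all vectors the table contains level `r`: every step from level
`r` is described by some vector, and in pass number `r`, counted from `0`, that vector had its turn.
-/
theorem lev_of_progress {P n : ℕ} (hP : P = radProd S.rad S.numDigits) (hm : 0 < S.m)
    (ha : S.a ≤ S.B)
    (h : ∀ r E, (∀ j < S.numDigits, E j < S.rad j) →
      r * P + radVal S.rad E S.numDigits < n → S.Admissible E →
      ∀ f, S.Fire E (S.Lev r) f → T f) (r : ℕ) (hr : r * P ≤ n) : ∀ f, S.Lev r f → T f := by
  induction r with
  | zero => exact fun f hf => hf.elim
  | succ r ih =>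
    rw [add_one_mul] at hr
    rintro f (hf | hf)
    · exact ih (by omega) f hf
    · obtain ⟨E, hE, hA, hF⟩ := hf.exists_fire hm ha
      have := radVal_lt hE
      exact h r E hE (by omega) hA f hF

/-- The work variables are cleared, so all variables have their old values again; only the digits
and the table in the memory carry information from one iteration to the next. -/
theorem iteration_spec (hI : Input S w off nn) {v : ℕ → ℕ} (hv : Clean v)
    (hc : ∀ σ : Store, σ.v = v → Config S (off S.t) σ) {n : ℕ}
    (h : LoopInv S w (off S.t) v n σ) :
    iteration.ok (5 * S.B) σ ∧ LoopInv S w (off S.t) v (n + 1) (iteration.sem σ) := by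
  obtain ⟨hσ, D, T, hD, hT, hval, hgood, hprog⟩ := h
  have ha : S.a ≤ S.B := hI.a ▸ hI.le 0
  have hm : 0 < S.m := Nat.zero_lt_of_lt hI.qI_lt
  obtain ⟨ok1, T', hT', hsw, hfire⟩ := body_spec hI hD hT (hc σ hσ)
    (by rw [hσ]; exact hv)
  set σ1 := clearWork.sem (body.sem σ) with hσ1
  have v1 : σ1.v = v := clearWork_v hv (by decide) hσ
  have m1 : σ1.m = (body.sem σ).m := Cm.sem_m _ (by decide) _
  obtain ⟨ok2, E, hE, hTE, hvalE⟩ := increment_spec hD (m1 ▸ hT') (hc σ1 v1)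
    (by rw [v1]; exact hv 32 (by norm_num) (by norm_num))
  refine ⟨⟨ok1, ok_clear _ _, ok2, ok_clear _ _, trivial⟩, ?_⟩
  have e : iteration.sem σ = clearWork.sem (increment.sem σ1) := rfl
  have m2 : (iteration.sem σ).m = (increment.sem σ1).m := Cm.sem_m clearWork (by decide) _
  refine ⟨by rw [e]; exact clearWork_v hv (by decide) v1, E, T', hE, by rwa [m2], ?_,
    hsw.good hgood, ?_⟩
  · rw [hvalE, hval, Nat.mod_add_mod]
  · intro r E' hE' hlt hA f hF
    rcases Nat.lt_succ_iff_lt_or_eq.1 hlt with hlt | heq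
    · exact hsw.sub f (hprog r E' hE' hlt hA f hF)
    -- Now it is the turn of `E'`: it agrees with the current digits, and `r` passes are complete,
    -- so all of level `r` is in the table.
    · have hlt' := radVal_lt hE'
      have hEq := radVal_injective hD hE' (by
        rw [hval, ← heq, add_comm, Nat.add_mul_mod_self_right, Nat.mod_eq_of_lt hlt'])
      have hL := lev_of_progress rfl hm ha hprog r (by omega)
      -- `E'` may differ from `D` beyond the last digit, so the same execution is analysed again
      -- with `E'`. It ends in the same memory, hence `T'` and `T''` agree on valid facts.
      obtain ⟨-, T'', hT'', hsw'', hfire''⟩ := body_spec hI hE' (hT.congr hEq) (hc σ hσ)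
        (by rw [hσ]; exact hv)
      have hval := hF.step hE' hA hI.qI_lt hI.qF_lt |>.valid
      have := hfire'' hA f (hF.mono hL)
      exact (hT'.mem f hval).1 ((hT''.mem f hval).2 this)

theorem setup_spec (hI : Input S w off nn) (hv : σ.v = fun _ => 0) (hm : σ.m = w) :
    setup.ok (5 * S.B) σ ∧ (setup.sem σ).m = w ∧ Config S (off S.t) (setup.sem σ) ∧
      (setup.sem σ).v 0 = 0 ∧
      (setup.sem σ).v 11 = (S.B ^ 4 + S.B) * radProd S.rad S.numDigits := by
  have hB := S.hB
  set σ1 := (Cm.set 4 (get 3)).sem ((Cm.set 3 (get 2)).sem ((Cm.set 2 (get 1)).sem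
    ((Cm.set 1 (get 0)).sem σ))) with hσ1
  have m1 : σ1.m = w := by simp [hσ1, hm]
  have a1 : σ1.v 1 = S.a := by simp [hσ1, hm, hI.a]
  have a2 : σ1.v 2 = S.m := by simp [hσ1, hm, hI.m]
  have a3 : σ1.v 3 = S.t := by simp [hσ1, hm, hI.t]
  have a4 : σ1.v 4 = S.s := by simp [hσ1, hm, hI.s]
  have a49 : σ1.v 49 = 0 := by simp [hσ1, hv]
  have a32 : σ1.v 32 = 0 := by simp [hσ1, hv]
  obtain ⟨ok2, b1, -, b3⟩ := offLoop_spec hI (σ := σ1) (cnt := var 3) le_rfl (by simp [a3])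
    (by simp) a1 a2 (by simp [m1])
  set σ2 := (offLoop (var 3)).sem σ1 with hσ2
  have m2 : σ2.m = w := (Cm.sem_m _ (by decide) σ1).trans m1
  have fr : ∀ x, x ∉ (offLoop (var 3)).writes → σ2.v x = σ1.v x := fun x hx =>
    Cm.sem_v_of_notMem _ hx σ1
  have c1 : σ2.v 1 = S.a := (fr _ (by decide)).trans a1
  have c2 : σ2.v 2 = S.m := (fr _ (by decide)).trans a2
  have c3 : σ2.v 3 = S.t := (fr _ (by decide)).trans a3
  have c4 : σ2.v 4 = S.s := (fr _ (by decide)).trans a4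
  have c32 : σ2.v 32 = 0 := (fr _ (by decide)).trans a32
  have c49 : S.a + S.m + S.t + S.s + S.s + 10 + σ2.v 49 = S.B := by
    rw [b3, a49, hI.B]; ring
  set pre := seqs [
    .set 5 (var 1 + var 2 + var 3 + var 4 + var 4 + 10 + var 49),
    .set 6 (var 5 + 1),
    .set 7 (var 30),
    .set 10 (9 + var 3 + var 4 + var 4 + 2),
    .set 9 (var 10 + var 4 + var 4 + var 4 + var 4 + 4),
    .set 8 (var 7 + var 9),
    .set 11 (var 5 * var 5 * var 5 * var 5 + var 5)] with hpre
  set σ3 := pre.sem σ2 with hσ3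
  have d5 : S.stPos = 9 + S.t + S.s + S.s + 2 := by simp only [Sys.stPos]; omega
  have d6 : S.numDigits = 9 + S.t + S.s + S.s + 2 + S.s + S.s + S.s + S.s + 4 := by
    simp only [Sys.numDigits, Sys.stPos]; omega
  have m3 : σ3.m = w := (Cm.sem_m _ (by decide) σ2).trans m2
  have conf : Config S (off S.t) σ3 := by
    constructor <;> simp [hσ3, hpre, c1, c2, c3, c4, c49, b1, d5, d6]
  have e11 : σ3.v 11 = S.B ^ 4 + S.B := by
    simp [hσ3, hpre, c1, c2, c3, c4, c49]; ring
  have e32 : σ3.v 32 = 0 := by rw [hσ3, Cm.sem_v_of_notMem _ (by decide), c32]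
  have okpre : pre.ok (5 * S.B) σ2 := by
    simp [hpre, c1, c2, c3, c4, c49]; omega
  set c := seqs [setRad, .set 11 (var 11 * var 48), .set 32 (var 32 + 1)] with hcdef
  have he : (var 9).eval σ3 = S.numDigits := conf.num
  have hk := rep_spec (W := 5 * S.B) (e := var 9) (c := c) (σ := σ3)
    (I := fun j τ => τ.m = w ∧ τ.v 2 = S.m ∧ τ.v 5 = S.B ∧ τ.v 10 = S.stPos ∧ τ.v 32 = j ∧
      τ.v 11 = (S.B ^ 4 + S.B) * radProd S.rad j) (by simp) (by rw [he]; omega)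
    ⟨m3, conf.m, conf.B, conf.st, e32, by simp [e11, radProd]⟩ (by
      rw [he]
      rintro j hj τ ⟨i1, i2, i3, i4, i5, i6⟩
      have h48 := setRad_v i2 i3 i4
      have hr := S.rad_le j
      have f11 : (setRad.sem τ).v 11 = τ.v 11 := Cm.sem_v_of_notMem _ (by decide) _
      rw [i5] at h48
      refine ⟨⟨by simp [setRad], ?_⟩, ?_, ?_, ?_, ?_, ?_, ?_⟩
      · simp [h48]; omega
      · rw [Cm.sem_m _ (by decide), i1]
      · rw [Cm.sem_v_of_notMem _ (by decide), i2]
      · rw [Cm.sem_v_of_notMem _ (by decide), i3]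
      · rw [Cm.sem_v_of_notMem _ (by decide), i4]
      · have : (setRad.sem τ).v 32 = τ.v 32 := Cm.sem_v_of_notMem _ (by decide) _
        simp [hcdef, this, i5]
      · simp only [hcdef, sem_seqs_cons]
        simp [h48, f11, i6, radProd_succ, mul_assoc])
  rw [he] at hk
  obtain ⟨okr, -, -, -, -, -, i6⟩ := hk
  have es : setup.sem σ = (Cm.rep (var 9) c).sem σ3 := rfl
  refine ⟨⟨trivial, trivial, trivial, trivial, ok2, ?_⟩, ?_, ?_, ?_, by rw [es]; exact i6⟩
  · obtain ⟨o1, o2, o3, o4, o5, o6, o7, -⟩ := okpre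
    exact ⟨o1, o2, o3, o4, o5, o6, o7, okr, trivial⟩
  · rw [es, Cm.sem_m _ (by decide), m3]
  · rw [es]
    have key : ∀ x, x ≠ 11 → x < 12 → ((Cm.rep (var 9) c).sem σ3).v x = σ3.v x := fun x h1 h2 =>
      Cm.sem_v_of_notMem _ (by
        simp [hcdef, setRad, seqs, cset, Cm.writes]; omega) σ3
    constructor <;> (rw [key _ (by norm_num) (by norm_num)])
    exacts [conf.a, conf.m, conf.t, conf.s, conf.B, conf.C, conf.digs, conf.tab, conf.num, conf.st]
  · rw [Cm.sem_v_of_notMem _ (by decide), hv]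

end RAM

/-! ### Result and running time of the whole program -/

namespace RAM

open Ex

variable {S : Sys} {w off nn : ℕ → ℕ}

/-- A bound for the number of instructions in one iteration of the main loop, and outside it. -/
def work (B : ℕ) : ℕ :=
  5 * B + (seqs [setup, clearWork, iteration, finish]).bd (5 * B) + 2

theorem budget_le_sq {L b X : ℕ} (hb : b ≤ X) (hL : L + b + 1 ≤ 2 * X) :
    budget L b ≤ 16 * (X * X) := by
  unfold budget
  calc 8 * b * (L + b + 1) ≤ 8 * X * (2 * X) := by gcongr
    _ = 16 * (X * X) := by ring

theorem time_le {W s c i f K X t₁ t₂ t₃ t₄ t₅ : ℕ} (hX : X = W + (s + (c + (i + (f + 1)))) + 2)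
    (h₁ : t₁ ≤ budget W s) (h₂ : t₂ ≤ budget (W + s) c) (h₃ : t₃ ≤ budget (W + s + c) 1)
    (h₄ : t₄ ≤ K * (budget (W + s + c) i + 2 * (W + s + c) + 5) + 1)
    (h₅ : t₅ ≤ budget (W + s + c) (f + 1)) :
    t₁ + (t₂ + (t₃ + t₄ + t₅)) ≤ (K + 1) * (100 * (X * X)) := by
  have q1 := budget_le_sq (L := W) (b := s) (X := X) (by omega) (by omega)
  have q2 := budget_le_sq (L := W + s) (b := c) (X := X) (by omega) (by omega)
  have q3 := budget_le_sq (L := W + s + c) (b := 1) (X := X) (by omega) (by omega)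
  have q4 := budget_le_sq (L := W + s + c) (b := i) (X := X) (by omega) (by omega)
  have q5 := budget_le_sq (L := W + s + c) (b := f + 1) (X := X) (by omega) (by omega)
  have hX3 : 3 ≤ X := by omega
  have q6 : 2 * (W + s + c) + 5 ≤ 8 * (X * X) := by
    calc 2 * (W + s + c) + 5 ≤ 8 * X := by omega
      _ ≤ 8 * (X * X) := Nat.mul_le_mul_left _ (Nat.le_mul_of_pos_left _ (by omega))
  have q7 : 1 ≤ X * X := Nat.mul_pos (by omega) (by omega)
  have q8 : K * (budget (W + s + c) i + 2 * (W + s + c) + 5) ≤ K * (100 * (X * X)) :=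
    Nat.mul_le_mul_left _ (by omega)
  rw [add_one_mul]
  omega

/-- The result of the main loop. -/
theorem loop_result (hI : Input S w off nn) {v : ℕ → ℕ} {σ : Store}
    (h : LoopInv S w (off S.t) v ((S.B ^ 4 + S.B) * radProd S.rad S.numDigits) σ) :
    (σ.m (off S.t + S.numDigits + S.fcode .acc) ≤ 1 ∧
      (σ.m (off S.t + S.numDigits + S.fcode .acc) ≠ 0 ↔ ∃ v, S.Solution v)) ∧
      σ.m 4 = S.qI ∧ σ.m 5 = S.qF := by
  obtain ⟨-, D, T, -, hT, -, hgood, hprog⟩ := h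
  have h0 := hI.off_zero_le
  have h0' := hI.off_zero
  refine ⟨⟨hT.one _ trivial, ?_⟩, by rw [hT.inp _ (by omega), hI.qI],
    by rw [hT.inp _ (by omega), hI.qF]⟩
  rw [hT.mem .acc trivial]
  constructor
  · exact fun h => (hgood _ h).2
  · rintro ⟨v, hv⟩
    exact lev_of_progress rfl (Nat.zero_lt_of_lt hI.qI_lt) (hI.a ▸ hI.le 0) hprog _ le_rfl _
      (Sys.lev_acc hv)

/-- The main loop runs too often for `Cm.ok`, whose bound `W = 5 * S.B` on repetitions enters the
lengths of numbers. It is therefore executed with `exec_rep_loop` directly, with a price for one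
iteration that does not depend on its number. -/
theorem program_spec (hI : Input S w off nn) :
    ∃ (ν : State) (k : ℕ), Exec (program.comp 0) ⟨fun _ => 0, w⟩ ν k ∧
      k ≤ ((S.B ^ 4 + S.B) * radProd S.rad S.numDigits + 1) * (100 * (work S.B * work S.B)) ∧
      ((S.qI = S.qF ∨ ∃ v, S.Solution v) → ν.reg 0 = 1) ∧
      (¬ (S.qI = S.qF ∨ ∃ v, S.Solution v) → ν.reg 0 = 0) := by
  have hB := S.hB
  set K := (S.B ^ 4 + S.B) * radProd S.rad S.numDigits with hK
  set X := work S.B with hX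
  set W := 5 * S.B with hW
  have eX : X = W + (setup.bd W + (clearWork.bd W + (iteration.bd W + (finish.bd W + 1)))) + 2 := rfl
  set σ₀ : Store := ⟨fun _ => 0, w⟩ with hσ₀
  have b0 : σ₀.Below W := by
    refine ⟨fun x => by simp [hσ₀], fun x => ?_⟩
    calc w x ≤ S.B := hI.le x
      _ ≤ W := by omega
      _ < 2 ^ W := Nat.lt_two_pow_self
  obtain ⟨ok1, m1, c1, -, k1⟩ := setup_spec (σ := σ₀) hI rfl rfl
  obtain ⟨μ1, t1, x1, l1, r1, -⟩ := Cm.comp_spec b0 setup ok1 0 ⟨fun _ => 0, w⟩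
    ⟨fun _ => rfl, rfl⟩
  have b1 := Cm.below_sem b0 setup ok1
  set σ1 := setup.sem σ₀
  have ok2 : clearWork.ok W σ1 := ok_clear _ _
  obtain ⟨μ2, t2, x2, l2, r2, -⟩ := Cm.comp_spec b1 clearWork ok2 0 μ1 r1
  have b2 := Cm.below_sem b1 clearWork ok2
  set σ2 := clearWork.sem σ1 with hσ2
  set L := W + setup.bd W + clearWork.bd W with hL
  have m2 : σ2.m = w := (Cm.sem_m clearWork (by decide) _).trans m1
  have c2 : Config S (off S.t) σ2 := config_of_notMem c1 clearWork (by decide)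
  have k2 : σ2.v 11 = K := (Cm.sem_v_of_notMem clearWork (by decide) _).trans k1
  have hclean : Clean σ2.v := by
    intro x h1 h2
    rw [hσ2, clearWork_sem]
    simp [h1, h2]
  clear_value σ2 σ1
  have hconf : ∀ σ : Store, σ.v = σ2.v → Config S (off S.t) σ := by
    intro σ e
    constructor <;> rw [e]
    exacts [c2.a, c2.m, c2.t, c2.s, c2.B, c2.C, c2.digs, c2.tab, c2.num, c2.st]
  have hrad : ∀ j, 0 < S.rad j := by
    intro j
    have := hI.qI_lt
    rw [Sys.rad]
    split_ifs <;> omega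
  have inv0 : LoopInv S w (off S.t) σ2.v 0 σ2 := by
    refine ⟨rfl, fun _ => 0, fun _ => False, fun j _ => hrad j, ⟨?_, ?_, ?_, ?_, ?_⟩, by simp [radVal],
      fun f hf => hf.elim, fun r E _ h => absurd h (by omega)⟩
    · intro k _
      rw [m2]
    · intro j _
      rw [m2, hI.zero _ (by omega)]
    · intro f _
      rw [m2, hI.zero _ (by omega)]
      simp
    · intro f _
      rw [m2, hI.zero _ (by omega)]
      omega
    · intro k
      rw [m2]
      exact hI.le k
  have inv : ∀ n, LoopInv S w (off S.t) σ2.v n (iteration.sem^[n] σ2) := by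
    intro n
    induction n with
    | zero => exact inv0
    | succ n ih =>
      rw [Function.iterate_succ_apply']
      exact (iteration_spec hI hclean hconf ih).2
  -- Lengths do not accumulate over the iterations: by the invariant all variables have their
  -- initial values and all memory cells are at most `B`.
  have below : ∀ n, (iteration.sem^[n] σ2).Below L := by
    intro n
    obtain ⟨e, D, T, -, hT, -⟩ := inv n
    have : S.B ≤ L := by omega
    refine ⟨fun x => by rw [e]; exact b2.v x, fun x => ?_⟩
    calc _ ≤ S.B := hT.le x
      _ ≤ L := this
      _ < 2 ^ L := Nat.lt_two_pow_self
  obtain ⟨μ3, t3, x3, l3, r3, -, v3⟩ := Ex.comp_spec (W := W) b2 (var 11) trivial 0 μ2 r2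
  obtain ⟨μ4, t4, x4, l4, r4, -⟩ := exec_rep_loop (c := iteration) (d := 0) (L := L)
    (b := budget L (iteration.bd W)) (n := K) r3 (by rw [v3]; exact k2) (by rw [← k2]; exact b2.v 11)
    (fun j _ μ hμ => by
      rw [Function.iterate_succ_apply']
      exact Cm.comp_spec (below j) iteration (iteration_spec hI hclean hconf (inv j)).1 _ μ hμ)
  set σ3 := iteration.sem^[K] σ2 with hσ3
  have inv3 : LoopInv S w (off S.t) σ2.v K σ3 := inv K
  obtain ⟨⟨hone, hacc⟩, e4, e5⟩ := loop_result hI inv3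
  have c3 := hconf σ3 inv3.1
  have okf : (Cm.seq finish .skip).ok W σ3 := by
    refine ⟨?_, trivial⟩
    simp [finish, look]
  obtain ⟨μ5, t5, x5, l5, r5, -⟩ := Cm.comp_spec (below K) (Cm.seq finish .skip) okf 0 μ4 r4
  rw [← hσ3] at r5
  clear_value σ3
  have out : μ5.reg 0 = if S.qI = S.qF then 1 else
      σ3.m (off S.t + S.numDigits + S.fcode .acc) := by
    have e1 := r5.v 0
    have : S.fcode .acc = 1 := by simp [Sys.fcode, Fct.key, code]
    rw [this]
    simp only [mul_zero] at e1
    rw [e1]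
    simp [Cm.sem, finish, look, sem_cset', e4, e5, c3.tab]
    by_cases e : S.qI = S.qF
    · simp [e]
    · rw [if_neg e, if_pos]
      omega
  refine ⟨μ5, _, Exec.seq x1 (Exec.seq x2 (Exec.seq (Exec.seq x3 x4) x5)), ?_, ?_, ?_⟩
  · exact time_le eX l1 l2 l3 l4 l5
  · rintro (h | h)
    · rw [out, if_pos h]
    · have := hacc.2 h
      rw [out]
      split_ifs <;> omega
  · intro h
    rw [not_or] at h
    rw [out, if_neg h.1]
    by_contra h'
    exact h.2 (hacc.1 h')

end RAM

/-! ### The encoding of instances -/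

theorem length_flatMap_finRange {n : ℕ} (f : Fin n → List ℕ) (ℓ : ℕ → ℕ)
    (h : ∀ i : Fin n, (f i).length = ℓ i) :
    ((List.finRange n).flatMap f).length = ∑ k ∈ Finset.range n, ℓ k := by
  induction n generalizing ℓ with
  | zero => simp
  | succ n ih =>
    have := ih (fun i => f i.succ) (fun k => ℓ (k + 1)) fun i => by simpa using h i.succ
    rw [List.finRange_succ, List.flatMap_cons, List.flatMap_map, List.length_append, this,
      Finset.sum_range_succ', h 0, add_comm]
    rfl

theorem getD_flatMap_finRange {n : ℕ} (f : Fin n → List ℕ) (ℓ : ℕ → ℕ)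
    (h : ∀ i : Fin n, (f i).length = ℓ i) {i x : ℕ} (hi : i < n) (hx : x < ℓ i) :
    ((List.finRange n).flatMap f).getD (∑ k ∈ Finset.range i, ℓ k + x) 0 =
      (f ⟨i, hi⟩).getD x 0 := by
  induction n generalizing i ℓ with
  | zero => omega
  | succ n ih =>
    rw [List.finRange_succ, List.flatMap_cons, List.flatMap_map]
    have h0 : (f 0).length = ℓ 0 := h 0
    cases i with
    | zero =>
      rw [List.getD_append _ _ _ _ (by rw [h0]; simpa using hx)]
      simp
    | succ i =>
      rw [List.getD_append_right _ _ _ _ (by rw [h0, Finset.sum_range_succ']; omega), h0,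
        Finset.sum_range_succ', show ∑ k ∈ Finset.range i, ℓ (k + 1) + ℓ 0 + x - ℓ 0 =
          ∑ k ∈ Finset.range i, ℓ (k + 1) + x by omega]
      exact ih (fun i => f i.succ) (fun k => ℓ (k + 1)) (fun i => by simpa using h i.succ)
        (by omega) hx

section Table

variable {a n : ℕ} (A : FinAut a n)

theorem FinAut.length_table : A.table.length = a * n * n := by
  have h1 : ∀ p x, ((List.finRange n).map fun q => (A.step p x q).toNat).length = n := by simp
  have h2 : ∀ p : Fin n, ((List.finRange a).flatMap fun x =>
      (List.finRange n).map fun q => (A.step p x q).toNat).length = a * n := fun p => by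
    rw [length_flatMap_finRange _ (fun _ => n) (h1 p)]; simp
  rw [FinAut.table, length_flatMap_finRange _ (fun _ => a * n) h2]
  simp
  ring

theorem FinAut.getD_table {p x q : ℕ} (hp : p < n) (hx : x < a) (hq : q < n) :
    A.table.getD ((p * a + x) * n + q) 0 = (A.step ⟨p, hp⟩ ⟨x, hx⟩ ⟨q, hq⟩).toNat := by
  have h1 : ∀ p x, ((List.finRange n).map fun q => (A.step p x q).toNat).length = n := by simp
  have h2 : ∀ p : Fin n, ((List.finRange a).flatMap fun x =>
      (List.finRange n).map fun q => (A.step p x q).toNat).length = a * n := fun p => by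
    rw [length_flatMap_finRange _ (fun _ => n) (h1 p)]; simp
  have e := getD_flatMap_finRange _ (fun _ => a * n) h2 hp (x := x * n + q) (by nlinarith)
  have e' := getD_flatMap_finRange _ (fun _ => n) (h1 ⟨p, hp⟩) hx (x := q) hq
  simp only [Finset.sum_const, Finset.card_range, smul_eq_mul] at e e'
  rw [e'] at e
  rw [FinAut.table, show (p * a + x) * n + q = p * (a * n) + (x * n + q) by ring, e]
  simp [hq]

theorem FinAut.table_le : ∀ k ∈ A.table, k ≤ 1 := by
  intro k hk
  simp only [FinAut.table, List.mem_flatMap, List.mem_map] at hk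
  obtain ⟨p, -, x, -, q, -, rfl⟩ := hk
  exact Bool.toNat_le _

end Table

namespace SMCP

variable (P : SMCP) (s : ℕ)

/-- The numbers of states of the threads. -/
def count (i : ℕ) : ℕ := if h : i < P.t then P.n ⟨i, h⟩ else 0

/-- The addresses of the threads in the encoding of an instance. -/
def offset (i : ℕ) : ℕ :=
  6 + P.a * P.m * P.m + ∑ k ∈ Finset.range i, (3 + P.a * P.count k * P.count k)

variable {P} in
theorem count_of_lt {i : ℕ} (h : i < P.t) : P.count i = P.n ⟨i, h⟩ := dif_pos h

theorem count_le {i : ℕ} (h : i < P.t) : P.count i ≤ ∑ k ∈ Finset.range P.t, P.count k :=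
  Finset.single_le_sum (f := P.count) (fun _ _ => Nat.zero_le _) (Finset.mem_range.2 h)

/-- The program as a system with states in `ℕ`. -/
def toSys : Sys where
  Ms q x r := ∃ hq hx hr, P.M.step ⟨q, hq⟩ ⟨x, hx⟩ ⟨r, hr⟩ = true
  As i p x p' := ∃ (hi : i < P.t) (hp : p < P.n ⟨i, hi⟩) (hx : x < P.a) (hp' : p' < P.n ⟨i, hi⟩),
    (P.A ⟨i, hi⟩).step ⟨p, hp⟩ ⟨x, hx⟩ ⟨p', hp'⟩ = true
  pI i := if h : i < P.t then (P.A ⟨i, h⟩).init else 0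
  pF i := if h : i < P.t then (P.A ⟨i, h⟩).final else 0
  qI := P.M.init
  qF := P.M.final
  a := P.a
  m := P.m
  t := P.t
  s := s
  B := P.a + P.m + P.t + 2 * s + 10 + ∑ i ∈ Finset.range P.t, P.count i
  hM := fun ⟨hq, hx, hr, _⟩ => ⟨hq, hx, hr⟩
  hA := by
    rintro i p x p' ⟨hi, hp, hx, hp', -⟩
    have := P.count_le hi
    rw [count_of_lt hi] at this
    exact ⟨hi, by omega, by omega⟩
  hmB := by omega
  hpI := by
    intro i hi
    have h1 := P.count_le hi
    have h2 := (P.A ⟨i, hi⟩).init.2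
    rw [count_of_lt hi] at h1
    rw [dif_pos hi]
    omega
  hpF := by
    intro i hi
    have h1 := P.count_le hi
    have h2 := (P.A ⟨i, hi⟩).final.2
    rw [count_of_lt hi] at h1
    rw [dif_pos hi]
    omega
  hB := by omega

/-- The encoding of a thread. -/
def threadCode (i : Fin P.t) : List ℕ :=
  [P.n i, ((P.A i).init : ℕ), ((P.A i).final : ℕ)] ++ (P.A i).table

theorem encodeInstance_eq : encodeInstance P s =
    [P.a, P.m, P.t, s, (P.M.init : ℕ), (P.M.final : ℕ)] ++
      (P.M.table ++ (List.finRange P.t).flatMap P.threadCode) := by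
  simp [encodeInstance]
  rfl

theorem length_threadCode (i : Fin P.t) :
    (P.threadCode i).length = 3 + P.a * P.count i * P.count i := by
  rw [threadCode, List.length_append, FinAut.length_table, count_of_lt i.2]
  rfl

theorem length_encodeInstance : (encodeInstance P s).length = P.offset P.t := by
  rw [encodeInstance_eq, List.length_append, List.length_append, FinAut.length_table,
    length_flatMap_finRange _ (fun i => 3 + P.a * P.count i * P.count i) P.length_threadCode, offset, add_assoc]
  rfl

theorem encodeInstance_table {q x r : ℕ} (hq : q < P.m) (hx : x < P.a) (hr : r < P.m) :
    (encodeInstance P s).getD (6 + ((q * P.a + x) * P.m + r)) 0 =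
      (P.M.step ⟨q, hq⟩ ⟨x, hx⟩ ⟨r, hr⟩).toNat := by
  have := index_lt hq hx hr
  rw [encodeInstance_eq, List.getD_append_right _ _ _ _ (by simp),
    show 6 + ((q * P.a + x) * P.m + r) - [P.a, P.m, P.t, s, (P.M.init : ℕ), (P.M.final : ℕ)].length =
      (q * P.a + x) * P.m + r by simp,
    List.getD_append _ _ _ _ (by rwa [FinAut.length_table]), FinAut.getD_table _ hq hx hr]

theorem encodeInstance_thread {i k : ℕ} (hi : i < P.t)
    (hk : k < 3 + P.a * P.count i * P.count i) :
    (encodeInstance P s).getD (P.offset i + k) 0 = (P.threadCode ⟨i, hi⟩).getD k 0 := by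
  rw [encodeInstance_eq, List.getD_append_right _ _ _ _ (by simp [offset]; omega),
    List.getD_append_right _ _ _ _ (by rw [FinAut.length_table]; simp [offset]; omega),
    FinAut.length_table, ← getD_flatMap_finRange _ (fun i => 3 + P.a * P.count i * P.count i) P.length_threadCode hi hk]
  congr 1
  simp [offset]
  omega

theorem input : Input (P.toSys s) (fun k => (encodeInstance P s).getD k 0) P.offset P.count where
  a := by simp [encodeInstance_eq, toSys]
  m := by simp [encodeInstance_eq, toSys]
  t := by simp [encodeInstance_eq, toSys]
  s := by simp [encodeInstance_eq, toSys]
  qI := by simp [encodeInstance_eq, toSys]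
  qF := by simp [encodeInstance_eq, toSys]
  off_zero := by simp [offset, toSys]
  off_succ i _ := by
    rw [offset, Finset.sum_range_succ, ← add_assoc, ← add_assoc]
    rfl
  count i hi := by
    have := P.encodeInstance_thread s (k := 0) hi (by omega)
    rw [add_zero] at this
    simp only [this, count_of_lt (P := P) hi]
    simp [threadCode]
  pI i hi := by
    have hi' : i < P.t := hi
    simp only [P.encodeInstance_thread s (k := 1) hi (by omega)]
    simp [threadCode, toSys, hi']
  pF i hi := by
    have hi' : i < P.t := hi
    simp only [P.encodeInstance_thread s (k := 2) hi (by omega)]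
    simp [threadCode, toSys, hi']
  mem q x r := by
    constructor
    · rintro ⟨hq, hx, hr, h⟩
      refine ⟨hq, hx, hr, ?_⟩
      have := P.encodeInstance_table s hq hx hr
      rw [h] at this
      exact fun h0 => absurd (this.symm.trans h0) (by decide)
    · rintro ⟨hq, hx, hr, h⟩
      refine ⟨hq, hx, hr, ?_⟩
      by_contra h'
      rw [Bool.not_eq_true] at h'
      have := P.encodeInstance_table s hq hx hr
      rw [h'] at this
      exact h this
  thread i p x p' := by
    have key : ∀ (hi : i < P.t) (hp : p < P.n ⟨i, hi⟩) (hx : x < P.a) (hp' : p' < P.n ⟨i, hi⟩),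
        (encodeInstance P s).getD (P.offset i + 3 + ((p * P.a + x) * P.count i + p')) 0 =
          ((P.A ⟨i, hi⟩).step ⟨p, hp⟩ ⟨x, hx⟩ ⟨p', hp'⟩).toNat := by
      intro hi hp hx hp'
      have hlt := index_lt hp hx hp'
      rw [add_assoc, P.encodeInstance_thread s hi (by rw [count_of_lt hi]; omega), threadCode,
        List.getD_append_right _ _ _ _ (by simp), count_of_lt hi, ← FinAut.getD_table _ hp hx hp']
      congr 1
      simp
    constructor
    · rintro ⟨hi, hp, hx, hp', h⟩
      have := key hi hp hx hp'
      rw [h] at this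
      rw [count_of_lt hi] at this ⊢
      exact ⟨hi, hp, hx, hp', fun h0 => absurd (this.symm.trans h0) (by decide)⟩
    · rintro ⟨hi, hp, hx, hp', h⟩
      have hi' : i < P.t := hi
      rw [count_of_lt hi'] at hp hp'
      refine ⟨hi, hp, hx, hp', ?_⟩
      by_contra h'
      rw [Bool.not_eq_true] at h'
      have := key hi hp hx hp'
      rw [h'] at this
      exact h this
  B := rfl
  le k := by
    have hB : (P.toSys s).B = P.a + P.m + P.t + 2 * s + 10 +
      ∑ i ∈ Finset.range P.t, P.count i := rfl
    rw [hB]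
    rcases lt_or_ge k (encodeInstance P s).length with hk | hk
    · have hmem : (encodeInstance P s).getD k 0 ∈ encodeInstance P s := by
        rw [List.getD_eq_getElem _ _ hk]
        exact List.getElem_mem hk
      generalize (encodeInstance P s).getD k 0 = y at hmem
      rw [encodeInstance_eq] at hmem
      have hI := P.M.init.2
      have hF := P.M.final.2
      simp only [List.mem_append, List.mem_cons, List.not_mem_nil, or_false, List.mem_flatMap,
        threadCode] at hmem
      rcases hmem with (rfl | rfl | rfl | rfl | rfl | rfl) | h | ⟨i, -, (rfl | rfl | rfl) | h⟩
      any_goals omega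
      · have := P.M.table_le _ h
        omega
      all_goals
        have h1 := P.count_le i.2
        rw [count_of_lt i.2, Fin.eta] at h1
      · omega
      · have := (P.A i).init.2
        omega
      · have := (P.A i).final.2
        omega
      · have := (P.A i).table_le _ h
        omega
    · simp only [List.getD_eq_default _ _ hk]
      omega
  zero k hk := List.getD_eq_default _ _ (by rw [P.length_encodeInstance s]; exact hk)
  qI_lt := P.M.init.2
  qF_lt := P.M.final.2

end SMCP

/-! ### Computations and solutions -/

theorem adj_map {α β : Type*} (th : α → β) (p q : β → Bool) (v : List α) :
    adj (fun e => p (th e)) (fun e => q (th e)) v = adj p q (v.map th) := by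
  induction v with
  | nil => rfl
  | cons e v ih =>
    rw [List.map_cons, adj, adj, ih]
    congr 2
    cases v <;> rfl

theorem grph_congr {α β : Type*} {th : α → ℕ} {th' : β → ℕ} {v : List α} {v' : List β}
    (h : v.map th = v'.map th') : grph th v = grph th' v' := by
  have key : ∀ i j, adj (fun e => th e == i) (fun e => th e == j) v =
      adj (fun e => th' e == i) (fun e => th' e == j) v' := by
    intro i j
    rw [adj_map th (· == i) (· == j), adj_map th' (· == i) (· == j), h]
  simp only [grph, h, key]

namespace SMCP

variable {P : SMCP} {s : ℕ}

/-- The letter without the states of the memory. -/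
def _root_.Ltr.letter (e : Ltr) : ℕ × ℕ := (e.x, e.i)

/-- A letter with numbers instead of elements of `Fin`. -/
def toNats {a t : ℕ} (e : Fin a × Fin t) : ℕ × ℕ := (e.1, e.2)

/-- A run of the memory is stored in the letters themselves, so reachability becomes the existence
of an annotated word. -/
theorem mem_eval_memory (y : List (Fin P.a × Fin P.t)) (q : Fin P.m) :
    q ∈ P.M.toNFA.eval (y.map Prod.fst).reverse ↔
      ∃ v : List Ltr, v.map Ltr.letter = y.map toNats ∧ (P.toSys s).MPath P.M.init v q := by
  induction y generalizing q with
  | nil =>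
    simp only [List.map_nil, List.reverse_nil, NFA.eval_nil, List.map_eq_nil_iff]
    constructor
    · rintro rfl
      exact ⟨[], rfl, rfl⟩
    · rintro ⟨v, rfl, h⟩
      exact Fin.ext (Eq.symm h)
  | cons e y ih =>
    rw [List.map_cons, List.reverse_cons, NFA.eval_append_singleton, NFA.mem_stepSet]
    constructor
    · rintro ⟨p, hp, hs⟩
      obtain ⟨v, hv, hM⟩ := (ih p).1 hp
      exact ⟨⟨p, e.1, e.2, q⟩ :: v, by simp [hv, Ltr.letter, toNats], rfl,
        ⟨p.2, e.1.2, q.2, hs⟩, hM⟩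
    · rintro ⟨v, hv, hM⟩
      cases v with
      | nil => simp at hv
      | cons d v =>
        simp only [List.map_cons, List.cons.injEq] at hv
        obtain ⟨h1, ⟨hq, hx, hr, h2⟩, h3⟩ := hM
        refine ⟨⟨d.q, hq⟩, (ih _).2 ⟨v, hv.2, h3⟩, ?_⟩
        have e1 : (⟨d.x, hx⟩ : Fin P.a) = e.1 := Fin.ext (congrArg Prod.fst hv.1)
        have e2 : (⟨d.r, hr⟩ : Fin P.m) = q := Fin.ext h1
        rw [e1, e2] at h2
        exact h2

theorem mem_eval_thread {i : Fin P.t} (l : List (Fin P.a)) {v : List Ltr}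
    (hv : v.map Ltr.x = l.map Fin.val) (p : Fin (P.n i)) :
    p ∈ (P.A i).toNFA.eval l.reverse ↔ (P.toSys s).APath i (P.A i).init v p := by
  induction l generalizing v p with
  | nil =>
    simp only [List.map_nil, List.map_eq_nil_iff] at hv
    subst hv
    simp only [List.reverse_nil, NFA.eval_nil]
    constructor
    · rintro rfl
      rfl
    · intro h
      exact Fin.ext (Eq.symm h)
  | cons x l ih =>
    cases v with
    | nil => simp at hv
    | cons d v =>
      simp only [List.map_cons, List.cons.injEq] at hv
      rw [List.reverse_cons, NFA.eval_append_singleton, NFA.mem_stepSet]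
      constructor
      · rintro ⟨p₁, hp₁, hs⟩
        refine ⟨p₁, ⟨i.2, p₁.2, hv.1 ▸ x.2, p.2, ?_⟩, (ih hv.2 p₁).1 hp₁⟩
        have e1 : (⟨d.x, hv.1 ▸ x.2⟩ : Fin P.a) = x := Fin.ext hv.1
        rw [e1]
        exact hs
      · rintro ⟨p₁, ⟨hi, hp₁, hx, hp, hs⟩, h⟩
        refine ⟨⟨p₁, hp₁⟩, (ih hv.2 ⟨p₁, hp₁⟩).2 h, ?_⟩
        have e1 : (⟨d.x, hx⟩ : Fin P.a) = x := Fin.ext hv.1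
        rw [e1] at hs
        exact hs

theorem mem_accepts_iff {a n : ℕ} (A : FinAut a n) (u : List (Fin a)) :
    u ∈ A.language ↔ A.final ∈ A.toNFA.eval u := by
  constructor
  · rintro ⟨q, hq, h⟩
    rwa [show q = A.final from hq] at h
  · exact fun h => ⟨A.final, rfl, h⟩

theorem threadProj_reverse {a t : ℕ} (i : Fin t) (y : List (Fin a × Fin t)) :
    threadProj i y.reverse = ((y.filter fun x => x.2 = i).map Prod.fst).reverse := by
  rw [threadProj, List.filter_reverse, List.map_reverse]

theorem map_filter_thread (i : Fin P.t) {v : List Ltr} {y : List (Fin P.a × Fin P.t)}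
    (h : v.map Ltr.letter = y.map toNats) :
    (v.filter (·.i == (i : ℕ))).map Ltr.x =
      ((y.filter fun x => x.2 = i).map Prod.fst).map Fin.val := by
  induction y generalizing v with
  | nil => simp only [List.map_nil, List.map_eq_nil_iff] at h; subst h; rfl
  | cons e y ih =>
    cases v with
    | nil => simp at h
    | cons d v =>
      simp only [List.map_cons, List.cons.injEq, Ltr.letter, toNats, Prod.mk.injEq] at h
      have := ih h.2
      by_cases he : e.2 = i
      · have hd : d.i = i := by rw [h.1.2, he]
        rw [List.filter_cons_of_pos (by simpa using hd), List.filter_cons_of_pos (by simpa using he)]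
        simp [this, h.1.1]
      · have hd : d.i ≠ i := by
          rw [h.1.2]
          exact fun h' => he (Fin.ext h')
        rw [List.filter_cons_of_neg (by simpa using hd), List.filter_cons_of_neg (by simpa using he)]
        exact this

/-- A thread outside the graph has an empty projection, which is always allowed; a thread in the
graph has a nonempty one, so its automaton has to accept. -/
theorem mem_shuffle_iff {v : List Ltr} {y : List (Fin P.a × Fin P.t)}
    (h : v.map Ltr.letter = y.map toNats) :
    y.reverse ∈ P.shuffle ↔ ∀ i ∈ (grph Ltr.i v).V, (P.toSys s).APath i ((P.toSys s).pI i)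
      (v.filter (·.i == i)) ((P.toSys s).pF i) := by
  have hi : v.map Ltr.i = y.map fun e => (e.2 : ℕ) := by
    have := congrArg (List.map Prod.snd) h
    simpa [Function.comp_def, Ltr.letter, toNats] using this
  have hmem : ∀ i, i ∈ (grph Ltr.i v).V ↔ ∃ e ∈ y, (e.2 : ℕ) = i := by
    intro i
    simp only [grph, hi, List.mem_toFinset, List.mem_map]
  have key : ∀ i : Fin P.t, threadProj i y.reverse ∈ (P.A i).language ↔
      (P.toSys s).APath i ((P.toSys s).pI i) (v.filter (·.i == (i : ℕ))) ((P.toSys s).pF i) := by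
    intro i
    rw [mem_accepts_iff, threadProj_reverse, mem_eval_thread (s := s) _ (map_filter_thread i h)]
    simp [toSys]
  have hnil : ∀ i : Fin P.t, threadProj i y.reverse = [] ↔ ¬ ∃ e ∈ y, (e.2 : ℕ) = i := by
    intro i
    rw [threadProj_reverse]
    simp [Fin.ext_iff]
  constructor
  · intro hy i hiV
    obtain ⟨e, he, rfl⟩ := (hmem i).1 hiV
    refine (key e.2).1 ((hy e.2).resolve_right ?_)
    rw [hnil]
    exact fun h => h ⟨e, he, rfl⟩
  · intro hv i
    by_cases hiV : (i : ℕ) ∈ (grph Ltr.i v).V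
    · exact .inl ((key i).2 (hv i hiV))
    · rw [hmem] at hiV
      exact .inr ((hnil i).2 hiV)

theorem sdim_schedulingGraph_nil (a t : ℕ) : (schedulingGraph ([] : List (Fin a × Fin t))).sdim = 0 := by
  rw [MGraph.sdim, Nat.sInf_eq_zero]
  right
  rw [Set.eq_empty_iff_forall_notMem]
  rintro d ⟨π, h, -⟩
  have h1 := h.length
  have h2 := h.head
  rw [List.length_eq_zero_iff.1 (h1.trans rfl)] at h2
  simp at h2

/-- The problem in terms of solutions. -/
theorem bcsLsd_iff : BCSLsd P s ↔
    (P.toSys s).qI = (P.toSys s).qF ∨ ∃ v, (P.toSys s).Solution v := by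
  have main : ∀ (v : List Ltr) (y : List (Fin P.a × Fin P.t)), v ≠ [] →
      v.map Ltr.letter = y.map toNats → (y.reverse ∈ sdimLang P.a P.t s ↔
      (grph Ltr.i v).Carve s (grph Ltr.i v).V) := by
    intro v y hne h
    have hi : y.map (fun e => (e.2 : ℕ)) = v.map Ltr.i := by
      have := congrArg (List.map Prod.snd) h
      simpa [Function.comp_def, Ltr.letter, toNats] using this.symm
    have : schedulingGraph y.reverse = grph Ltr.i v := by
      rw [schedulingGraph_eq_grph, grph_congr hi]
    rw [sdimLang, Set.mem_ofPred_eq, this, MGraph.sdim_le_iff (grph_loopless _ _)]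
    obtain ⟨e, v, rfl⟩ := List.exists_cons_of_ne_nil hne
    exact ⟨e.i, by simp [grph]⟩
  constructor
  · rintro ⟨u, ⟨hM, hsh⟩, hs⟩
    obtain ⟨y, rfl⟩ : ∃ y, u = y.reverse := ⟨u.reverse, by simp⟩
    by_cases hy : y = []
    · subst hy
      left
      have := (mem_accepts_iff _ _).1 hM
      simp only [List.reverse_nil, List.map_nil, NFA.eval_nil] at this
      exact congrArg Fin.val (Eq.symm this)
    · right
      have hM' := (mem_accepts_iff _ _).1 hM
      rw [List.map_reverse, mem_eval_memory (s := s)] at hM'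
      obtain ⟨v, hv, hMP⟩ := hM'
      have hne : v ≠ [] := by
        rintro rfl
        exact hy (by simpa using hv.symm)
      exact ⟨v, hne, hMP, (mem_shuffle_iff hv).1 hsh, (main v y hne hv).1 hs⟩
  · rintro (h | ⟨v, hne, hMP, hA, hC⟩)
    · refine ⟨[], ⟨?_, fun i => .inr rfl⟩, ?_⟩
      · refine (mem_accepts_iff _ _).2 ?_
        simp only [List.map_nil, NFA.eval_nil]
        exact Fin.ext h.symm
      · exact (sdim_schedulingGraph_nil _ _).le.trans (Nat.zero_le _)
    · have hlt : ∀ {q r : ℕ} {v : List Ltr}, (P.toSys s).MPath q v r → ∀ e ∈ v, e.x < P.a := by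
        intro q r v hv
        induction v generalizing r with
        | nil => simp
        | cons d v ih =>
          obtain ⟨-, ⟨-, hx, -⟩, h⟩ := hv
          rintro e he
          rcases List.mem_cons.1 he with rfl | he
          exacts [hx, ih h e he]
      have hti : ∀ e ∈ v, e.i < P.t := by
        intro e he
        have hmem : e.i ∈ (grph Ltr.i v).V := by
          simp only [grph, List.mem_toFinset, List.mem_map]
          exact ⟨e, he, rfl⟩
        have := hA e.i hmem
        have hef : e ∈ v.filter (·.i == e.i) := by simp [he]
        obtain ⟨d, l, hl⟩ := List.exists_cons_of_ne_nil (List.ne_nil_of_mem hef)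
        rw [hl] at this
        obtain ⟨_, ⟨hi, _⟩, -⟩ := this
        exact hi
      -- The letters of a solution lie in range, operations by the memory run and threads by their
      -- own runs, so the word lifts back to `Fin`.
      obtain ⟨y, hy⟩ : ∃ y : List (Fin P.a × Fin P.t), v.map Ltr.letter = y.map toNats := by
        have hx := hlt hMP
        clear hMP hA hC hne hlt
        induction v with
        | nil => exact ⟨[], rfl⟩
        | cons e v ih =>
          obtain ⟨y, hy⟩ := ih (fun e he => hti e (List.mem_cons_of_mem _ he))
            fun e he => hx e (List.mem_cons_of_mem _ he)
          exact ⟨(⟨e.x, hx e (by simp)⟩, ⟨e.i, hti e (by simp)⟩) :: y, by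
            simp [hy, Ltr.letter, toNats]⟩
      refine ⟨y.reverse, ⟨?_, (mem_shuffle_iff hy).2 hA⟩, (main v y hne hy).2 hC⟩
      refine (mem_accepts_iff _ _).2 ?_
      rw [List.map_reverse, mem_eval_memory (s := s)]
      exact ⟨v, hy, hMP⟩

end SMCP

/-! ### The running time -/

/-- The power is at most `e.factorial * (s + e).choose e`, and the binomial coefficient times `9 ^
s` is bounded by a single term in the expansion of `(9 + 7) ^ (s + e)`. -/
theorem pow_mul_nine_pow_le (e s : ℕ) : (s + 1) ^ e * 9 ^ s ≤ e.factorial * 16 ^ e * 16 ^ s := by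
  have h1 : (s + 1) ^ e ≤ e.factorial * (s + e).choose e := by
    rw [← Nat.ascFactorial_eq_factorial_mul_choose]
    exact Nat.pow_succ_le_ascFactorial _ _
  have h2 : (s + e).choose e * 9 ^ s ≤ 16 ^ (s + e) := by
    have h := add_pow 9 7 (s + e)
    have hs := Finset.single_le_sum
      (f := fun k => 9 ^ k * 7 ^ (s + e - k) * ((s + e).choose k)) (fun _ _ => Nat.zero_le _)
      (Finset.mem_range.2 (show s < s + e + 1 by omega))
    have h7 : 1 ≤ 7 ^ (s + e - s) := Nat.one_le_pow _ _ (by norm_num)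
    have hc : (s + e).choose s = (s + e).choose e := Nat.choose_symm_add
    simp only [hc] at hs
    calc (s + e).choose e * 9 ^ s = 9 ^ s * 1 * (s + e).choose e := by ring
      _ ≤ 9 ^ s * 7 ^ (s + e - s) * (s + e).choose e := by gcongr
      _ ≤ _ := hs
      _ = 16 ^ (s + e) := h.symm
  calc (s + 1) ^ e * 9 ^ s ≤ e.factorial * (s + e).choose e * 9 ^ s := by gcongr
    _ = e.factorial * ((s + e).choose e * 9 ^ s) := by ring
    _ ≤ e.factorial * 16 ^ (s + e) := by gcongr
    _ = _ := by ring

theorem Sys.radProd_eq (S : Sys) : radProd S.rad S.numDigits =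
    S.B ^ 9 * 3 ^ (S.t + 2 * S.s + 2) * S.m ^ (4 * S.s + 4) := by
  have e : S.numDigits = 9 + (S.t + 2 * S.s + 2) + (4 * S.s + 4) := by
    simp only [numDigits, stPos]; omega
  have e' : S.stPos = 9 + (S.t + 2 * S.s + 2) := by simp only [stPos]; omega
  rw [radProd, e, Finset.prod_range_add, Finset.prod_range_add]
  congr 1
  · congr 1
    · rw [Finset.prod_congr rfl fun j hj => rad_small (Finset.mem_range.1 hj)]
      simp
    · rw [Finset.prod_congr rfl (g := fun _ => 3)]
      · simp
      · intro j hj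
        have := Finset.mem_range.1 hj
        rw [rad, if_neg (by omega), if_pos (by omega)]
  · rw [Finset.prod_congr rfl (g := fun _ => S.m)]
    · simp
    · intro j _
      rw [rad, if_neg (by omega), if_neg (by omega)]

theorem RAM.exists_work_le : ∃ A k : ℕ, ∀ B, RAM.work B ≤ A * (B + 1) ^ k := by
  obtain ⟨A, k, h⟩ := Cm.exists_bd_le (seqs [setup, clearWork, iteration, finish])
  refine ⟨A * 5 ^ k + 5, k + 1, fun B => ?_⟩
  have h1 := h (5 * B)
  have h2 : (5 * B + 1) ^ k ≤ 5 ^ k * (B + 1) ^ (k + 1) := by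
    calc (5 * B + 1) ^ k ≤ (5 * (B + 1)) ^ k := Nat.pow_le_pow_left (by omega) _
      _ = 5 ^ k * (B + 1) ^ k := mul_pow _ _ _
      _ ≤ 5 ^ k * (B + 1) ^ (k + 1) :=
        Nat.mul_le_mul_left _ (Nat.pow_le_pow_right (by omega) (by omega))
  have h3 : B + 1 ≤ (B + 1) ^ (k + 1) := Nat.le_self_pow (by omega) _
  have h4 : A * (5 * B + 1) ^ k ≤ A * (5 ^ k * (B + 1) ^ (k + 1)) := Nat.mul_le_mul_left _ h2
  have h5 : (A * 5 ^ k + 5) * (B + 1) ^ (k + 1) =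
      A * (5 ^ k * (B + 1) ^ (k + 1)) + 5 * (B + 1) ^ (k + 1) := by ring
  unfold work
  omega

/-- `B` is linear in `s` itself, whereas the size of the instance only counts the binary length of
`s`; hence the separate factor `s + 1`. The memory has an initial state, so the size is positive. -/
theorem SMCP.B_le (P : SMCP) (s : ℕ) :
    (P.toSys s).B + 1 ≤ 12 * (instanceSize P s * (s + 1)) ∧ P.m ≤ instanceSize P s := by
  have hm : 0 < P.m := Nat.zero_lt_of_lt P.M.init.2
  have hsum : ∑ i ∈ Finset.range P.t, P.count i = ∑ i, P.n i := by
    rw [Finset.sum_range]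
    exact Finset.sum_congr rfl fun i _ => count_of_lt i.2
  have hB : (P.toSys s).B = P.a + P.m + P.t + 2 * s + 10 +
    ∑ i ∈ Finset.range P.t, P.count i := rfl
  rw [hB, hsum]
  unfold instanceSize
  refine ⟨?_, by omega⟩
  generalize ∑ i, P.n i = n
  generalize Nat.size s = l
  nlinarith [Nat.zero_le (P.a * s), Nat.zero_le (P.t * s), Nat.zero_le (n * s),
    Nat.zero_le (l * s), Nat.mul_le_mul_right s hm]

theorem RAM.exists_time_le : ∃ C c : ℕ, ∀ (P : SMCP) (s : ℕ),
    (((P.toSys s).B ^ 4 + (P.toSys s).B) * radProd (P.toSys s).rad (P.toSys s).numDigits + 1) *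
      (100 * (work (P.toSys s).B * work (P.toSys s).B)) ≤
    C * ((2 * P.m) ^ (4 * s) * 4 ^ P.t) * instanceSize P s ^ c := by
  obtain ⟨A, k, hA⟩ := exists_work_le
  -- The power of `B + 1` in the running time: `13` for the rounds and the nine small digits, and `2
  -- * k` for the squared work of one iteration. The constant `2700` is `3 * 3 ^ 2 * 100`.
  set e := 13 + 2 * k with he
  refine ⟨2700 * A ^ 2 * 12 ^ e * (e.factorial * 16 ^ e), e + 4, fun P s => ?_⟩
  obtain ⟨h1, h2⟩ := P.B_le s
  have hB10 := (P.toSys s).hB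
  have hm : 0 < P.m := Nat.zero_lt_of_lt P.M.init.2
  rw [Sys.radProd_eq]
  have hw := hA (P.toSys s).B
  change ((_ : ℕ) * ((P.toSys s).B ^ 9 * 3 ^ (P.t + 2 * s + 2) * P.m ^ (4 * s + 4)) + 1) * _ ≤ _
  generalize (P.toSys s).B = B at *
  generalize instanceSize P s = N at *
  generalize P.m = m at *
  generalize P.t = t at *
  have hX : 1 ≤ 3 ^ (t + 2 * s + 2) * m ^ (4 * s + 4) :=
    Nat.mul_pos (by positivity) (Nat.pow_pos hm)
  have hK : (B ^ 4 + B) * (B ^ 9 * 3 ^ (t + 2 * s + 2) * m ^ (4 * s + 4)) + 1 ≤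
      3 * (B + 1) ^ 13 * (3 ^ (t + 2 * s + 2) * m ^ (4 * s + 4)) := by
    have b1 : (B ^ 4 + B) * B ^ 9 ≤ 2 * (B + 1) ^ 13 := by
      have c1 : B ^ 13 ≤ (B + 1) ^ 13 := Nat.pow_le_pow_left (by omega) _
      have c2 : B ^ 10 ≤ (B + 1) ^ 13 :=
        (Nat.pow_le_pow_left (by omega) _).trans (Nat.pow_le_pow_right (by omega) (by norm_num))
      calc (B ^ 4 + B) * B ^ 9 = B ^ 13 + B ^ 10 := by ring
        _ ≤ _ := by omega
    have b2 : 1 ≤ (B + 1) ^ 13 := Nat.one_le_pow _ _ (by omega)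
    calc (B ^ 4 + B) * (B ^ 9 * 3 ^ (t + 2 * s + 2) * m ^ (4 * s + 4)) + 1
        ≤ (B ^ 4 + B) * B ^ 9 * (3 ^ (t + 2 * s + 2) * m ^ (4 * s + 4)) +
          1 * (3 ^ (t + 2 * s + 2) * m ^ (4 * s + 4)) := by
          rw [one_mul]
          exact Nat.add_le_add (le_of_eq (by ring)) hX
      _ = ((B ^ 4 + B) * B ^ 9 + 1) * (3 ^ (t + 2 * s + 2) * m ^ (4 * s + 4)) := by ring
      _ ≤ 3 * (B + 1) ^ 13 * (3 ^ (t + 2 * s + 2) * m ^ (4 * s + 4)) :=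
        Nat.mul_le_mul_right _ (by omega)
  have h3 := pow_mul_nine_pow_le e s
  calc _ ≤ 3 * (B + 1) ^ 13 * (3 ^ (t + 2 * s + 2) * m ^ (4 * s + 4)) *
        (100 * (A * (B + 1) ^ k * (A * (B + 1) ^ k))) := by gcongr
    _ = 2700 * A ^ 2 * (B + 1) ^ e * 3 ^ t * 9 ^ s * m ^ 4 * m ^ (4 * s) := by
      rw [he, pow_add 3 (t + 2 * s) 2, pow_add 3 t (2 * s), pow_mul 3 2 s]
      ring
    _ ≤ 2700 * A ^ 2 * (12 * (N * (s + 1))) ^ e * 4 ^ t * 9 ^ s * N ^ 4 * m ^ (4 * s) := by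
      gcongr
      norm_num
    _ = 2700 * A ^ 2 * 12 ^ e * ((s + 1) ^ e * 9 ^ s) * (m ^ (4 * s) * 4 ^ t) * N ^ (e + 4) := by
      rw [mul_pow, mul_pow]
      ring
    _ ≤ 2700 * A ^ 2 * 12 ^ e * (e.factorial * 16 ^ e * 16 ^ s) * (m ^ (4 * s) * 4 ^ t) *
        N ^ (e + 4) := by gcongr
    _ = _ := by
      rw [mul_pow, pow_mul 2 4 s, show 2 ^ 4 = 16 from rfl]
      ring

/-- One program decides all instances `(S, s)` in time `O*((2m)^(4s) * 4^t)`: up to a constant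
factor and a polynomial in the size of the instance, in time `(2m)^(4s) * 4^t`. -/
theorem mainTheorem5 :
    ∃ (p : RAM.Prog) (C c : ℕ), ∀ (S : SMCP) (s : ℕ),
      RAM.DecidesWithin p (encodeInstance S s) (BCSLsd S s)
        (C * ((2 * S.m) ^ (4 * s) * 4 ^ S.t) * instanceSize S s ^ c) := by
  obtain ⟨C, c, h⟩ := RAM.exists_time_le
  refine ⟨RAM.program.comp 0, C, c, fun S s => ?_⟩
  obtain ⟨ν, k, hx, hk, hyes, hno⟩ := RAM.program_spec (S.input s)
  exact ⟨ν, k, hx, hk.trans (h S s), fun hP => hyes (SMCP.bcsLsd_iff.1 hP),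
    fun hP => hno fun h' => hP (SMCP.bcsLsd_iff.2 h')⟩
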